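/- **Theorem 1.2.** Let $\mathbb G_+$ be an $n\times n$ grid diagram of a knot, with exactly one $X$ and one $O$ in each row and column and never both in one square. Let $\mathbb G_-$ be obtained from $\mathbb G_+$ by a cross-commutation of columns: two consecutive columns are interchanged, where the interiors of the vertical intervals spanned by the markings of the two columns intersect but neither interval contains the other. Suppose that the crossing changed in this way is positive in $\mathbb G_+$ (negative in $\mathbb G_-$); equivalently, going up cyclically in $\mathbb G_+$, one meets the $X$ of the right column, the $X$ of the left column, the $O$ of the right column and the $O$ of the left column in this cyclic order. (Vertical segments are oriented from $X$ to $O$ and pass over horizontal ones.) *The filtered grid complex.* View the diagrams on the torus, with horizontal and vertical grid circles. A grid state $\mathbf x\in\mathbf S(\mathbb G)$ is an $n$-tuple of points with exactly one on each horizontal and one on each vertical circle. The complex $\mathcal{GC}^-(\mathbb G)$ is the free module over $\mathbb F_2[V_1,\dots,V_n]$ on $\mathbf S(\mathbb G)$, with differential $$\partial^-\mathbf x=\sum_{\mathbf y}\ \sum_{r\in\mathrm{Rect}^\circ(\mathbf x,\mathbf y)}V_1^{O_1(r)}\cdots V_n^{O_n(r)}\,\mathbf y ,$$ where $O_i(r)\in\{0,1\}$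 records whether $r$ contains the marking $O_i$. For finite sets $P,Q$ in the plane let $I(P,Q)$ be the number of pairs $(p,q)\in P\times Q$ with $p_1<q_1$ and $p_2<q_2$, let $\mathcal J(P,Q)=\frac12(I(P,Q)+I(Q,P))$, and extend $\mathcal J$ bilinearly. Put $M_{\mathbb O}(\mathbf x)=\mathcal J(\mathbf x-\mathbb O,\mathbf x-\mathbb O)+1$, likewise $M_{\mathbb X}$, and $M=M_{\mathbb O}$, $A=\frac12(M_{\mathbb O}-M_{\mathbb X})-\frac{n-1}2$. The part $\mathcal C_d$ of Maslov grading $d$ is the $\mathbb F_2$-span of the $V_1^{k_1}\cdots V_n^{k_n}\mathbf x$ with $M(\mathbf x)-2\sum k_i=d$, and $\mathcal F_s\mathcal C$ is the span of those with $A(\mathbf x)-\sum k_i\le s$. A module map $f$ is homogeneous of degree $(m,t)$ if $f(\mathcal C_d)\subseteq\mathcal C'_{d+m}$ and $f(\mathcal F_s\mathcal C)\subseteq\mathcal F_{s+t}\mathcal C'$ for all $d,s\in\mathbb Z$. A filtered chain homotopy between maps $f,g$ of degree $(m,t)$ is a module map $H$, homogeneous of degree $(m+1,t)$, with $\partial H+H\partial=f-g$.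 *The common diagram.* Draw both diagrams on one torus with the same markings, so that they differ only in the vertical circle between the two columns, which is $\beta$ for $\mathbb G_+$ and $\gamma$ for $\mathbb G_-$. The circles $\beta$ and $\gamma$ meet in four points, off the horizontal circles, and bound four bigons, each containing exactly one of the four markings of the two columns. Let $t$ be the common vertex of the two bigons marked $X$. Name the two $O$s of these columns $O_1$ and $O_2$, in either way, and let $s$ be the common vertex of the bigon marked $O_2$ and a bigon marked $X$. *Polygons.* A rectangle, pentagon or hexagon from $\mathbf x$ to $\mathbf y$ is an embedded disk in the torus with $4$, $5$ or $6$ corners, whose sides are arcs of grid circles (for pentagons and hexagons, of the horizontal circles, the common vertical circles, $\beta$ and $\gamma$), which contains exactly one of the four quadrants at each corner, has four corners in $\mathbf x\cup\mathbf y$ and the others in $\beta\cap\gamma$, and for which the part of its oriented boundary on the horizontal circles has boundary $\mathbf y-\mathbf x$. It is empty if its interior contains no point of $\mathbf x$ or $\mathbf y$. Let $\mathrm{Pent}^\circ_s$ and $\mathrm{Pent}^\circ_t$ be the sets of empty pentagons with a corner at $s$, respectively $t$; let $\mathrm{Hex}^\circ_{t,s}$ be the set of empty hexagons with consecutive corners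 $t$, $s$ in this order along the boundary orientation, and $\mathrm{Hex}^\circ_{s,t}$ the same with the opposite order. *Claim.* Let $\mathcal C_-:\mathcal{GC}^-(\mathbb G_+)\to\mathcal{GC}^-(\mathbb G_-)$, $\mathcal C_+:\mathcal{GC}^-(\mathbb G_-)\to\mathcal{GC}^-(\mathbb G_+)$, $\mathcal H_+$ on $\mathcal{GC}^-(\mathbb G_+)$ and $\mathcal H_-$ on $\mathcal{GC}^-(\mathbb G_-)$ be the $\mathbb F_2[V_1,\dots,V_n]$-linear maps that send a grid state $\mathbf x$ to $\sum_{\mathbf y}\sum_{p}V_1^{O_1(p)}\cdots V_n^{O_n(p)}\,\mathbf y$, where $p$ runs over $\mathrm{Pent}^\circ_s(\mathbf x,\mathbf y)$, $\mathrm{Pent}^\circ_t(\mathbf x,\mathbf y)$, $\mathrm{Hex}^\circ_{t,s}(\mathbf x,\mathbf y)$ and $\mathrm{Hex}^\circ_{s,t}(\mathbf x,\mathbf y)$ respectively. Then $\mathcal C_-$ and $\mathcal C_+$ are chain maps, homogeneous of degrees $(0,0)$ and $(-2,-1)$ respectively. Moreover $\mathcal C_+\circ\mathcal C_-$ and $\mathcal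 C_-\circ\mathcal C_+$ are filtered chain homotopic to multiplication by $V_1$, through $\mathcal H_+$ and $\mathcal H_-$ respectively: $$\partial^-\mathcal H_++\mathcal H_+\partial^-=\mathcal C_+\mathcal C_--V_1,\qquad \partial^-\mathcal H_-+\mathcal H_-\partial^-=\mathcal C_-\mathcal C_+-V_1,$$ and $\mathcal H_+$ and $\mathcal H_-$ are homogeneous of degree $(-1,-1)$. -/

import Mathlib

noncomputable section

namespace GridHomology

/-! Conventions.  The grid torus is drawn as an `n × n` square with opposite sides identified.
Columns and rows are numbered `0, …, n - 1` from left to right and from bottom to top.  The vertical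
circle `β_m` is the left edge of column `m`, the horizontal circle `α_j` is the bottom edge of
row `j`.  In scaled coordinates `β_m` sits at horizontal position `2 m` and the centre of column `c`
at `2 c + 1`; vertically, `α_j` sits at height `4 j`, the centre of row `j` (where its markings are)
at height `4 j + 2`, and the odd heights are available for intersection points of two vertical
circles. -/

/-- `b` is met strictly between `a` and `c` when one runs from `a` in the positive direction around
a circle. -/
def CycLT (a b c : ℕ) : Prop := (a < b ∧ b < c) ∨ (b < c ∧ c < a) ∨ (c < a ∧ a < b)

instance (a b c : ℕ) : Decidable (CycLT a b c) := by
  unfold CycLT; infer_instance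

/-- A planar grid diagram of grid number `n`: `O c` and `X c` are the rows of the `O` and of the `X`
in column `c`. -/
structure GridDiagram (n : ℕ) where
  O : Equiv.Perm (Fin n)
  X : Equiv.Perm (Fin n)
  ne : ∀ c, O c ≠ X c

/-- A grid state, as a permutation: its point on `β_m` is `β_m ∩ α_(x m)`. -/
abbrev GridState (n : ℕ) : Type := Equiv.Perm (Fin n)

/-- The base ring `𝔽₂[V_1, …, V_n]`; the variable attached to an `O` is indexed by its row. -/
abbrev BaseRing (n : ℕ) : Type := MvPolynomial (Fin n) (ZMod 2)

namespace GridDiagram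

variable {n : ℕ}

/-- The oriented link of the diagram has exactly one component.  Following a component from the `X`
to the `O` of column `c` and then along the row of that `O` to its `X`, one arrives in
column `X⁻¹ (O c)`. -/
def IsKnot (G : GridDiagram n) : Prop := (G.X⁻¹ * G.O).IsCycleOn Set.univ

/-! ### Gradings -/

/-- The number of pairs `p ∈ P`, `q ∈ Q` with `q` strictly to the upper right of `p`. -/
def pairCount (P Q : Finset (ℕ × ℕ)) : ℤ :=
  (((P ×ˢ Q).filter fun w => w.1.1 < w.2.1 ∧ w.1.2 < w.2.2).card : ℤ)

/-- The points of a grid state in the plane (all coordinates doubled). -/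
def statePoints (x : GridState n) : Finset (ℕ × ℕ) :=
  Finset.univ.image fun m : Fin n => (2 * (m : ℕ), 2 * (x m : ℕ))

/-- The centres of the squares `(c, σ c)` in the plane (all coordinates doubled). -/
def markPoints (σ : Equiv.Perm (Fin n)) : Finset (ℕ × ℕ) :=
  Finset.univ.image fun c : Fin n => (2 * (c : ℕ) + 1, 2 * (σ c : ℕ) + 1)

/-- `𝒥(x - S, x - S) + 1`, where `S` is the set of markings in the squares `(c, σ c)` and
`𝒥(P, Q) = (I(P, Q) + I(Q, P)) / 2` is extended bilinearly. -/
def maslovOf (σ : Equiv.Perm (Fin n)) (x : GridState n) : ℤ :=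
  pairCount (statePoints x) (statePoints x) - pairCount (statePoints x) (markPoints σ)
    - pairCount (markPoints σ) (statePoints x) + pairCount (markPoints σ) (markPoints σ) + 1

/-- The Maslov grading `M = M_𝕆` of a grid state. -/
def maslov (G : GridDiagram n) (x : GridState n) : ℤ := maslovOf G.O x

/-- The Alexander function `A = (M_𝕆 - M_𝕏) / 2 - (n - 1) / 2` of a grid state. -/
def alexander (G : GridDiagram n) (x : GridState n) : ℚ :=
  ((maslovOf G.O x : ℚ) - (maslovOf G.X x : ℚ)) / 2 - ((n : ℚ) - 1) / 2

/-! ### Polygons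

A rectangle, pentagon or hexagon starting at the grid state `x` is encoded by the pair `p = (a, b)`
of the (distinct) indices of the vertical circles on its left and on its right side.  Its boundary
orientation makes the horizontal sides run from `x` to the terminal state, so its lower left corner
is the point of `x` on the circle `a`, its upper right corner is the point of `x` on the circle `b`,
it extends upward from `α_(x a)` to `α_(x b)` and to the right from circle `a` to circle `b`, and
the terminal state is `x ∘ (a b)`. -/

/-- The polygons with side circles `a ≠ b` that lead from `x` to `y`. -/
def boxes (x y : GridState n) : Finset (Fin n × Fin n) :=
  Finset.univ.filter fun p => p.1 ≠ p.2 ∧ y = x * Equiv.swap p.1 p.2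

/-- No point of `x` lies in the interior.  (The terminal state has the same points as `x` apart from
the corners.) -/
def IsEmptyBox (x : GridState n) (p : Fin n × Fin n) : Prop :=
  ∀ m : Fin n, ¬ (CycLT p.1 m p.2 ∧ CycLT (x p.1) (x m) (x p.2))

instance (x : GridState n) (p : Fin n × Fin n) : Decidable (IsEmptyBox x p) := by
  unfold IsEmptyBox; infer_instance

/-- The `O` of row `ρ` lies in the polygon `p`, provided that at the height of that `O` the vertical
sides of the polygon run along vertical circles of `G`: the row is within the vertical extent, and
the column of the `O` in `G` is within the horizontal extent. -/
def CoversO (G : GridDiagram n) (x : GridState n) (p : Fin n × Fin n) (ρ : Fin n) : Prop :=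
  CycLT (4 * (x p.1 : ℕ)) (4 * (ρ : ℕ) + 2) (4 * (x p.2 : ℕ)) ∧
    CycLT (2 * (p.1 : ℕ)) (2 * (G.O.symm ρ : ℕ) + 1) (2 * (p.2 : ℕ))

instance (G : GridDiagram n) (x : GridState n) (p : Fin n × Fin n) (ρ : Fin n) :
    Decidable (CoversO G x p ρ) := by
  unfold CoversO; infer_instance

/-- `V_1^{O_1(p)} ⋯ V_n^{O_n(p)}` for a polygon whose vertical sides run, at the height of row `ρ`,
along vertical circles of the diagram `side ρ`. -/
def monomialOf (side : Fin n → GridDiagram n) (x : GridState n) (p : Fin n × Fin n) : BaseRing n :=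
  ∏ ρ : Fin n, (MvPolynomial.X ρ : BaseRing n) ^ (if CoversO (side ρ) x p ρ then 1 else 0)

/-! ### The filtered grid complex -/

/-- The module underlying the filtered grid complex: free over `𝔽₂[V_1, …, V_n]` on the grid
states. -/
abbrev Complex (_G : GridDiagram n) : Type := GridState n →₀ BaseRing n

/-- The empty rectangles from `x` to `y`. -/
def emptyRectangles (x y : GridState n) : Finset (Fin n × Fin n) :=
  (boxes x y).filter fun p => IsEmptyBox x p

/-- The differential `∂⁻`, counting all empty rectangles, including those that contain `X`s. -/
def differential (G : GridDiagram n) : G.Complex →ₗ[BaseRing n] G.Complex :=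
  Finsupp.linearCombination (BaseRing n) fun x : GridState n =>
    ∑ y : GridState n, ∑ p ∈ emptyRectangles x y,
      Finsupp.single y (monomialOf (fun _ => G) x p)

/-- The part of Maslov grading `d`: the span of the `V^k · x` with `M(x) - 2 |k| = d`. -/
def gradedPart (G : GridDiagram n) (d : ℤ) : Submodule (ZMod 2) G.Complex :=
  Submodule.span (ZMod 2) {z | ∃ (k : Fin n →₀ ℕ) (x : GridState n),
    G.maslov x - 2 * (k.degree : ℤ) = d ∧ z = Finsupp.single x (MvPolynomial.monomial k 1)}

/-- The Alexander filtration: `ℱ_s` is the span of the `V^k · x` with `A(x) - |k| ≤ s`. -/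
def filtration (G : GridDiagram n) (s : ℤ) : Submodule (ZMod 2) G.Complex :=
  Submodule.span (ZMod 2) {z | ∃ (k : Fin n →₀ ℕ) (x : GridState n),
    G.alexander x - (k.degree : ℚ) ≤ (s : ℚ) ∧ z = Finsupp.single x (MvPolynomial.monomial k 1)}

/-- `f` commutes with the differentials. -/
def IsChainMap (G G' : GridDiagram n) (f : G.Complex →ₗ[BaseRing n] G'.Complex) : Prop :=
  f ∘ₗ G.differential = G'.differential ∘ₗ f

/-- `f` is homogeneous of degree `(m, t)`: it maps Maslov grading `d` to `d + m` and filtration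
level `s` to `s + t`. -/
def HomogeneousOfDegree (G G' : GridDiagram n) (f : G.Complex →ₗ[BaseRing n] G'.Complex)
    (m t : ℤ) : Prop :=
  (∀ d : ℤ, ∀ z ∈ G.gradedPart d, f z ∈ G'.gradedPart (d + m)) ∧
    (∀ s : ℤ, ∀ z ∈ G.filtration s, f z ∈ G'.filtration (s + t))

/-- `H` is a filtered chain homotopy between the maps `f` and `g` of degree `(m, t)`. -/
def IsFilteredHomotopy (G G' : GridDiagram n) (H f g : G.Complex →ₗ[BaseRing n] G'.Complex)
    (m t : ℤ) : Prop :=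
  G'.differential ∘ₗ H + H ∘ₗ G.differential = f - g ∧ HomogeneousOfDegree G G' H (m + 1) t

/-! ### Cross-commutations -/

/-- The interval of heights spanned by the two markings of column `c`, as the pair of its ends. -/
def interval (G : GridDiagram n) (c : Fin n) : Fin n × Fin n :=
  (min (G.O c) (G.X c), max (G.O c) (G.X c))

/-- `G'` arises from `G` by a cross-commutation of the consecutive columns `l` and `r`: the columns
are interchanged, and the interiors of their intervals meet although neither interval contains the
other. -/
def CrossCommutation (G G' : GridDiagram n) (l r : Fin n) : Prop :=
  (r : ℕ) = (l : ℕ) + 1 ∧ G'.O = G.O * Equiv.swap l r ∧ G'.X = G.X * Equiv.swap l r ∧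
    max (G.interval l).1 (G.interval r).1 < min (G.interval l).2 (G.interval r).2 ∧
    ¬ ((G.interval l).1 ≤ (G.interval r).1 ∧ (G.interval r).2 ≤ (G.interval l).2) ∧
    ¬ ((G.interval r).1 ≤ (G.interval l).1 ∧ (G.interval l).2 ≤ (G.interval r).2)

/-- Going up around the torus, the markings of the columns `l` and `r` are met in the cyclic order
`X` of `r`, `X` of `l`, `O` of `r`, `O` of `l`.  Of the two diagrams related by a cross-commutation
this singles out the one in which the crossing that changes is positive.  For instance, if both
strands run upward (vertical segments are oriented from `X` to `O` and pass over), it says that the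
column `l` has the higher interval, and if one runs upward and one downward, that `l` has the lower
one. -/
def PositiveAt (G : GridDiagram n) (l r : Fin n) : Prop :=
  CycLT (G.X r) (G.X l) (G.O r) ∧ CycLT (G.O r) (G.O l) (G.X r)

end GridDiagram

open GridDiagram

/-- A crossing change between `plus` (positive crossing) and `minus` (negative crossing), with the
choices that are needed to draw both diagrams on one torus.

The common markings stay fixed; the circle `β` of `plus` and the circle `γ` of `minus` that separate
the columns `left` and `right` both have the index `right`.  Where a marking of one of the two
columns is met, `β` and `γ` pass on different sides of it.  So they bound four bigons, one around
each of these markings, and meet once between any two cyclically consecutive ones.  Each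
intersection point can be placed at any odd height there. -/
structure CrossingChange (n : ℕ) where
  plus : GridDiagram n
  minus : GridDiagram n
  left : Fin n
  right : Fin n
  cross : CrossCommutation plus minus left right
  positive : plus.PositiveAt left right
  /-- The row of the marking `O_1`. -/
  o₁ : Fin n
  /-- The row of the marking `O_2`. -/
  o₂ : Fin n
  /-- `O_1` and `O_2` are the two `O`s of the two columns, named in either way. -/
  o_mem : (o₁ = plus.O left ∧ o₂ = plus.O right) ∨ (o₁ = plus.O right ∧ o₂ = plus.O left)
  /-- The height of the common vertex `t` of the two bigons marked `X`. -/
  t : ℕ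
  t_odd : t % 2 = 1
  t_lt : t < 4 * n
  t_between : CycLT (4 * (plus.X right : ℕ) + 2) t (4 * (plus.X left : ℕ) + 2)
  /-- The height of the common vertex `s` of the bigon marked `O_2` and a bigon marked `X`. -/
  s : ℕ
  s_odd : s % 2 = 1
  s_lt : s < 4 * n
  s_between :
    (o₂ = plus.O right ∧ CycLT (4 * (plus.X left : ℕ) + 2) s (4 * (plus.O right : ℕ) + 2)) ∨
    (o₂ = plus.O left ∧ CycLT (4 * (plus.O left : ℕ) + 2) s (4 * (plus.X right : ℕ) + 2))

namespace CrossingChange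

variable {n : ℕ}

/-! A pentagon from a state of `G` to a state of `G'` (`G` and `G'` being `plus` and `minus` in some
order) has one plain side, on a circle `β_k` common to both diagrams, and one side broken at the
intersection point.  The latter starts, at the corner in the initial state, along the special circle
of `G` and arrives, at the corner in the terminal state, along the special circle of `G'`.  On a left
side the initial corner is the lower end, on a right side it is the upper end.  Passing `s` upward,
`γ` changes from the left to the right of `β`, at `t` it is the other way round; hence the corner
at `s` contains exactly one quadrant for pentagons from `plus` to `minus`, and the corner at `t` for
pentagons from `minus` to `plus`. -/

/-- The empty pentagons from `x` to `y` with a vertex at the intersection point at height `h`. -/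
def emptyPentagons (D : CrossingChange n) (h : ℕ) (x y : GridState n) : Finset (Fin n × Fin n) :=
  (boxes x y).filter fun p => (p.1 = D.right ∨ p.2 = D.right) ∧
    CycLT (4 * (x p.1 : ℕ)) h (4 * (x p.2 : ℕ)) ∧ IsEmptyBox x p

/-- The diagram to which the broken side of a pentagon from `G` to `G'` belongs at the height of the
markings of row `ρ`. -/
def pentagonSide (D : CrossingChange n) (G G' : GridDiagram n) (h : ℕ) (x : GridState n)
    (p : Fin n × Fin n) (ρ : Fin n) : GridDiagram n :=
  if CycLT (4 * (x p.1 : ℕ)) (4 * (ρ : ℕ) + 2) h then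
    (if p.1 = D.right then G else G')
  else
    (if p.1 = D.right then G' else G)

/-- `Pent_s°(x, y)`, for `x` a state of `plus` and `y` a state of `minus`. -/
def pentS (D : CrossingChange n) (x y : GridState n) : Finset (Fin n × Fin n) :=
  D.emptyPentagons D.s x y

/-- `Pent_t°(x, y)`, for `x` a state of `minus` and `y` a state of `plus`. -/
def pentT (D : CrossingChange n) (x y : GridState n) : Finset (Fin n × Fin n) :=
  D.emptyPentagons D.t x y

/-- The monomial `V_1^{O_1(p)} ⋯ V_n^{O_n(p)}` of a pentagon in `pentS`. -/
def pentSMonomial (D : CrossingChange n) (x : GridState n) (p : Fin n × Fin n) : BaseRing n :=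
  monomialOf (D.pentagonSide D.plus D.minus D.s x p) x p

/-- The monomial `V_1^{O_1(p)} ⋯ V_n^{O_n(p)}` of a pentagon in `pentT`. -/
def pentTMonomial (D : CrossingChange n) (x : GridState n) (p : Fin n × Fin n) : BaseRing n :=
  monomialOf (D.pentagonSide D.minus D.plus D.t x p) x p

/-! A hexagon between two states of `G` has one plain side and one side which runs along the special
circle of `G`, then along the special circle of the other diagram between two intersection points,
and along that of `G` again.  The boundary orientation goes down a left side and up a right side.
For states of `plus` the corners contain exactly one quadrant if `t` comes before `s`, for states
of `minus` if `s` comes before `t`. -/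

/-- The lower one of two consecutive corners of the hexagon with side circles `p`, the corners being at
heights `h₁`, `h₂` in the order of the boundary orientation. -/
def lowerCorner (D : CrossingChange n) (h₁ h₂ : ℕ) (p : Fin n × Fin n) : ℕ :=
  if p.1 = D.right then h₂ else h₁

/-- The upper one of these two corners. -/
def upperCorner (D : CrossingChange n) (h₁ h₂ : ℕ) (p : Fin n × Fin n) : ℕ :=
  if p.1 = D.right then h₁ else h₂

/-- The empty hexagons from `x` to `y` with consecutive corners, in the order of the boundary
orientation, at the intersection points at heights `h₁` and `h₂`. -/
def emptyHexagons (D : CrossingChange n) (h₁ h₂ : ℕ) (x y : GridState n) :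
    Finset (Fin n × Fin n) :=
  (boxes x y).filter fun p => (p.1 = D.right ∨ p.2 = D.right) ∧
    CycLT (4 * (x p.1 : ℕ)) (D.lowerCorner h₁ h₂ p) (D.upperCorner h₁ h₂ p) ∧
    CycLT (D.lowerCorner h₁ h₂ p) (D.upperCorner h₁ h₂ p) (4 * (x p.2 : ℕ)) ∧
    CycLT (4 * (x p.1 : ℕ)) (D.upperCorner h₁ h₂ p) (4 * (x p.2 : ℕ)) ∧ IsEmptyBox x p

/-- The diagram to which the broken side of a hexagon between states of `G` belongs at the height of
the markings of row `ρ`; `G'` is the other diagram. -/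
def hexagonSide (D : CrossingChange n) (G G' : GridDiagram n) (h₁ h₂ : ℕ) (p : Fin n × Fin n)
    (ρ : Fin n) : GridDiagram n :=
  if CycLT (D.lowerCorner h₁ h₂ p) (4 * (ρ : ℕ) + 2) (D.upperCorner h₁ h₂ p) then G' else G

/-- `Hex_{t,s}°(x, y)`, for `x`, `y` states of `plus`. -/
def hexTS (D : CrossingChange n) (x y : GridState n) : Finset (Fin n × Fin n) :=
  D.emptyHexagons D.t D.s x y

/-- `Hex_{s,t}°(x, y)`, for `x`, `y` states of `minus`. -/
def hexST (D : CrossingChange n) (x y : GridState n) : Finset (Fin n × Fin n) :=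
  D.emptyHexagons D.s D.t x y

/-- The monomial `V_1^{O_1(h)} ⋯ V_n^{O_n(h)}` of a hexagon in `hexTS`. -/
def hexTSMonomial (D : CrossingChange n) (x : GridState n) (p : Fin n × Fin n) : BaseRing n :=
  monomialOf (D.hexagonSide D.plus D.minus D.t D.s p) x p

/-- The monomial `V_1^{O_1(h)} ⋯ V_n^{O_n(h)}` of a hexagon in `hexST`. -/
def hexSTMonomial (D : CrossingChange n) (x : GridState n) (p : Fin n × Fin n) : BaseRing n :=
  monomialOf (D.hexagonSide D.minus D.plus D.s D.t p) x p

end CrossingChange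

end GridHomology

end

/-! Rectangles, pentagons and hexagons are all boxes on the torus; they differ only in where a side
on the special circle changes between the circle of `G` and that of `G'`. Three states record this:
on the circle of `G`, changed to `G'` at `s`, changed back at `t`. Moving along the special circle
past one height is then a lower triangular 3×3 matrix (`stepMatrix`), and a whole side has the
product of these matrices as its weight. A right side is traversed downward and gets the
antitransposed product with circles and points exchanged. Give every empty box its matrix weight. In
the operator W counting all boxes, the diagonal entries are the differentials of `G`, `G'`, `G`;
entry (1,0) counts pentagons at `s`, entry (2,1) pentagons at `t`, and entry (2,0) hexagons
(`weight_diag`, `weight_one_zero`, `weight_two_one`, `weight_two_zero`).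

All chain-level identities thus follow from one computation of W², which copies the proof that ∂² =
0 up to annuli. Pairs of boxes without a common circle commute. Pairs with one common circle form an
L-shaped region, which can be cut in two ways with equal weights. This needs only the algebraic
rules collected in `SideTransport`, above all that opposite traversals of the same stretch multiply
to a central scalar; here characteristic 2 enters. What remains is the thin annuli
(`sum_pairTerm_eq`). Away from the special circle a vertical annulus cancels the horizontal annulus
through the same `O`. The two vertical annuli next to the special circle give the sum of a loop
upward and a loop downward, a matrix independent of the starting point (`loop_add_loop_eq`). Its
diagonal cancels the two remaining horizontal annuli, and its only other entry is at (2,0). Hence W²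
is a multiple of the elementary matrix at (2,0) (`sum_single_weight_mul_weight`). The multiple is
the variable of `O_1`, because the arc from `s` to `t` contains both or none of the two `O`s
(`O_arc`, `pathMatrix_plusCircle`). Entries (1,0), (2,1) and (2,0) of this identity are the two
chain map equations and the homotopy equation; exchanging the diagrams and the points gives the
other homotopy.

For the degrees, an empty box changes the Maslov function of either set of markings by -1 plus twice
the number of markings in it (`maslovOf_mul_swap`). Interchanging two columns changes it by a sign
(`maslovOf_mul_swap_columns`). For pentagons and hexagons the combined shift depends only on where
`s` and `t` lie relative to the four markings. Applying this to the `O`s and to the `X`s gives the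
Maslov degree and the filtration degree. -/

noncomputable section
namespace GridHomology
open GridDiagram

/-! ### Cyclic order on a circle -/

section CyclicOrder

theorem CycLT.rotate {a b c : ℕ} (h : CycLT a b c) : CycLT b c a := by
  unfold CycLT at *; omega

theorem CycLT.not_swap {a b c : ℕ} (h : CycLT a b c) : ¬ CycLT a c b := by
  unfold CycLT at *; omega

theorem CycLT.ne_left {a b c : ℕ} (h : CycLT a b c) : a ≠ b := by
  unfold CycLT at *; omega

theorem CycLT.ne_right {a b c : ℕ} (h : CycLT a b c) : b ≠ c := by
  unfold CycLT at *; omega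

theorem CycLT.ne_ends {a b c : ℕ} (h : CycLT a b c) : a ≠ c := by
  unfold CycLT at *; omega

theorem not_cycLT_left (a b : ℕ) : ¬ CycLT a a b := by
  unfold CycLT; omega

theorem not_cycLT_right (a b : ℕ) : ¬ CycLT a b b := by
  unfold CycLT; omega

theorem cycLT_or_cycLT {a b c : ℕ} (hab : a ≠ b) (hbc : b ≠ c) (hac : a ≠ c) :
    CycLT a b c ∨ CycLT a c b := by
  unfold CycLT; omega

theorem CycLT.mul_left {a b c : ℕ} (k : ℕ) (hk : 0 < k) (h : CycLT a b c) :
    CycLT (k * a) (k * b) (k * c) := by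
  unfold CycLT at *
  simpa [Nat.mul_lt_mul_left hk] using h

/-- An arc is cut into two by an interior point. -/
theorem CycLT.split {a b c m : ℕ} (h : CycLT a b c) (hm : m ≠ b) :
    CycLT a m c ↔ CycLT a m b ∨ CycLT b m c := by
  unfold CycLT at *; omega

theorem CycLT.not_both {a b c m : ℕ} (h : CycLT a b c) : ¬ (CycLT a m b ∧ CycLT b m c) := by
  unfold CycLT at *; omega

/-- The four points occur in the cyclic order `p`, `q`, `r`, `z`. This turns a corner of one box
inside another box into a corner of the other inside the one. -/
theorem CycLT.arcs_of_not {p q r z : ℕ} (h : CycLT p q r) (hz : ¬ CycLT p z r) (hp : z ≠ p)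
    (hq : z ≠ q) (hr : z ≠ r) : CycLT q r z ∧ CycLT z p q := by
  unfold CycLT at *; omega

/-- The indicator of the open arc from `a` to `b`. -/
def arcInd (a m b : ℕ) : ℕ := if CycLT a m b then 1 else 0

theorem arcInd_add {a b c m : ℕ} (h : CycLT a b c) (hm : m ≠ b) :
    arcInd a m c = arcInd a m b + arcInd b m c := by
  have h1 := h.split hm
  have h2 := h.not_both (m := m)
  unfold arcInd
  by_cases h3 : CycLT a m b <;> by_cases h4 : CycLT b m c <;> simp_all

end CyclicOrder

/-! ### Emptiness of two successive boxes -/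

section Empty

variable {n : ℕ} {x : GridState n} {a b c d : Fin n}

theorem mul_swap_left (x : GridState n) (a b : Fin n) : (x * Equiv.swap a b) a = x b := by simp
theorem mul_swap_right (x : GridState n) (a b : Fin n) : (x * Equiv.swap a b) b = x a := by simp
theorem mul_swap_of_ne (x : GridState n) {a b c : Fin n} (h : c ≠ a) (h' : c ≠ b) :
    (x * Equiv.swap a b) c = x c := by simp [Equiv.swap_apply_of_ne_of_ne h h']

theorem val_apply_ne (x : GridState n) (h : a ≠ b) : (x a : ℕ) ≠ x b :=
  fun e => h (x.injective (Fin.ext e))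

theorem val_ne (h : a ≠ b) : (a : ℕ) ≠ b := fun e => h (Fin.ext e)

theorem ne_of_val {a b : Fin n} (h : (a : ℕ) ≠ b) : a ≠ b := fun e => h (by rw [e])

/-- Emptiness of two successive boxes, tested away from the circles carrying their corners. -/
theorem isEmptyBox_congr {x y x' y' : GridState n} {p q p' q' : Fin n × Fin n} {s : Finset (Fin n)}
    (hx : ∀ m ∈ s, ¬ (CycLT p.1 m p.2 ∧ CycLT (x p.1) (x m) (x p.2)) ∧
      ¬ (CycLT q.1 m q.2 ∧ CycLT (y q.1) (y m) (y q.2)))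
    (hx' : ∀ m ∈ s, ¬ (CycLT p'.1 m p'.2 ∧ CycLT (x' p'.1) (x' m) (x' p'.2)) ∧
      ¬ (CycLT q'.1 m q'.2 ∧ CycLT (y' q'.1) (y' m) (y' q'.2)))
    (h : ∀ m ∉ s, ((CycLT p.1 m p.2 ∧ CycLT (x p.1) (x m) (x p.2)) ∨
      (CycLT q.1 m q.2 ∧ CycLT (y q.1) (y m) (y q.2))) ↔
      ((CycLT p'.1 m p'.2 ∧ CycLT (x' p'.1) (x' m) (x' p'.2)) ∨
      (CycLT q'.1 m q'.2 ∧ CycLT (y' q'.1) (y' m) (y' q'.2)))) :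
    (IsEmptyBox x p ∧ IsEmptyBox y q) ↔ (IsEmptyBox x' p' ∧ IsEmptyBox y' q') := by
  unfold IsEmptyBox
  rw [← forall_and, ← forall_and]
  refine forall_congr' fun m => ?_
  by_cases hm : m ∈ s
  · exact ⟨fun _ => hx' m hm, fun _ => hx m hm⟩
  · rw [← not_or, ← not_or, h m hm]

/-- An L-shaped region without its upper right part can be cut along the vertical or along the
horizontal line through its reflex corner. Off the corner circles both pairs of boxes contain the
same state points, as arcs split at an interior point. In `isEmptyBox_L₂`, `isEmptyBox_L₃` and
`isEmptyBox_L₄` the missing part is at the upper left, the lower left and the lower right. -/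
theorem isEmptyBox_L₁ (h : CycLT a b c) (h' : CycLT (x a) (x c) (x b)) :
    (IsEmptyBox x (a, b) ∧ IsEmptyBox (x * Equiv.swap a b) (b, c)) ↔
      (IsEmptyBox x (a, c) ∧ IsEmptyBox (x * Equiv.swap a c) (a, b)) := by
  have hab : a ≠ b := ne_of_val h.ne_left
  have hbc : b ≠ c := ne_of_val h.ne_right
  have hac : a ≠ c := ne_of_val h.ne_ends
  apply isEmptyBox_congr (s := {a, b, c})
  · simp only [Finset.mem_insert, Finset.mem_singleton, forall_eq_or_imp, forall_eq,
      mul_swap_left, mul_swap_right, mul_swap_of_ne x hac.symm hbc.symm]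
    unfold CycLT at *; omega
  · simp only [Finset.mem_insert, Finset.mem_singleton, forall_eq_or_imp, forall_eq,
      mul_swap_left, mul_swap_right, mul_swap_of_ne x hab.symm hbc]
    unfold CycLT at *; omega
  · intro m hm
    simp only [Finset.mem_insert, Finset.mem_singleton, not_or] at hm
    obtain ⟨ha, hb, hc⟩ := hm
    simp only [mul_swap_left, mul_swap_right, mul_swap_of_ne x ha hb, mul_swap_of_ne x ha hc,
      mul_swap_of_ne x hac.symm hbc.symm, mul_swap_of_ne x hab.symm hbc]
    rw [h.split (val_ne hb), h'.split (val_apply_ne x hc)]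
    tauto

theorem isEmptyBox_L₂ (h : CycLT a b c) (h' : CycLT (x a) (x b) (x c)) :
    (IsEmptyBox x (a, b) ∧ IsEmptyBox (x * Equiv.swap a b) (b, c)) ↔
      (IsEmptyBox x (b, c) ∧ IsEmptyBox (x * Equiv.swap b c) (a, c)) := by
  have hab : a ≠ b := ne_of_val h.ne_left
  have hbc : b ≠ c := ne_of_val h.ne_right
  have hac : a ≠ c := ne_of_val h.ne_ends
  apply isEmptyBox_congr (s := {a, b, c})
  · simp only [Finset.mem_insert, Finset.mem_singleton, forall_eq_or_imp, forall_eq,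
      mul_swap_left, mul_swap_right, mul_swap_of_ne x hac.symm hbc.symm]
    unfold CycLT at *; omega
  · simp only [Finset.mem_insert, Finset.mem_singleton, forall_eq_or_imp, forall_eq,
      mul_swap_left, mul_swap_right, mul_swap_of_ne x hab hac]
    unfold CycLT at *; omega
  · intro m hm
    simp only [Finset.mem_insert, Finset.mem_singleton, not_or] at hm
    obtain ⟨ha, hb, hc⟩ := hm
    simp only [mul_swap_right, mul_swap_of_ne x ha hb, mul_swap_of_ne x hb hc,
      mul_swap_of_ne x hac.symm hbc.symm, mul_swap_of_ne x hab hac]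
    rw [h.split (val_ne hb), h'.split (val_apply_ne x hb)]
    tauto

theorem isEmptyBox_L₃ (h : CycLT a c b) (h' : CycLT (x a) (x b) (x c)) :
    (IsEmptyBox x (a, b) ∧ IsEmptyBox (x * Equiv.swap a b) (c, b)) ↔
      (IsEmptyBox x (c, b) ∧ IsEmptyBox (x * Equiv.swap c b) (a, c)) := by
  have hab : a ≠ b := ne_of_val h.ne_ends
  have hbc : b ≠ c := (ne_of_val h.ne_right).symm
  have hac : a ≠ c := ne_of_val h.ne_left
  apply isEmptyBox_congr (s := {a, b, c})
  · simp only [Finset.mem_insert, Finset.mem_singleton, forall_eq_or_imp, forall_eq,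
      mul_swap_left, mul_swap_right, mul_swap_of_ne x hac.symm hbc.symm]
    unfold CycLT at *; omega
  · simp only [Finset.mem_insert, Finset.mem_singleton, forall_eq_or_imp, forall_eq,
      mul_swap_left, mul_swap_right, mul_swap_of_ne x hac hab]
    unfold CycLT at *; omega
  · intro m hm
    simp only [Finset.mem_insert, Finset.mem_singleton, not_or] at hm
    obtain ⟨ha, hb, hc⟩ := hm
    simp only [mul_swap_left, mul_swap_right, mul_swap_of_ne x ha hb, mul_swap_of_ne x hc hb,
      mul_swap_of_ne x hac.symm hbc.symm, mul_swap_of_ne x hac hab]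
    rw [h.split (val_ne hc), h'.rotate.rotate.split (val_apply_ne x ha)]
    tauto

theorem isEmptyBox_L₄ (h : CycLT a b c) (h' : CycLT (x a) (x b) (x c)) :
    (IsEmptyBox x (a, b) ∧ IsEmptyBox (x * Equiv.swap a b) (a, c)) ↔
      (IsEmptyBox x (b, c) ∧ IsEmptyBox (x * Equiv.swap b c) (a, b)) := by
  have hab : a ≠ b := ne_of_val h.ne_left
  have hbc : b ≠ c := ne_of_val h.ne_right
  have hac : a ≠ c := ne_of_val h.ne_ends
  apply isEmptyBox_congr (s := {a, b, c})
  · simp only [Finset.mem_insert, Finset.mem_singleton, forall_eq_or_imp, forall_eq,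
      mul_swap_left, mul_swap_right, mul_swap_of_ne x hac.symm hbc.symm]
    unfold CycLT at *; omega
  · simp only [Finset.mem_insert, Finset.mem_singleton, forall_eq_or_imp, forall_eq,
      mul_swap_left, mul_swap_right, mul_swap_of_ne x hab hac]
    unfold CycLT at *; omega
  · intro m hm
    simp only [Finset.mem_insert, Finset.mem_singleton, not_or] at hm
    obtain ⟨ha, hb, hc⟩ := hm
    simp only [mul_swap_left, mul_swap_of_ne x ha hb, mul_swap_of_ne x hb hc,
      mul_swap_of_ne x hac.symm hbc.symm, mul_swap_of_ne x hab hac]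
    rw [h.split (val_ne hb), h'.split (val_apply_ne x hb)]
    tauto

/-- Which relative positions occur for two successive empty boxes with one common circle. -/
theorem cycLT_of_isEmptyBox_right_left (hab : a ≠ b) (hbc : b ≠ c) (hac : a ≠ c)
    (h₁ : IsEmptyBox x (a, b)) (h₂ : IsEmptyBox (x * Equiv.swap a b) (b, c)) : CycLT a b c := by
  have e₁ := h₁ c
  have e₂ := h₂ a
  have := val_ne hab; have := val_ne hbc; have := val_ne hac
  have := val_apply_ne x hab; have := val_apply_ne x hbc; have := val_apply_ne x hac
  simp only [mul_swap_left, mul_swap_right, mul_swap_of_ne x hac.symm hbc.symm] at e₁ e₂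
  unfold CycLT at *; omega

theorem cycLT_of_isEmptyBox_left_right (hab : a ≠ b) (hbc : b ≠ c) (hac : a ≠ c)
    (h₁ : IsEmptyBox x (a, b)) (h₂ : IsEmptyBox (x * Equiv.swap a b) (c, a)) : CycLT a b c := by
  have e₁ := h₁ c
  have e₂ := h₂ b
  have := val_ne hab; have := val_ne hbc; have := val_ne hac
  have := val_apply_ne x hab; have := val_apply_ne x hbc; have := val_apply_ne x hac
  simp only [mul_swap_left, mul_swap_right, mul_swap_of_ne x hac.symm hbc.symm] at e₁ e₂
  unfold CycLT at *; omega

/-- Boxes with a common left circle are stacked on each other, so emptiness fixes the cyclic order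
of the heights and leaves that of the circles free. For boxes side by side it is the other way
round. -/
theorem cycLT_of_isEmptyBox_left_left (hab : a ≠ b) (hbc : b ≠ c) (hac : a ≠ c)
    (h₁ : IsEmptyBox x (a, b)) (h₂ : IsEmptyBox (x * Equiv.swap a b) (a, c)) :
    CycLT (x a) (x b) (x c) := by
  have e₁ := h₁ c
  have e₂ := h₂ b
  have := val_ne hab; have := val_ne hbc; have := val_ne hac
  have := val_apply_ne x hab; have := val_apply_ne x hbc; have := val_apply_ne x hac
  simp only [mul_swap_left, mul_swap_right, mul_swap_of_ne x hac.symm hbc.symm] at e₁ e₂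
  unfold CycLT at *; omega

theorem cycLT_of_isEmptyBox_right_right (hab : a ≠ b) (hbc : b ≠ c) (hac : a ≠ c)
    (h₁ : IsEmptyBox x (a, b)) (h₂ : IsEmptyBox (x * Equiv.swap a b) (c, b)) :
    CycLT (x a) (x b) (x c) := by
  have e₁ := h₁ c
  have e₂ := h₂ a
  have := val_ne hab; have := val_ne hbc; have := val_ne hac
  have := val_apply_ne x hab; have := val_apply_ne x hbc; have := val_apply_ne x hac
  simp only [mul_swap_left, mul_swap_right, mul_swap_of_ne x hac.symm hbc.symm] at e₁ e₂
  unfold CycLT at *; omega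

/-- Only the corners need attention, since they move when a box is applied. If a corner of one box
entered the other box once the order is exchanged, `CycLT.arcs_of_not` would put a corner of the
second box inside the first one, in the original order. -/
theorem isEmptyBox_disjoint_aux (hab : a ≠ b) (hcd : c ≠ d) (hac : a ≠ c) (had : a ≠ d)
    (hbc : b ≠ c) (hbd : b ≠ d)
    (h : IsEmptyBox x (a, b) ∧ IsEmptyBox (x * Equiv.swap a b) (c, d)) :
    IsEmptyBox x (c, d) ∧ IsEmptyBox (x * Equiv.swap c d) (a, b) := by
  obtain ⟨h₁, h₂⟩ := h
  have e₁ := h₁ c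
  have e₂ := h₁ d
  have e₃ := h₂ a
  have e₄ := h₂ b
  have hv {i j : Fin n} (h : i ≠ j) := val_ne h
  have hx {i j : Fin n} (h : i ≠ j) := val_apply_ne x h
  simp only [mul_swap_left, mul_swap_right, mul_swap_of_ne x hac.symm hbc.symm,
    mul_swap_of_ne x had.symm hbd.symm] at e₁ e₂ e₃ e₄
  constructor
  · intro m
    have e := h₂ m
    simp only [mul_swap_of_ne x hac.symm hbc.symm, mul_swap_of_ne x had.symm hbd.symm] at e
    rcases eq_or_ne m a with rfl | ha
    · rintro ⟨g, g'⟩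
      exact e₂ ⟨(g.arcs_of_not (fun k => e₄ ⟨k, g'⟩) (hv hbc) (hv hab.symm) (hv hbd)).1,
        (g'.arcs_of_not (fun k => e₃ ⟨g, k⟩) (hx hbc) (hx hab.symm) (hx hbd)).1⟩
    rcases eq_or_ne m b with rfl | hb
    · rintro ⟨g, g'⟩
      exact e₁ ⟨(g.arcs_of_not (fun k => e₃ ⟨k, g'⟩) (hv hac) (hv hab) (hv had)).2,
        (g'.arcs_of_not (fun k => e₄ ⟨g, k⟩) (hx hac) (hx hab) (hx had)).2⟩
    · rwa [mul_swap_of_ne x ha hb] at e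
  · intro m
    have e := h₁ m
    simp only [mul_swap_of_ne x hac had, mul_swap_of_ne x hbc hbd]
    rcases eq_or_ne m c with rfl | hc
    · rw [mul_swap_left]
      rintro ⟨g, g'⟩
      exact e₄ ⟨(g.arcs_of_not (fun k => e₂ ⟨k, g'⟩) (hv had.symm) (hv hcd.symm) (hv hbd.symm)).1,
        (g'.arcs_of_not (fun k => e₁ ⟨g, k⟩) (hx hac.symm) (hx hcd) (hx hbc.symm)).2⟩
    rcases eq_or_ne m d with rfl | hd
    · rw [mul_swap_right]
      rintro ⟨g, g'⟩
      exact e₃ ⟨(g.arcs_of_not (fun k => e₁ ⟨k, g'⟩) (hv hac.symm) (hv hcd) (hv hbc.symm)).2,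
        (g'.arcs_of_not (fun k => e₂ ⟨g, k⟩) (hx had.symm) (hx hcd.symm) (hx hbd.symm)).1⟩
    · rwa [mul_swap_of_ne x hc hd]

theorem isEmptyBox_disjoint (hab : a ≠ b) (hcd : c ≠ d) (hac : a ≠ c) (had : a ≠ d)
    (hbc : b ≠ c) (hbd : b ≠ d) :
    (IsEmptyBox x (a, b) ∧ IsEmptyBox (x * Equiv.swap a b) (c, d)) ↔
      (IsEmptyBox x (c, d) ∧ IsEmptyBox (x * Equiv.swap c d) (a, b)) :=
  ⟨isEmptyBox_disjoint_aux hab hcd hac had hbc hbd,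
    isEmptyBox_disjoint_aux hcd hab hac.symm hbc.symm had.symm hbd.symm⟩

end Empty
end GridHomology
end

/-! ### Weights of boxes and their invariance under recutting -/

noncomputable section
namespace GridHomology
open GridDiagram

section BoxWeights

variable {n : ℕ} {R M : Type*} [CommRing R] [Ring M] [Algebra R M]

/-- Weights for the sides of boxes on one vertical circle: `up A B` belongs to a left side from
height `A` up to `B`, `down A B` to a right side from `B` down to `A`, and `full A B` to a box that
reaches across the circle. -/
structure SideTransport (n : ℕ) (R M : Type*) [CommRing R] [Ring M] [Algebra R M] where
  up : Fin n → Fin n → M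
  down : Fin n → Fin n → M
  full : Fin n → Fin n → R
  up_mul_up : ∀ {A B C : Fin n}, CycLT A C B → up C B * up A C = up A B
  down_mul_down : ∀ {A B C : Fin n}, CycLT A C B → down A C * down C B = down A B
  full_mul_full : ∀ {A B C : Fin n}, CycLT A C B → full A C * full C B = full A B
  up_mul_down : ∀ {A B : Fin n}, A ≠ B → up A B * down A B = algebraMap R M (full A B)
  down_mul_up : ∀ {A B : Fin n}, A ≠ B → down A B * up A B = algebraMap R M (full A B)

/-- The contribution of the circle `r` to the weight of the box from circle `a` to circle `b` and
from height `A` to height `B`. -/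
def SideTransport.factor (T : SideTransport n R M) (r a b A B : Fin n) : M :=
  if a = r then T.up A B else if b = r then T.down A B
  else algebraMap R M (if CycLT a r b then T.full A B else 1)

/-- The product of the `v ρ` over the markings `(col ρ, ρ)` in the box from circle `a` to
circle `b` and from height `A` to height `B`. -/
def markWeight (v : Fin n → R) (col : Fin n → Fin n) (a b A B : Fin n) : R :=
  ∏ ρ, v ρ ^ (arcInd (2 * a) (2 * col ρ + 1) (2 * b) * arcInd (4 * A) (4 * ρ + 2) (4 * B))

theorem arcInd_cols {a b c : Fin n} (h : CycLT a b c) (m : ℕ) :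
    arcInd (2 * a) (2 * m + 1) (2 * c) =
      arcInd (2 * a) (2 * m + 1) (2 * b) + arcInd (2 * b) (2 * m + 1) (2 * c) :=
  arcInd_add (h.mul_left 2 two_pos) (by omega)

theorem arcInd_rows {a b c : Fin n} (h : CycLT a b c) (m : ℕ) :
    arcInd (4 * a) (4 * m + 2) (4 * c) =
      arcInd (4 * a) (4 * m + 2) (4 * b) + arcInd (4 * b) (4 * m + 2) (4 * c) :=
  arcInd_add (h.mul_left 4 four_pos) (by omega)

variable (v : Fin n → R) (col : Fin n → Fin n) {a b c A B C r : Fin n} (T : SideTransport n R M)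

/-- Both cuts of the region cover every marking equally often, because the column and row indicators
are additive along arcs. -/
theorem markWeight_L₁ (h : CycLT a b c) (h' : CycLT A C B) :
    markWeight v col b c A C * markWeight v col a b A B =
      markWeight v col a b C B * markWeight v col a c A C := by
  simp only [markWeight, ← Finset.prod_mul_distrib, ← pow_add, arcInd_cols h, arcInd_rows h']
  exact Finset.prod_congr rfl fun ρ _ => by ring_nf

theorem markWeight_L₂ (h : CycLT a b c) (h' : CycLT A B C) :
    markWeight v col b c A C * markWeight v col a b A B =
      markWeight v col a c A B * markWeight v col b c B C := by
  simp only [markWeight, ← Finset.prod_mul_distrib, ← pow_add, arcInd_cols h, arcInd_rows h']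
  exact Finset.prod_congr rfl fun ρ _ => by ring_nf

theorem markWeight_L₃ (h : CycLT a c b) (h' : CycLT A B C) :
    markWeight v col c b C A * markWeight v col a b A B =
      markWeight v col a c A B * markWeight v col c b C B := by
  simp only [markWeight, ← Finset.prod_mul_distrib, ← pow_add, arcInd_cols h,
    arcInd_rows h'.rotate.rotate]
  exact Finset.prod_congr rfl fun ρ _ => by ring_nf

theorem markWeight_L₄ (h : CycLT a b c) (h' : CycLT A B C) :
    markWeight v col a c B C * markWeight v col a b A B =
      markWeight v col a b A C * markWeight v col b c B C := by
  simp only [markWeight, ← Finset.prod_mul_distrib, ← pow_add, arcInd_cols h, arcInd_rows h']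
  exact Finset.prod_congr rfl fun ρ _ => by ring_nf

namespace SideTransport

theorem factor_left : T.factor r r b A B = T.up A B := by simp [factor]

theorem factor_right (h : a ≠ r) : T.factor r a r A B = T.down A B := by simp [factor, h]

theorem factor_of_ne (h : a ≠ r) (h' : b ≠ r) :
    T.factor r a b A B = algebraMap R M (if CycLT a r b then T.full A B else 1) := by
  simp [factor, h, h']

theorem factor_of_cycLT (h : CycLT a r b) :
    T.factor r a b A B = algebraMap R M (T.full A B) := by
  rw [T.factor_of_ne (ne_of_val h.ne_left) (ne_of_val h.ne_right).symm, if_pos h]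

theorem factor_of_cycLT' (h : CycLT a b r) : T.factor r a b A B = 1 := by
  rw [T.factor_of_ne (ne_of_val h.ne_ends) (ne_of_val h.ne_right), if_neg h.not_swap, map_one]

/-- At most one of two boxes without common circles has a side on `r`; the factor of the other is a
scalar, hence central. -/
theorem commute_factor (hac : a ≠ c) {d : Fin n} (had : a ≠ d) (hbc : b ≠ c) (hbd : b ≠ d)
    (A B C D : Fin n) : Commute (T.factor r a b A B) (T.factor r c d C D) := by
  by_cases h : a = r ∨ b = r
  · have hc : c ≠ r := by rintro rfl; rcases h with h | h <;> simp_all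
    have hd : d ≠ r := by rintro rfl; rcases h with h | h <;> simp_all
    rw [T.factor_of_ne hc hd]
    exact (Algebra.commutes _ _).symm
  · rw [not_or] at h
    rw [T.factor_of_ne h.1 h.2]
    exact Algebra.commutes _ _

/-- If `r` is the cut circle, a stretch of it is traversed in opposite directions by the two
adjacent sides, and `up_mul_down` turns this into the scalar of the box that reaches across `r` in
the other cut. A side on an outer circle is unchanged or subdivided. In all other cases only scalars
occur. -/
theorem factor_L₁ (h : CycLT a b c) (h' : CycLT A C B) :
    T.factor r b c A C * T.factor r a b A B = T.factor r a b C B * T.factor r a c A C := by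
  have hab : a ≠ b := ne_of_val h.ne_left
  have hbc : b ≠ c := ne_of_val h.ne_right
  have hac : a ≠ c := ne_of_val h.ne_ends
  have hAC : A ≠ C := ne_of_val h'.ne_left
  rcases eq_or_ne a r with rfl | ha
  · rw [T.factor_of_cycLT' h.rotate, factor_left, factor_left, factor_left, one_mul,
      T.up_mul_up h']
  rcases eq_or_ne b r with rfl | hb
  · rw [T.factor_left, T.factor_right hab, T.factor_right hab, T.factor_of_cycLT h,
      ← Algebra.commutes, ← T.up_mul_down hAC, mul_assoc, T.down_mul_down h']
  rcases eq_or_ne c r with rfl | hc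
  · rw [T.factor_right hbc, T.factor_right hac, T.factor_of_cycLT' h, T.factor_of_cycLT' h,
      one_mul, mul_one]
  simp only [T.factor_of_ne ha hb, T.factor_of_ne ha hc, T.factor_of_ne hb hc, ← map_mul]
  have h1 := h.split (val_ne hb.symm)
  have h2 := h.not_both (m := r)
  by_cases h3 : CycLT a r b <;> by_cases h4 : CycLT b r c <;>
    simp_all [← T.full_mul_full h', mul_comm]

theorem factor_L₂ (h : CycLT a b c) (h' : CycLT A B C) :
    T.factor r b c A C * T.factor r a b A B = T.factor r a c A B * T.factor r b c B C := by
  have hab : a ≠ b := ne_of_val h.ne_left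
  have hbc : b ≠ c := ne_of_val h.ne_right
  have hac : a ≠ c := ne_of_val h.ne_ends
  have hAB : A ≠ B := ne_of_val h'.ne_left
  rcases eq_or_ne a r with rfl | ha
  · rw [T.factor_of_cycLT' h.rotate, T.factor_of_cycLT' h.rotate, factor_left, factor_left,
      one_mul, mul_one]
  rcases eq_or_ne b r with rfl | hb
  · rw [T.factor_left, T.factor_right hab, T.factor_left, T.factor_of_cycLT h,
      Algebra.commutes, ← T.up_mul_down hAB, ← mul_assoc, T.up_mul_up h']
  rcases eq_or_ne c r with rfl | hc
  · rw [T.factor_right hbc, T.factor_right hac, T.factor_right hbc, T.factor_of_cycLT' h,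
      mul_one, T.down_mul_down h']
  simp only [T.factor_of_ne ha hb, T.factor_of_ne ha hc, T.factor_of_ne hb hc, ← map_mul]
  have h1 := h.split (val_ne hb.symm)
  have h2 := h.not_both (m := r)
  by_cases h3 : CycLT a r b <;> by_cases h4 : CycLT b r c <;>
    simp_all [← T.full_mul_full h', mul_comm]

theorem factor_L₃ (h : CycLT a c b) (h' : CycLT A B C) :
    T.factor r c b C A * T.factor r a b A B = T.factor r a c A B * T.factor r c b C B := by
  have hab : a ≠ b := ne_of_val h.ne_ends
  have hcb : c ≠ b := ne_of_val h.ne_right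
  have hac : a ≠ c := ne_of_val h.ne_left
  have hAB : A ≠ B := ne_of_val h'.ne_left
  rcases eq_or_ne a r with rfl | ha
  · rw [T.factor_of_cycLT' h.rotate, T.factor_of_cycLT' h.rotate, factor_left, factor_left,
      one_mul, mul_one]
  rcases eq_or_ne b r with rfl | hb
  · rw [T.factor_right hcb, T.factor_right hab, T.factor_right hcb, T.factor_of_cycLT' h,
      one_mul, T.down_mul_down h'.rotate.rotate]
  rcases eq_or_ne c r with rfl | hc
  · rw [T.factor_left, T.factor_right hac, T.factor_left, T.factor_of_cycLT h,
      ← T.up_mul_up h'.rotate.rotate, ← mul_assoc, T.down_mul_up hAB, Algebra.commutes]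
  simp only [T.factor_of_ne ha hb, T.factor_of_ne ha hc, T.factor_of_ne hc hb, ← map_mul]
  have h1 := h.split (val_ne hc.symm)
  have h2 := h.not_both (m := r)
  by_cases h3 : CycLT a r c <;> by_cases h4 : CycLT c r b <;>
    simp_all [← T.full_mul_full h'.rotate.rotate, mul_comm]

theorem factor_L₄ (h : CycLT a b c) (h' : CycLT A B C) :
    T.factor r a c B C * T.factor r a b A B = T.factor r a b A C * T.factor r b c B C := by
  have hab : a ≠ b := ne_of_val h.ne_left
  have hbc : b ≠ c := ne_of_val h.ne_right
  have hac : a ≠ c := ne_of_val h.ne_ends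
  have hBC : B ≠ C := ne_of_val h'.ne_right
  rcases eq_or_ne a r with rfl | ha
  · rw [T.factor_of_cycLT' h.rotate, factor_left, factor_left, factor_left, mul_one,
      T.up_mul_up h']
  rcases eq_or_ne b r with rfl | hb
  · rw [T.factor_left, T.factor_right hab, T.factor_right hab, T.factor_of_cycLT h,
      Algebra.commutes, ← T.down_mul_down h', mul_assoc, T.down_mul_up hBC]
  rcases eq_or_ne c r with rfl | hc
  · rw [T.factor_right hbc, T.factor_right hac, T.factor_of_cycLT' h, T.factor_of_cycLT' h,
      one_mul, mul_one]
  simp only [T.factor_of_ne ha hb, T.factor_of_ne ha hc, T.factor_of_ne hb hc, ← map_mul]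
  have h1 := h.split (val_ne hb.symm)
  have h2 := h.not_both (m := r)
  by_cases h3 : CycLT a r b <;> by_cases h4 : CycLT b r c <;>
    simp_all [← T.full_mul_full h', mul_comm]

/-- The weight of the box `(a, b)` in the state `x`, zero unless the box is empty. -/
def boxTerm (r : Fin n) (x : GridState n) (a b : Fin n) : M :=
  if a ≠ b ∧ IsEmptyBox x (a, b) then
    markWeight v col a b (x a) (x b) • T.factor r a b (x a) (x b)
  else 0

/-- The contribution of two successive boxes to the square of the operator counting boxes. -/
def pairTerm (r : Fin n) (x : GridState n) (a b c d : Fin n) : GridState n →₀ M :=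
  Finsupp.single (x * Equiv.swap a b * Equiv.swap c d)
    (T.boxTerm v col r (x * Equiv.swap a b) c d * T.boxTerm v col r x a b)

variable {x : GridState n}

theorem boxTerm_self : T.boxTerm v col r x a a = 0 := by simp [boxTerm]

theorem pairTerm_eq_ite {d : Fin n} (hab : a ≠ b) (hcd : c ≠ d) :
    T.pairTerm v col r x a b c d =
      if IsEmptyBox x (a, b) ∧ IsEmptyBox (x * Equiv.swap a b) (c, d) then
        Finsupp.single (x * Equiv.swap a b * Equiv.swap c d)
          ((markWeight v col c d ((x * Equiv.swap a b) c) ((x * Equiv.swap a b) d) *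
              markWeight v col a b (x a) (x b)) •
            (T.factor r c d ((x * Equiv.swap a b) c) ((x * Equiv.swap a b) d) *
              T.factor r a b (x a) (x b)))
      else 0 := by
  unfold pairTerm boxTerm
  by_cases h₁ : IsEmptyBox x (a, b) <;> by_cases h₂ : IsEmptyBox (x * Equiv.swap a b) (c, d) <;>
    simp [h₁, h₂, hab, hcd, mul_smul, smul_comm (markWeight v col a b _ _)]

theorem swap_mul_swap_left (hbc : b ≠ c) (hac : a ≠ c) :
    Equiv.swap a b * Equiv.swap b c = Equiv.swap a c * Equiv.swap a b := by
  rw [Equiv.mul_swap_eq_swap_mul, Equiv.swap_apply_right,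
    Equiv.swap_apply_of_ne_of_ne hac.symm hbc.symm]

theorem swap_mul_swap_right (hab : a ≠ b) (hac : a ≠ c) :
    Equiv.swap a b * Equiv.swap b c = Equiv.swap b c * Equiv.swap a c := by
  rw [Equiv.swap_mul_eq_mul_swap, Equiv.swap_inv, Equiv.swap_apply_left,
    Equiv.swap_apply_of_ne_of_ne hab hac]

theorem pairTerm_L₁ (h : CycLT a b c) (h' : CycLT (x a) (x c) (x b)) :
    T.pairTerm v col r x a b b c = T.pairTerm v col r x a c a b := by
  have hab : a ≠ b := ne_of_val h.ne_left
  have hbc : b ≠ c := ne_of_val h.ne_right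
  have hac : a ≠ c := ne_of_val h.ne_ends
  rw [T.pairTerm_eq_ite v col hab hbc, T.pairTerm_eq_ite v col hac hab]
  refine if_congr (isEmptyBox_L₁ h h') ?_ rfl
  simp only [mul_swap_left, mul_swap_right, mul_swap_of_ne x hac.symm hbc.symm,
    mul_swap_of_ne x hab.symm hbc, mul_assoc x]
  rw [swap_mul_swap_left hbc hac, markWeight_L₁ v col h h', T.factor_L₁ h h']

theorem pairTerm_L₂ (h : CycLT a b c) (h' : CycLT (x a) (x b) (x c)) :
    T.pairTerm v col r x a b b c = T.pairTerm v col r x b c a c := by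
  have hab : a ≠ b := ne_of_val h.ne_left
  have hbc : b ≠ c := ne_of_val h.ne_right
  have hac : a ≠ c := ne_of_val h.ne_ends
  rw [T.pairTerm_eq_ite v col hab hbc, T.pairTerm_eq_ite v col hbc hac]
  refine if_congr (isEmptyBox_L₂ h h') ?_ rfl
  simp only [mul_swap_right, mul_swap_of_ne x hac.symm hbc.symm,
    mul_swap_of_ne x hab hac, mul_assoc x]
  rw [swap_mul_swap_right hab hac, markWeight_L₂ v col h h', T.factor_L₂ h h']

theorem pairTerm_L₃ (h : CycLT a c b) (h' : CycLT (x a) (x b) (x c)) :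
    T.pairTerm v col r x a b c b = T.pairTerm v col r x c b a c := by
  have hab : a ≠ b := ne_of_val h.ne_ends
  have hcb : c ≠ b := ne_of_val h.ne_right
  have hac : a ≠ c := ne_of_val h.ne_left
  rw [T.pairTerm_eq_ite v col hab hcb, T.pairTerm_eq_ite v col hcb hac]
  refine if_congr (isEmptyBox_L₃ h h') ?_ rfl
  simp only [mul_swap_left, mul_swap_right, mul_swap_of_ne x hac.symm hcb,
    mul_swap_of_ne x hac hab, mul_assoc x]
  rw [Equiv.swap_comm c b, swap_mul_swap_right hab hac, markWeight_L₃ v col h h',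
    T.factor_L₃ h h']

theorem pairTerm_L₄ (h : CycLT a b c) (h' : CycLT (x a) (x b) (x c)) :
    T.pairTerm v col r x a b a c = T.pairTerm v col r x b c a b := by
  have hab : a ≠ b := ne_of_val h.ne_left
  have hbc : b ≠ c := ne_of_val h.ne_right
  have hac : a ≠ c := ne_of_val h.ne_ends
  rw [T.pairTerm_eq_ite v col hab hac, T.pairTerm_eq_ite v col hbc hab]
  refine if_congr (isEmptyBox_L₄ h h') ?_ rfl
  simp only [mul_swap_left, mul_swap_of_ne x hac.symm hbc.symm,
    mul_swap_of_ne x hab hac, mul_assoc x]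
  rw [Equiv.swap_comm a b, swap_mul_swap_left hac hbc, markWeight_L₄ v col h h', T.factor_L₄ h h']

theorem pairTerm_disjoint {d : Fin n} (hac : a ≠ c) (had : a ≠ d) (hbc : b ≠ c) (hbd : b ≠ d) :
    T.pairTerm v col r x a b c d = T.pairTerm v col r x c d a b := by
  rcases eq_or_ne a b with rfl | hab
  · simp [pairTerm, boxTerm_self]
  rcases eq_or_ne c d with rfl | hcd
  · simp [pairTerm, boxTerm_self]
  rw [T.pairTerm_eq_ite v col hab hcd, T.pairTerm_eq_ite v col hcd hab]
  refine if_congr (isEmptyBox_disjoint hab hcd hac had hbc hbd) ?_ rfl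
  simp only [mul_swap_of_ne x hac.symm hbc.symm, mul_swap_of_ne x had.symm hbd.symm,
    mul_swap_of_ne x hac had, mul_swap_of_ne x hbc hbd, mul_assoc x]
  rw [mul_comm (markWeight _ _ c d _ _), (T.commute_factor hac had hbc hbd _ _ _ _).eq,
    (Equiv.Perm.disjoint_swap_swap (x := a) (y := b) (z := c) (t := d) (by simp [*])).commute.eq]

end SideTransport
end BoxWeights
end GridHomology
end

/-! ### Cancellation in the square of the box count -/

noncomputable section
namespace GridHomology
open GridDiagram

section Sums

theorem sum_eq_add_add_sum_ite {ι N : Type*} [Fintype ι] [DecidableEq ι] [AddCommMonoid N] {a b : ι}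
    (hab : a ≠ b) (g : ι → N) :
    ∑ c, g c = g a + g b + ∑ c, if c ≠ a ∧ c ≠ b then g c else 0 := by
  rw [← Finset.sum_filter, ← Finset.sum_filter_add_sum_filter_not _ (fun c => c = a ∨ c = b)]
  congr 1
  · rw [← Finset.sum_pair hab]
    congr 1; ext; simp
  · simp only [not_or, ne_eq]

/-- Exchanging the two indices is an involution whose fixed points contribute zero and whose other
orbits cancel. -/
theorem sum_sum_eq_zero_of_symm {ι N : Type*} [Fintype ι] [DecidableEq ι] [AddCommMonoid N]
    (h2 : ∀ z : N, z + z = 0) (g : ι → ι → N) (hs : ∀ p q, g p q = g q p) (h0 : ∀ p, g p p = 0) :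
    ∑ p, ∑ q, g p q = 0 := by
  rw [← Finset.sum_product' Finset.univ Finset.univ g]
  refine Finset.sum_involution (fun z _ => z.swap) ?_ ?_ ?_ ?_
  · rintro ⟨p, q⟩ _
    simp only [Prod.swap, hs q p]
    exact h2 _
  · rintro ⟨p, q⟩ _ h e
    simp only [Prod.swap, Prod.mk.injEq] at e
    exact h (by simp only [e.1, h0])
  · simp
  · simp

end Sums

namespace SideTransport

variable {n : ℕ} {R M : Type*} [CommRing R] [Ring M] [Algebra R M]
variable (v : Fin n → R) (col : Fin n → Fin n) (T : SideTransport n R M) (r : Fin n)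
  (x : GridState n)

theorem pairTerm_self_left (a c d : Fin n) : T.pairTerm v col r x a a c d = 0 := by
  simp [pairTerm, boxTerm_self]

theorem pairTerm_self_right (a b c : Fin n) : T.pairTerm v col r x a b c c = 0 := by
  simp [pairTerm, boxTerm_self]

theorem sum_pairTerm_disjoint (h2 : ∀ z : M, z + z = 0) :
    ∑ a, ∑ b, ∑ c, ∑ d, (if (c ≠ a ∧ c ≠ b) ∧ (d ≠ a ∧ d ≠ b) then T.pairTerm v col r x a b c d
      else 0) = 0 := by
  have h2' : ∀ z : GridState n →₀ M, z + z = 0 := fun z => Finsupp.ext fun _ => h2 _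
  have := sum_sum_eq_zero_of_symm h2' (fun p q : Fin n × Fin n =>
    if (q.1 ≠ p.1 ∧ q.1 ≠ p.2) ∧ (q.2 ≠ p.1 ∧ q.2 ≠ p.2) then T.pairTerm v col r x p.1 p.2 q.1 q.2
      else 0) ?_ ?_
  · simpa only [Fintype.sum_prod_type] using this
  · rintro ⟨a, b⟩ ⟨c, d⟩
    by_cases h : (c ≠ a ∧ c ≠ b) ∧ (d ≠ a ∧ d ≠ b)
    · have h' : (a ≠ c ∧ a ≠ d) ∧ (b ≠ c ∧ b ≠ d) :=
        ⟨⟨h.1.1.symm, h.2.1.symm⟩, h.1.2.symm, h.2.2.symm⟩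
      rw [if_pos h, if_pos h', T.pairTerm_disjoint v col h'.1.1 h'.1.2 h'.2.1 h'.2.2]
    · rw [if_neg h, if_neg (fun h' => h
        ⟨⟨h'.1.1.symm, h'.2.1.symm⟩, h'.1.2.symm, h'.2.2.symm⟩)]
  · rintro ⟨a, b⟩
    simp

/-- The term vanishes unless both boxes are empty. Emptiness fixes the order of the circles, and the
two summands are the two possible orders of the heights. -/
theorem pairTerm_right_left {a b c : Fin n} :
    (if a ≠ b ∧ c ≠ a ∧ c ≠ b then T.pairTerm v col r x a b b c else 0) =
      (if CycLT a b c ∧ CycLT (x a) (x c) (x b) then T.pairTerm v col r x a b b c else 0) +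
      (if CycLT a b c ∧ CycLT (x a) (x b) (x c) then T.pairTerm v col r x a b b c else 0) := by
  by_cases h : a ≠ b ∧ c ≠ a ∧ c ≠ b
  · obtain ⟨hab, hac, hbc⟩ := h
    rw [T.pairTerm_eq_ite v col hab hbc.symm]
    by_cases he : IsEmptyBox x (a, b) ∧ IsEmptyBox (x * Equiv.swap a b) (b, c)
    · have h1 := cycLT_of_isEmptyBox_right_left hab hbc.symm hac.symm he.1 he.2
      rcases cycLT_or_cycLT (val_apply_ne x hab) (val_apply_ne x hbc.symm)
        (val_apply_ne x hac.symm) with h2 | h2 <;> simp [hab, hac, hbc, h1, h2, h2.not_swap]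
    · simp [he]
  · rw [if_neg h, if_neg, if_neg, add_zero] <;>
    · rintro ⟨h1, -⟩
      exact h ⟨ne_of_val h1.ne_left, ne_of_val h1.ne_ends.symm, ne_of_val h1.ne_right.symm⟩

theorem pairTerm_left_right {a b c : Fin n} :
    (if a ≠ b ∧ c ≠ a ∧ c ≠ b then T.pairTerm v col r x a b c a else 0) =
      (if CycLT a b c ∧ CycLT (x a) (x c) (x b) then T.pairTerm v col r x a b c a else 0) +
      (if CycLT a b c ∧ CycLT (x a) (x b) (x c) then T.pairTerm v col r x a b c a else 0) := by
  by_cases h : a ≠ b ∧ c ≠ a ∧ c ≠ b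
  · obtain ⟨hab, hac, hbc⟩ := h
    rw [T.pairTerm_eq_ite v col hab hac]
    by_cases he : IsEmptyBox x (a, b) ∧ IsEmptyBox (x * Equiv.swap a b) (c, a)
    · have h1 := cycLT_of_isEmptyBox_left_right hab hbc.symm hac.symm he.1 he.2
      rcases cycLT_or_cycLT (val_apply_ne x hab) (val_apply_ne x hbc.symm)
        (val_apply_ne x hac.symm) with h2 | h2 <;> simp [hab, hac, hbc, h1, h2, h2.not_swap]
    · simp [he]
  · rw [if_neg h, if_neg, if_neg, add_zero] <;>
    · rintro ⟨h1, -⟩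
      exact h ⟨ne_of_val h1.ne_left, ne_of_val h1.ne_ends.symm, ne_of_val h1.ne_right.symm⟩

theorem pairTerm_left_left {a b c : Fin n} :
    (if a ≠ b ∧ c ≠ a ∧ c ≠ b then T.pairTerm v col r x a b a c else 0) =
      (if CycLT a b c ∧ CycLT (x a) (x b) (x c) then T.pairTerm v col r x a b a c else 0) +
      (if CycLT a c b ∧ CycLT (x a) (x b) (x c) then T.pairTerm v col r x a b a c else 0) := by
  by_cases h : a ≠ b ∧ c ≠ a ∧ c ≠ b
  · obtain ⟨hab, hac, hbc⟩ := h
    rw [T.pairTerm_eq_ite v col hab hac.symm]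
    by_cases he : IsEmptyBox x (a, b) ∧ IsEmptyBox (x * Equiv.swap a b) (a, c)
    · have h1 := cycLT_of_isEmptyBox_left_left hab hbc.symm hac.symm he.1 he.2
      rcases cycLT_or_cycLT (val_ne hab) (val_ne hbc.symm)
        (val_ne hac.symm) with h2 | h2 <;> simp [hab, hac, hbc, h1, h2, h2.not_swap]
    · simp [he]
  · rw [if_neg h, if_neg, if_neg, add_zero]
    · rintro ⟨h1, -⟩
      exact h ⟨ne_of_val h1.ne_ends, ne_of_val h1.ne_left.symm, ne_of_val h1.ne_right⟩
    · rintro ⟨h1, -⟩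
      exact h ⟨ne_of_val h1.ne_left, ne_of_val h1.ne_ends.symm, ne_of_val h1.ne_right.symm⟩

theorem pairTerm_right_right {a b c : Fin n} :
    (if a ≠ b ∧ c ≠ a ∧ c ≠ b then T.pairTerm v col r x a b c b else 0) =
      (if CycLT a b c ∧ CycLT (x a) (x b) (x c) then T.pairTerm v col r x a b c b else 0) +
      (if CycLT a c b ∧ CycLT (x a) (x b) (x c) then T.pairTerm v col r x a b c b else 0) := by
  by_cases h : a ≠ b ∧ c ≠ a ∧ c ≠ b
  · obtain ⟨hab, hac, hbc⟩ := h
    rw [T.pairTerm_eq_ite v col hab hbc]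
    by_cases he : IsEmptyBox x (a, b) ∧ IsEmptyBox (x * Equiv.swap a b) (c, b)
    · have h1 := cycLT_of_isEmptyBox_right_right hab hbc.symm hac.symm he.1 he.2
      rcases cycLT_or_cycLT (val_ne hab) (val_ne hbc.symm)
        (val_ne hac.symm) with h2 | h2 <;> simp [hab, hac, hbc, h1, h2, h2.not_swap]
    · simp [he]
  · rw [if_neg h, if_neg, if_neg, add_zero]
    · rintro ⟨h1, -⟩
      exact h ⟨ne_of_val h1.ne_ends, ne_of_val h1.ne_left.symm, ne_of_val h1.ne_right⟩
    · rintro ⟨h1, -⟩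
      exact h ⟨ne_of_val h1.ne_left, ne_of_val h1.ne_ends.symm, ne_of_val h1.ne_right.symm⟩

theorem sum_rotate {N : Type*} [AddCommMonoid N] (g : Fin n → Fin n → Fin n → N) :
    ∑ a, ∑ b, ∑ c, g a b c = ∑ a, ∑ b, ∑ c, g b c a := by
  rw [Finset.sum_comm_cycle]

theorem sum_reverse {N : Type*} [AddCommMonoid N] (g : Fin n → Fin n → Fin n → N) :
    ∑ a, ∑ b, ∑ c, g a b c = ∑ a, ∑ b, ∑ c, g c b a := by
  rw [sum_rotate]
  exact Finset.sum_congr rfl fun a _ => Finset.sum_comm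

/-- Pairs of boxes with exactly one common circle cancel, since each L-shaped region is cut into two
boxes in two ways. -/
theorem sum_pairTerm_adjacent (h2 : ∀ z : M, z + z = 0) :
    ∑ a, ∑ b, ∑ c, (if a ≠ b ∧ c ≠ a ∧ c ≠ b then
      T.pairTerm v col r x a b a c + T.pairTerm v col r x a b c a
        + (T.pairTerm v col r x a b b c + T.pairTerm v col r x a b c b) else 0) = 0 := by
  have h2' : ∀ z : GridState n →₀ M, z + z = 0 := fun z => Finsupp.ext fun _ => h2 _
  have split : ∀ a b c : Fin n, (if a ≠ b ∧ c ≠ a ∧ c ≠ b then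
      T.pairTerm v col r x a b a c + T.pairTerm v col r x a b c a
        + (T.pairTerm v col r x a b b c + T.pairTerm v col r x a b c b) else 0) =
      (if a ≠ b ∧ c ≠ a ∧ c ≠ b then T.pairTerm v col r x a b a c else 0) +
      (if a ≠ b ∧ c ≠ a ∧ c ≠ b then T.pairTerm v col r x a b c a else 0) +
      ((if a ≠ b ∧ c ≠ a ∧ c ≠ b then T.pairTerm v col r x a b b c else 0) +
      (if a ≠ b ∧ c ≠ a ∧ c ≠ b then T.pairTerm v col r x a b c b else 0)) := by
    intro a b c
    split_ifs <;> simp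
  simp only [split, pairTerm_left_left, pairTerm_left_right, pairTerm_right_left,
    pairTerm_right_right, Finset.sum_add_distrib]
  -- Four incidence types with two relative positions each give eight families of pairs. The
  -- identities `e₁` to `e₄` match them two by two, one for each position of the missing part of the
  -- L.
  have e₁ : ∑ a : Fin n, ∑ b : Fin n, ∑ c : Fin n,
      (if CycLT a b c ∧ CycLT (x a) (x c) (x b) then T.pairTerm v col r x a b b c else 0) =
      ∑ a : Fin n, ∑ b : Fin n, ∑ c : Fin n,
      (if CycLT a c b ∧ CycLT (x a) (x b) (x c) then T.pairTerm v col r x a b a c else 0) := by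
    refine Finset.sum_congr rfl fun a _ => ?_
    rw [Finset.sum_comm]
    refine Finset.sum_congr rfl fun b _ => Finset.sum_congr rfl fun c _ => ?_
    exact ite_congr rfl (fun h => T.pairTerm_L₁ v col h.1 h.2) fun _ => rfl
  have e₂ : ∑ a : Fin n, ∑ b : Fin n, ∑ c : Fin n,
      (if CycLT a b c ∧ CycLT (x a) (x b) (x c) then T.pairTerm v col r x a b b c else 0) =
      ∑ a : Fin n, ∑ b : Fin n, ∑ c : Fin n,
      (if CycLT a b c ∧ CycLT (x a) (x b) (x c) then T.pairTerm v col r x a b c b else 0) := by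
    conv_rhs => rw [sum_rotate]
    refine Finset.sum_congr rfl fun a _ => Finset.sum_congr rfl fun b _ =>
      Finset.sum_congr rfl fun c _ => ?_
    refine ite_congr (propext ⟨fun h => ⟨h.1.rotate, h.2.rotate⟩,
      fun h => ⟨h.1.rotate.rotate, h.2.rotate.rotate⟩⟩) (fun h => ?_) fun _ => rfl
    exact T.pairTerm_L₂ v col h.1.rotate.rotate h.2.rotate.rotate
  have e₃ : ∑ a : Fin n, ∑ b : Fin n, ∑ c : Fin n,
      (if CycLT a c b ∧ CycLT (x a) (x b) (x c) then T.pairTerm v col r x a b c b else 0) =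
      ∑ a : Fin n, ∑ b : Fin n, ∑ c : Fin n,
      (if CycLT a b c ∧ CycLT (x a) (x c) (x b) then T.pairTerm v col r x a b c a else 0) := by
    conv_rhs => rw [sum_reverse]
    refine Finset.sum_congr rfl fun a _ => Finset.sum_congr rfl fun b _ =>
      Finset.sum_congr rfl fun c _ => ?_
    refine ite_congr (propext ⟨fun h => ⟨h.1.rotate, h.2.rotate.rotate⟩,
      fun h => ⟨h.1.rotate.rotate, h.2.rotate⟩⟩) (fun h => ?_) fun _ => rfl
    exact T.pairTerm_L₃ v col h.1.rotate.rotate h.2.rotate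
  have e₄ : ∑ a : Fin n, ∑ b : Fin n, ∑ c : Fin n,
      (if CycLT a b c ∧ CycLT (x a) (x b) (x c) then T.pairTerm v col r x a b a c else 0) =
      ∑ a : Fin n, ∑ b : Fin n, ∑ c : Fin n,
      (if CycLT a b c ∧ CycLT (x a) (x b) (x c) then T.pairTerm v col r x a b c a else 0) := by
    conv_rhs => rw [sum_rotate]
    refine Finset.sum_congr rfl fun a _ => Finset.sum_congr rfl fun b _ =>
      Finset.sum_congr rfl fun c _ => ?_
    refine ite_congr (propext ⟨fun h => ⟨h.1.rotate, h.2.rotate⟩,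
      fun h => ⟨h.1.rotate.rotate, h.2.rotate.rotate⟩⟩) (fun h => ?_) fun _ => rfl
    exact T.pairTerm_L₄ v col h.1.rotate.rotate h.2.rotate.rotate
  rw [e₁, e₂, e₃, e₄]
  generalize (∑ a : Fin n, ∑ b : Fin n, ∑ c : Fin n,
    (if CycLT a c b ∧ CycLT (x a) (x b) (x c) then T.pairTerm v col r x a b a c else 0)) = z₁
  generalize (∑ a : Fin n, ∑ b : Fin n, ∑ c : Fin n,
    (if CycLT a b c ∧ CycLT (x a) (x b) (x c) then T.pairTerm v col r x a b c b else 0)) = z₂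
  generalize (∑ a : Fin n, ∑ b : Fin n, ∑ c : Fin n,
    (if CycLT a b c ∧ CycLT (x a) (x c) (x b) then T.pairTerm v col r x a b c a else 0)) = z₃
  generalize (∑ a : Fin n, ∑ b : Fin n, ∑ c : Fin n,
    (if CycLT a b c ∧ CycLT (x a) (x b) (x c) then T.pairTerm v col r x a b c a else 0)) = z₄
  calc _ = (z₁ + z₁) + (z₂ + z₂) + (z₃ + z₃) + (z₄ + z₄) := by abel
    _ = 0 := by simp only [h2']

/-- The second box shares two, one or no circles with the first. The last two kinds cancel among
themselves, and the first kind fills an annulus. -/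
theorem sum_pairTerm (h2 : ∀ z : M, z + z = 0) :
    ∑ a, ∑ b, ∑ c, ∑ d, T.pairTerm v col r x a b c d =
      ∑ a, ∑ b, (T.pairTerm v col r x a b a b + T.pairTerm v col r x a b b a) := by
  have key : ∀ a b, ∑ c, ∑ d, T.pairTerm v col r x a b c d =
      (T.pairTerm v col r x a b a b + T.pairTerm v col r x a b b a) +
      (∑ c, (if a ≠ b ∧ c ≠ a ∧ c ≠ b then
      T.pairTerm v col r x a b a c + T.pairTerm v col r x a b c a
        + (T.pairTerm v col r x a b b c + T.pairTerm v col r x a b c b) else 0)) +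
      ∑ c, ∑ d, (if (c ≠ a ∧ c ≠ b) ∧ (d ≠ a ∧ d ≠ b) then T.pairTerm v col r x a b c d
      else 0) := by
    intro a b
    rcases eq_or_ne a b with rfl | hab
    · simp [pairTerm_self_left]
    · simp only [sum_eq_add_add_sum_ite hab (T.pairTerm v col r x a b _)]
      rw [sum_eq_add_add_sum_ite hab]
      simp only [pairTerm_self_right, ne_eq, hab, not_false_eq_true, zero_add, add_zero, true_and]
      have e : ∀ c, (if ¬c = a ∧ ¬c = b then T.pairTerm v col r x a b c a + T.pairTerm v col r x a b c b
          + (∑ d, if ¬d = a ∧ ¬d = b then T.pairTerm v col r x a b c d else 0) else 0) =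
          (if ¬c = a ∧ ¬c = b then T.pairTerm v col r x a b c a else 0) +
          (if ¬c = a ∧ ¬c = b then T.pairTerm v col r x a b c b else 0) +
          (∑ d, if (¬c = a ∧ ¬c = b) ∧ ¬d = a ∧ ¬d = b then T.pairTerm v col r x a b c d else 0) := by
        intro c
        by_cases h : ¬c = a ∧ ¬c = b <;> simp [h]
      have e' : ∀ c, (if ¬c = a ∧ ¬c = b then
          T.pairTerm v col r x a b a c + T.pairTerm v col r x a b c a
          + (T.pairTerm v col r x a b b c + T.pairTerm v col r x a b c b) else 0) =
          (if ¬c = a ∧ ¬c = b then T.pairTerm v col r x a b a c else 0) +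
          (if ¬c = a ∧ ¬c = b then T.pairTerm v col r x a b c a else 0) +
          ((if ¬c = a ∧ ¬c = b then T.pairTerm v col r x a b b c else 0) +
          (if ¬c = a ∧ ¬c = b then T.pairTerm v col r x a b c b else 0)) := by
        intro c
        by_cases h : ¬c = a ∧ ¬c = b <;> simp [h]
      simp only [e, e', Finset.sum_add_distrib]
      abel
  simp only [key, Finset.sum_add_distrib]
  rw [sum_pairTerm_disjoint, add_zero, sum_pairTerm_adjacent, add_zero]
  · exact h2
  · exact h2

end SideTransport

/-! ### Thin annuli -/

section Annuli

variable {n : ℕ}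

/-- The next index on the circle. -/
def cycNext (a : Fin n) : Fin n :=
  ⟨if (a : ℕ) + 1 < n then a + 1 else 0, by have := a.isLt; split_ifs <;> omega⟩

/-- For `n = 1` the next index would be `a` itself, which explains the bound on `n`. -/
theorem eq_cycNext_iff (hn : 2 ≤ n) (a b : Fin n) :
    (a ≠ b ∧ ∀ m : Fin n, ¬ CycLT a m b) ↔ b = cycNext a := by
  constructor
  · rintro ⟨hab, h⟩
    by_contra hb
    have h1 := h (cycNext a)
    have h2 := val_ne hb
    have h3 := val_ne hab
    have := a.isLt; have := b.isLt
    unfold CycLT cycNext at *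
    simp only at h1 h2
    split_ifs at h1 h2 <;> omega
  · rintro rfl
    refine ⟨ne_of_val ?_, fun m => ?_⟩
    · unfold cycNext; simp only; split_ifs <;> omega
    · have := m.isLt
      unfold CycLT cycNext; simp only; split_ifs <;> omega

theorem arcInd_cols_cycNext (hn : 2 ≤ n) (a m : Fin n) :
    arcInd (2 * a) (2 * m + 1) (2 * (cycNext a : Fin n)) = if m = a then 1 else 0 := by
  have ha := a.isLt
  have hm := m.isLt
  refine if_congr ?_ rfl rfl
  unfold CycLT cycNext
  rw [Fin.ext_iff]
  dsimp only
  split_ifs <;> omega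

theorem arcInd_rows_cycNext (hn : 2 ≤ n) (a m : Fin n) :
    arcInd (4 * a) (4 * m + 2) (4 * (cycNext a : Fin n)) = if m = a then 1 else 0 := by
  have ha := a.isLt
  have hm := m.isLt
  refine if_congr ?_ rfl rfl
  unfold CycLT cycNext
  rw [Fin.ext_iff]
  dsimp only
  split_ifs <;> omega

end Annuli

namespace SideTransport

variable {n : ℕ} {R M : Type*} [CommRing R] [Ring M] [Algebra R M]
variable (v : Fin n → R) (col : Equiv.Perm (Fin n)) (T : SideTransport n R M) (r : Fin n)
  (x : GridState n)

theorem arcInd_add_arcInd_swap {a b m : ℕ} (hab : a ≠ b) (ha : m ≠ a) (hb : m ≠ b) :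
    arcInd a m b + arcInd b m a = 1 := by
  unfold arcInd
  rcases cycLT_or_cycLT ha.symm hb hab with h | h
  · rw [if_pos h, if_neg h.rotate.rotate.not_swap]
  · rw [if_neg h.not_swap, if_pos h.rotate]

/-- Together the two boxes fill the annulus between the circles: their height ranges are
complementary arcs. A state point on a circle strictly between would lie in one of them. -/
theorem isEmptyBox_vertical {a b : Fin n} (hab : a ≠ b) :
    (IsEmptyBox x (a, b) ∧ IsEmptyBox (x * Equiv.swap a b) (a, b)) ↔
      ∀ m : Fin n, ¬ CycLT a m b := by
  constructor
  · rintro ⟨h₁, h₂⟩ m hm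
    have ha : m ≠ a := (ne_of_val hm.ne_left).symm
    have hb : m ≠ b := ne_of_val hm.ne_right
    have e₁ := h₁ m
    have e₂ := h₂ m
    simp only [mul_swap_left, mul_swap_right, mul_swap_of_ne x ha hb, hm, true_and] at e₁ e₂
    rcases cycLT_or_cycLT (val_apply_ne x ha.symm) (val_apply_ne x hb) (val_apply_ne x hab)
      with h | h
    · exact e₁ h
    · exact e₂ h.rotate.rotate.rotate.rotate
  · exact fun h => ⟨fun m hm => h m hm.1, fun m hm => h m hm.1⟩

theorem isEmptyBox_horizontal {a b : Fin n} (hab : a ≠ b) :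
    (IsEmptyBox x (a, b) ∧ IsEmptyBox (x * Equiv.swap a b) (b, a)) ↔
      ∀ ρ : Fin n, ¬ CycLT (x a) ρ (x b) := by
  constructor
  · rintro ⟨h₁, h₂⟩ ρ hm
    obtain ⟨m, rfl⟩ := x.surjective ρ
    have ha : m ≠ a := by rintro rfl; exact not_cycLT_left _ _ hm
    have hb : m ≠ b := by rintro rfl; exact not_cycLT_right _ _ hm
    have e₁ := h₁ m
    have e₂ := h₂ m
    simp only [mul_swap_left, mul_swap_right, mul_swap_of_ne x ha hb, hm, and_true] at e₁ e₂
    rcases cycLT_or_cycLT (val_ne ha.symm) (val_ne hb) (val_ne hab) with h | h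
    · exact e₁ h
    · exact e₂ h.rotate
  · refine fun h => ⟨fun m hm => h _ hm.2, fun m hm => ?_⟩
    have h2 := hm.2
    simp only [mul_swap_left, mul_swap_right] at h2
    exact h _ h2

theorem pairTerm_vertical (hn : 2 ≤ n) (a b : Fin n) :
    T.pairTerm v col r x a b a b = if b = cycNext a then
      Finsupp.single x (v (col.symm a) • (T.factor r a b (x b) (x a) * T.factor r a b (x a) (x b)))
    else 0 := by
  rcases eq_or_ne a b with rfl | hab
  · rw [if_neg, pairTerm_self_left]
    exact fun h => ((eq_cycNext_iff hn a a).2 h).1 rfl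
  rw [T.pairTerm_eq_ite v col hab hab]
  refine ite_congr (propext ?_) (fun h => ?_) fun _ => rfl
  · rw [isEmptyBox_vertical x hab, ← eq_cycNext_iff hn, and_iff_right hab]
  · rw [mul_swap_left, mul_swap_right, mul_assoc, Equiv.swap_mul_self, mul_one]
    congr 2
    subst h
    simp only [markWeight, ← Finset.prod_mul_distrib, ← pow_add, ← mul_add]
    have hx : (x (cycNext a) : ℕ) ≠ x a := val_apply_ne x hab.symm
    -- The annulus is one column wide, so it contains only the marking of column `a`, and exactly
    -- one of the two complementary boxes contains that marking.
    rw [Finset.prod_eq_single_of_mem (col.symm a) (Finset.mem_univ _)]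
    · rw [arcInd_add_arcInd_swap (by omega) (by omega) (by omega), Equiv.apply_symm_apply,
        arcInd_cols_cycNext hn, if_pos rfl, mul_one, pow_one]
    · intro ρ _ hρ
      rw [arcInd_cols_cycNext hn, if_neg, zero_mul, pow_zero]
      rwa [← Equiv.eq_symm_apply]

theorem pairTerm_horizontal (hn : 2 ≤ n) (a b : Fin n) :
    T.pairTerm v col r x a b b a = if x b = cycNext (x a) then
      Finsupp.single x (algebraMap R M (v (x a) * T.full (x a) (x b)))
    else 0 := by
  rcases eq_or_ne a b with rfl | hab
  · rw [if_neg, pairTerm_self_left]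
    exact fun h => ((eq_cycNext_iff hn _ _).2 h).1 rfl
  have hx : x a ≠ x b := ne_of_val (val_apply_ne x hab)
  rw [T.pairTerm_eq_ite v col hab hab.symm]
  refine ite_congr (propext ?_) (fun h => ?_) fun _ => rfl
  · rw [isEmptyBox_horizontal x hab, ← eq_cycNext_iff hn, and_iff_right hx]
  · rw [mul_swap_left, mul_swap_right, mul_assoc, Equiv.swap_comm b a, Equiv.swap_mul_self, mul_one]
    congr 1
    -- The circle `r` crosses the horizontal annulus exactly once: either as the common edge of the
    -- two boxes, traversed in both directions, or inside one of them. Each case yields the same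
    -- scalar.
    have hf : T.factor r b a (x a) (x b) * T.factor r a b (x a) (x b) =
        algebraMap R M (T.full (x a) (x b)) := by
      rcases eq_or_ne a r with rfl | ha
      · rw [factor_left, T.factor_right hab.symm, T.down_mul_up hx]
      rcases eq_or_ne b r with rfl | hb
      · rw [factor_left, T.factor_right hab, T.up_mul_down hx]
      rcases cycLT_or_cycLT (val_ne ha) (val_ne hb.symm) (val_ne hab) with g | g
      · rw [T.factor_of_cycLT g, T.factor_of_cycLT' g.rotate.rotate, one_mul]
      · rw [T.factor_of_cycLT g.rotate, T.factor_of_cycLT' g, mul_one]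
    rw [hf, map_mul, Algebra.smul_def]
    congr 2
    simp only [markWeight, ← Finset.prod_mul_distrib, ← pow_add, ← add_mul]
    have hv : (a : ℕ) ≠ b := val_ne hab
    rw [Finset.prod_eq_single_of_mem (x a) (Finset.mem_univ _)]
    · rw [arcInd_add_arcInd_swap (by omega) (by omega) (by omega), h,
        arcInd_rows_cycNext hn, if_pos rfl, mul_one, pow_one]
    · intro ρ _ hρ
      rw [h, arcInd_rows_cycNext hn, if_neg hρ, mul_zero, pow_zero]

/-- The square of the operator counting boxes: only the thin annuli contribute. -/
theorem sum_pairTerm_eq (hn : 2 ≤ n) (h2 : ∀ z : M, z + z = 0) {l : Fin n} (hlr : cycNext l = r)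
    (hl : v (col.symm l) = 1) (hr : v (col.symm r) = 1) {Z : M} (hloop : ∀ A B C, A ≠ B → A ≠ C →
      T.up B A * T.up A B + T.down A C * T.down C A = Z) (hne : l ≠ r) :
    ∑ a, ∑ b, ∑ c, ∑ d, T.pairTerm v col r x a b c d =
      Finsupp.single x (Z + algebraMap R M (
        (∑ a, if a ≠ l ∧ a ≠ r then v (col.symm a) else 0) + ∑ ρ, v ρ * T.full ρ (cycNext ρ))) := by
  rw [T.sum_pairTerm v col r x h2]
  have hv : ∑ a, ∑ b, T.pairTerm v col r x a b a b = Finsupp.single x (Z + algebraMap R M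
      (∑ a, if a ≠ l ∧ a ≠ r then v (col.symm a) else 0)) := by
    simp only [pairTerm_vertical v col T r x hn, Finset.sum_ite_eq', Finset.mem_univ, if_true]
    have hlr' : ∀ a, cycNext a = r ↔ a = l := by
      intro a
      rw [← hlr]
      refine ⟨fun h => Fin.ext ?_, fun h => by rw [h]⟩
      have := a.isLt; have := l.isLt
      have h' := congrArg Fin.val h
      unfold cycNext at h'
      dsimp only at h'
      split_ifs at h' <;> omega
    have hx (a : Fin n) : x a ≠ x (cycNext a) :=
      fun e => ((eq_cycNext_iff hn a _).2 rfl).1 (x.injective e)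
    -- The annuli of the columns `l` and `r` are the ones with a side on the special circle, a right
    -- side for `l` and a left side for `r`. All others give scalars.
    rw [sum_eq_add_add_sum_ite hne, hl, hr, one_smul, one_smul, ← Finsupp.single_add, hlr,
      T.factor_right hne, T.factor_right hne, factor_left, factor_left, add_comm (_ * _),
      hloop _ _ _ (hx r) (by rw [← hlr]; exact (hx l).symm), Finsupp.single_add, map_sum]
    congr 1
    rw [← Finsupp.singleAddHom_apply, map_sum]
    refine Finset.sum_congr rfl fun a _ => ?_
    split_ifs with h
    · have h₁ : cycNext a ≠ r := fun e => h.1 ((hlr' a).1 e)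
      have h₂ : ¬ CycLT a r (cycNext a) := ((eq_cycNext_iff hn a _).2 rfl).2 r
      rw [T.factor_of_ne h.2 h₁, T.factor_of_ne h.2 h₁, if_neg h₂, if_neg h₂, map_one, mul_one,
        Algebra.algebraMap_eq_smul_one, Finsupp.singleAddHom_apply]
    · rw [map_zero, map_zero]
  have hh : ∑ a, ∑ b, T.pairTerm v col r x a b b a = Finsupp.single x (algebraMap R M
      (∑ ρ, v ρ * T.full ρ (cycNext ρ))) := by
    simp only [pairTerm_horizontal v col T r x hn, ← Equiv.eq_symm_apply, Finset.sum_ite_eq',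
      Finset.mem_univ, if_true, Equiv.apply_symm_apply]
    rw [map_sum, ← Finsupp.singleAddHom_apply, map_sum]
    exact Equiv.sum_comp x fun ρ => Finsupp.singleAddHom x (algebraMap R M
      (v ρ * T.full ρ (cycNext ρ)))
  simp only [Finset.sum_add_distrib, hv, hh, map_add]
  rw [← Finsupp.single_add, add_assoc]

end SideTransport
end GridHomology
end

/-! ### Transition matrices along a broken circle -/

noncomputable section
namespace GridHomology
open GridDiagram

section PathMatrices

variable {R : Type*} [CommRing R]

/-- The transition matrix for moving up past the height `h` along a broken vertical circle: the
states `0`, `1`, `2` are to be on the first circle, to have changed to the second circle at height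
`s`, and to have changed back at height `t`.  The functions `f` and `g` give the weights on the first
and the second circle. -/
def stepMatrix (f g : ℕ → R) (s t h : ℕ) : Matrix (Fin 3) (Fin 3) R :=
  !![f h, 0, 0; if h = s then 1 else 0, g h, 0; 0, if h = t then 1 else 0, f h]

/-- The reflection of a matrix in its antidiagonal. -/
def antiTranspose (A : Matrix (Fin 3) (Fin 3) R) : Matrix (Fin 3) (Fin 3) R :=
  Matrix.of fun i j => A j.rev i.rev

theorem antiTranspose_mul (A B : Matrix (Fin 3) (Fin 3) R) :
    antiTranspose (A * B) = antiTranspose B * antiTranspose A := by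
  ext i j
  simp only [antiTranspose, Matrix.of_apply, Matrix.mul_apply]
  rw [← Equiv.sum_comp Fin.revPerm]
  exact Finset.sum_congr rfl fun k _ => by simp [mul_comm]

theorem antiTranspose_one : antiTranspose (1 : Matrix (Fin 3) (Fin 3) R) = 1 := by
  ext i j
  simp [antiTranspose, Matrix.of_apply, Matrix.one_apply, eq_comm]

/-- The product of the transition matrices at the heights `i, …, k - 1`. -/
def pathMatrix (f g : ℕ → R) (s t i : ℕ) : ℕ → Matrix (Fin 3) (Fin 3) R
  | 0 => 1
  | k + 1 => if i ≤ k then stepMatrix f g s t k * pathMatrix f g s t i k else 1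

variable (f g : ℕ → R) (s t : ℕ) {i j k : ℕ}

theorem pathMatrix_self : pathMatrix f g s t i i = 1 := by
  cases i <;> simp [pathMatrix]

theorem pathMatrix_succ (h : i ≤ k) :
    pathMatrix f g s t i (k + 1) = stepMatrix f g s t k * pathMatrix f g s t i k := by
  simp [pathMatrix, h]

theorem pathMatrix_mul_pathMatrix (hij : i ≤ j) (hjk : j ≤ k) :
    pathMatrix f g s t j k * pathMatrix f g s t i j = pathMatrix f g s t i k := by
  induction k, hjk using Nat.le_induction with
  | base => rw [pathMatrix_self, one_mul]
  | succ k hk ih => rw [pathMatrix_succ _ _ _ _ hk, pathMatrix_succ _ _ _ _ (hij.trans hk), mul_assoc, ih]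

variable {s t}

/-- The entries next to the diagonal are sums of two equal terms and vanish in characteristic 2. The
lower left entry would require `h = s` and `h = t` at once. -/
theorem stepMatrix_mul_antiTranspose (h2 : ∀ z : R, z + z = 0) (hst : s ≠ t) (h : ℕ) :
    stepMatrix f g s t h * antiTranspose (stepMatrix g f t s h) =
      algebraMap R _ (f h * g h) := by
  have : ¬ (h = t ∧ h = s) := fun e => hst (e.2.symm.trans e.1)
  ext i j
  fin_cases i <;> fin_cases j <;>
    simp [stepMatrix, antiTranspose, Matrix.mul_apply, Fin.sum_univ_three, Matrix.algebraMap_matrix_apply,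
      mul_comm, h2, Fin.rev, ← ite_and, this]

theorem antiTranspose_mul_stepMatrix (h2 : ∀ z : R, z + z = 0) (hst : s ≠ t) (h : ℕ) :
    antiTranspose (stepMatrix g f t s h) * stepMatrix f g s t h =
      algebraMap R _ (f h * g h) := by
  have : ¬ (h = t ∧ h = s) := fun e => hst (e.2.symm.trans e.1)
  ext i j
  fin_cases i <;> fin_cases j <;>
    simp [stepMatrix, antiTranspose, Matrix.mul_apply, Fin.sum_univ_three, Matrix.algebraMap_matrix_apply,
      mul_comm, h2, Fin.rev, ← ite_and, this]

/-- The product telescopes from the inside, since each inner product of a matrix with its reversed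
partner is a scalar and can be moved out. -/
theorem pathMatrix_mul_antiTranspose (h2 : ∀ z : R, z + z = 0) (hst : s ≠ t) (h : i ≤ k) :
    pathMatrix f g s t i k * antiTranspose (pathMatrix g f t s i k) =
      algebraMap R _ (∏ h ∈ Finset.Ico i k, f h * g h) := by
  induction k, h using Nat.le_induction with
  | base => simp [pathMatrix_self, antiTranspose_one]
  | succ k hk ih =>
    rw [pathMatrix_succ _ _ _ _ hk, pathMatrix_succ _ _ _ _ hk, antiTranspose_mul, mul_assoc,
      ← mul_assoc (pathMatrix f g s t i k), ih, ← mul_assoc, ← Algebra.commutes, mul_assoc,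
      stepMatrix_mul_antiTranspose f g h2 hst, ← map_mul, Finset.prod_Ico_succ_top hk]

theorem antiTranspose_mul_pathMatrix (h2 : ∀ z : R, z + z = 0) (hst : s ≠ t) (h : i ≤ k) :
    antiTranspose (pathMatrix g f t s i k) * pathMatrix f g s t i k =
      algebraMap R _ (∏ h ∈ Finset.Ico i k, f h * g h) := by
  induction k, h using Nat.le_induction with
  | base => simp [pathMatrix_self, antiTranspose_one]
  | succ k hk ih =>
    rw [pathMatrix_succ _ _ _ _ hk, pathMatrix_succ _ _ _ _ hk, antiTranspose_mul, mul_assoc,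
      ← mul_assoc (antiTranspose (stepMatrix _ _ _ _ _)), antiTranspose_mul_stepMatrix f g h2 hst,
      ← mul_assoc, ← Algebra.commutes, mul_assoc, ih,  ← map_mul, Finset.prod_Ico_succ_top hk,
      mul_comm]

/-- An entry below the diagonal records the prescribed changes of circle. Starting on the first
circle, both changes can only take place if `s` is met before `t`. The matrix entry for a change
carries no weight, whereas the half-open products include the height of the change; hence the
assumption of weight one there. -/
theorem pathMatrix_eq (hst : s ≠ t) (hfs : f s = 1) (hgs : g s = 1) (hft : f t = 1)
    (hgt : g t = 1) (h : i ≤ k) :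
    pathMatrix f g s t i k = !![∏ h ∈ Finset.Ico i k, f h, 0, 0;
      if i ≤ s ∧ s < k then (∏ h ∈ Finset.Ico i s, f h) * ∏ h ∈ Finset.Ico s k, g h else 0,
      ∏ h ∈ Finset.Ico i k, g h, 0;
      if i ≤ s ∧ s < t ∧ t < k then
        (∏ h ∈ Finset.Ico i s, f h) * (∏ h ∈ Finset.Ico s t, g h) * ∏ h ∈ Finset.Ico t k, f h
      else 0,
      if i ≤ t ∧ t < k then (∏ h ∈ Finset.Ico i t, g h) * ∏ h ∈ Finset.Ico t k, f h else 0,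
      ∏ h ∈ Finset.Ico i k, f h] := by
  induction k, h using Nat.le_induction with
  | base =>
    have h₁ : ¬ (i ≤ s ∧ s < i) := by omega
    have h₂ : ¬ (i ≤ t ∧ t < i) := by omega
    have h₃ : ¬ (i ≤ s ∧ s < t ∧ t < i) := by omega
    rw [pathMatrix_self]
    ext a b
    fin_cases a <;> fin_cases b <;> simp [h₁, h₂, h₃]
  | succ k hk ih =>
    rw [pathMatrix_succ _ _ _ _ hk, ih]
    have e₁ : (if i ≤ s ∧ s < k + 1 then (∏ h ∈ Finset.Ico i s, f h) * ∏ h ∈ Finset.Ico s (k + 1), g h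
        else 0) = (if k = s then 1 else 0) * (∏ h ∈ Finset.Ico i k, f h) + g k *
        (if i ≤ s ∧ s < k then (∏ h ∈ Finset.Ico i s, f h) * ∏ h ∈ Finset.Ico s k, g h else 0) := by
      rcases eq_or_ne k s with rfl | hne
      · simp [hk, hgs]
      · by_cases hs : i ≤ s ∧ s < k
        · rw [if_pos ⟨hs.1, by omega⟩, if_neg hne, if_pos hs, Finset.prod_Ico_succ_top hs.2.le]
          ring
        · rw [if_neg (by omega), if_neg hne, if_neg hs]; ring
    have e₂ : (if i ≤ t ∧ t < k + 1 then (∏ h ∈ Finset.Ico i t, g h) * ∏ h ∈ Finset.Ico t (k + 1), f h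
        else 0) = (if k = t then 1 else 0) * (∏ h ∈ Finset.Ico i k, g h) + f k *
        (if i ≤ t ∧ t < k then (∏ h ∈ Finset.Ico i t, g h) * ∏ h ∈ Finset.Ico t k, f h else 0) := by
      rcases eq_or_ne k t with rfl | hne
      · simp [hk, hft]
      · by_cases hs : i ≤ t ∧ t < k
        · rw [if_pos ⟨hs.1, by omega⟩, if_neg hne, if_pos hs, Finset.prod_Ico_succ_top hs.2.le]
          ring
        · rw [if_neg (by omega), if_neg hne, if_neg hs]; ring
    have e₃ : (if i ≤ s ∧ s < t ∧ t < k + 1 then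
        (∏ h ∈ Finset.Ico i s, f h) * (∏ h ∈ Finset.Ico s t, g h) * ∏ h ∈ Finset.Ico t (k + 1), f h
        else 0) = (if k = t then 1 else 0) *
        (if i ≤ s ∧ s < k then (∏ h ∈ Finset.Ico i s, f h) * ∏ h ∈ Finset.Ico s k, g h else 0) +
        f k * (if i ≤ s ∧ s < t ∧ t < k then
        (∏ h ∈ Finset.Ico i s, f h) * (∏ h ∈ Finset.Ico s t, g h) * ∏ h ∈ Finset.Ico t k, f h
        else 0) := by
      rcases eq_or_ne k t with rfl | hne
      · simp [hft]
      · by_cases hs : i ≤ s ∧ s < t ∧ t < k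
        · rw [if_pos ⟨hs.1, hs.2.1, by omega⟩, if_neg hne, if_pos hs,
            Finset.prod_Ico_succ_top hs.2.2.le]
          ring
        · rw [if_neg (by omega), if_neg hne, if_neg hs]; ring
    rw [e₁, e₂, e₃, Finset.prod_Ico_succ_top hk, Finset.prod_Ico_succ_top hk]
    ext a b
    fin_cases a <;> fin_cases b <;>
      simp [stepMatrix, Matrix.mul_apply, Fin.sum_univ_three, mul_comm]

/-- The product over the heights from `i` up to `k` on a circle of length `N`. -/
def cycProd (N : ℕ) (f : ℕ → R) (i k : ℕ) : R :=
  if i < k then ∏ h ∈ Finset.Ico i k, f h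
  else (∏ h ∈ Finset.Ico i N, f h) * ∏ h ∈ Finset.Ico 0 k, f h

/-- The transition matrix for moving from height `i` up to height `k` on a circle of length `N`. -/
def cycMatrix (N : ℕ) (f g : ℕ → R) (s t i k : ℕ) : Matrix (Fin 3) (Fin 3) R :=
  if i < k then pathMatrix f g s t i k else pathMatrix f g s t 0 k * pathMatrix f g s t i N

variable {N : ℕ}

theorem cycProd_mul_cycProd (hj : j ≤ N) (h : CycLT i j k) :
    cycProd N f i j * cycProd N f j k = cycProd N f i k := by
  unfold cycProd
  rcases h with h | h | h
  · rw [if_pos h.1, if_pos h.2, if_pos (h.1.trans h.2),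
      Finset.prod_Ico_consecutive _ h.1.le h.2.le]
  · rw [if_neg (by omega), if_pos h.1, if_neg (by omega), mul_assoc,
      Finset.prod_Ico_consecutive _ (by omega) h.1.le]
  · rw [if_pos h.2, if_neg (by omega), if_neg (by omega), ← mul_assoc,
      Finset.prod_Ico_consecutive _ h.2.le hj]

variable (s t) in
theorem cycMatrix_mul_cycMatrix (hj : j ≤ N) (h : CycLT i j k) :
    cycMatrix N f g s t j k * cycMatrix N f g s t i j = cycMatrix N f g s t i k := by
  unfold cycMatrix
  rcases h with h | h | h
  · rw [if_pos h.1, if_pos h.2, if_pos (h.1.trans h.2),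
      pathMatrix_mul_pathMatrix _ _ _ _ h.1.le h.2.le]
  · rw [if_pos h.1, if_neg (by omega : ¬ i < j), if_neg (by omega : ¬ i < k), ← mul_assoc,
      pathMatrix_mul_pathMatrix _ _ _ _ (by omega) h.1.le]
  · rw [if_pos h.2, if_neg (by omega : ¬ j < k), if_neg (by omega : ¬ i < k), mul_assoc,
      pathMatrix_mul_pathMatrix _ _ _ _ h.2.le hj]

theorem cycMatrix_mul_antiTranspose (h2 : ∀ z : R, z + z = 0) (hst : s ≠ t) (hi : i ≤ N) :
    cycMatrix N f g s t i k * antiTranspose (cycMatrix N g f t s i k) =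
      algebraMap R _ (cycProd N (fun h => f h * g h) i k) := by
  unfold cycMatrix cycProd
  split_ifs with h
  · exact pathMatrix_mul_antiTranspose f g h2 hst h.le
  · rw [antiTranspose_mul, mul_assoc, ← mul_assoc (pathMatrix f g s t i N),
      pathMatrix_mul_antiTranspose f g h2 hst hi, Algebra.commutes, ← mul_assoc,
      pathMatrix_mul_antiTranspose f g h2 hst (Nat.zero_le k), ← map_mul, mul_comm]

theorem antiTranspose_mul_cycMatrix (h2 : ∀ z : R, z + z = 0) (hst : s ≠ t) (hi : i ≤ N) :
    antiTranspose (cycMatrix N g f t s i k) * cycMatrix N f g s t i k =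
      algebraMap R _ (cycProd N (fun h => f h * g h) i k) := by
  unfold cycMatrix cycProd
  split_ifs with h
  · exact antiTranspose_mul_pathMatrix f g h2 hst h.le
  · rw [antiTranspose_mul, mul_assoc, ← mul_assoc (antiTranspose (pathMatrix g f t s 0 k)),
      antiTranspose_mul_pathMatrix f g h2 hst (Nat.zero_le k), Algebra.commutes, ← mul_assoc,
      antiTranspose_mul_pathMatrix f g h2 hst hi, ← map_mul]

/-- Going once around the circle, the loops in the two directions add up to a central matrix, which
does not depend on the starting point. -/
theorem loop_add_loop_eq (h2 : ∀ z : R, z + z = 0) (hst : s ≠ t) (hreg : ∀ h, IsLeftRegular (f h * g h))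
    {z w : R}
    (h0 : pathMatrix f g s t 0 N + antiTranspose (pathMatrix g f t s 0 N) =
      !![w, 0, 0; 0, w, 0; z, 0, w]) (hk : k ≤ N) :
    pathMatrix f g s t 0 k * pathMatrix f g s t k N +
      antiTranspose (pathMatrix g f t s 0 k * pathMatrix g f t s k N) =
      !![w, 0, 0; 0, w, 0; z, 0, w] := by
  induction k with
  | zero => simpa [pathMatrix_self, antiTranspose_mul, antiTranspose_one] using h0
  | succ k ih =>
    have ih := ih (by omega)
    have e {f g : ℕ → R} {s t : ℕ} : pathMatrix f g s t k N = pathMatrix f g s t (k + 1) N * stepMatrix f g s t k := by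
      rw [← pathMatrix_mul_pathMatrix f g s t (Nat.le_succ k) hk, pathMatrix_succ _ _ _ _ le_rfl,
        pathMatrix_self, mul_one]
    set Z : Matrix (Fin 3) (Fin 3) R := !![w, 0, 0; 0, w, 0; z, 0, w] with hZ
    -- The lower left entry of `Z` causes no obstruction because both outer diagonal entries of the
    -- step matrix equal `f k`.
    have hc : stepMatrix f g s t k * Z = Z * stepMatrix f g s t k := by
      ext a b
      fin_cases a <;> fin_cases b <;>
        simp [hZ, stepMatrix, Matrix.mul_apply, Fin.sum_univ_three, mul_comm]
    -- Multiplying by the step matrix on the left and by its reversed partner on the right moves the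
    -- starting point past `k` at the cost of the scalar `f k * g k`, which is cancelled by
    -- regularity.
    have key : algebraMap R _ (f k * g k) * (pathMatrix f g s t 0 (k + 1) * pathMatrix f g s t (k + 1) N +
      antiTranspose (pathMatrix g f t s 0 (k + 1) * pathMatrix g f t s (k + 1) N)) =
        algebraMap R _ (f k * g k) * Z := by
      calc _ = stepMatrix f g s t k * (pathMatrix f g s t 0 k * pathMatrix f g s t k N +
            antiTranspose (pathMatrix g f t s 0 k * pathMatrix g f t s k N)) *
            antiTranspose (stepMatrix g f t s k) := by
            rw [e, e, pathMatrix_succ _ _ _ _ (Nat.zero_le k), pathMatrix_succ _ _ _ _ (Nat.zero_le k)]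
            simp only [antiTranspose_mul, mul_add, add_mul]
            congr 1
            · rw [Algebra.commutes, ← stepMatrix_mul_antiTranspose f g h2 hst]
              simp only [mul_assoc]
            · rw [← stepMatrix_mul_antiTranspose f g h2 hst]
              simp only [mul_assoc]
        _ = _ := by
          rw [ih, hc, mul_assoc, stepMatrix_mul_antiTranspose f g h2 hst, Algebra.commutes]
    ext a b
    have := congrFun (congrFun key a) b
    rw [← Algebra.smul_def, ← Algebra.smul_def] at this
    exact hreg k (by simpa using this)

theorem cycMatrix_zero_zero (hst : s ≠ t) (hfs : f s = 1) (hgs : g s = 1) (hft : f t = 1)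
    (hgt : g t = 1) (hi : i ≤ N) : cycMatrix N f g s t i k 0 0 = cycProd N f i k := by
  unfold cycMatrix cycProd
  split_ifs with h
  · rw [pathMatrix_eq f g hst hfs hgs hft hgt h.le]; simp
  · rw [pathMatrix_eq f g hst hfs hgs hft hgt hi,
      pathMatrix_eq f g hst hfs hgs hft hgt (Nat.zero_le k)]
    simp [Matrix.mul_apply, Fin.sum_univ_three, mul_comm]

theorem cycMatrix_one_one (hst : s ≠ t) (hfs : f s = 1) (hgs : g s = 1) (hft : f t = 1)
    (hgt : g t = 1) (hi : i ≤ N) : cycMatrix N f g s t i k 1 1 = cycProd N g i k := by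
  unfold cycMatrix cycProd
  split_ifs with h
  · rw [pathMatrix_eq f g hst hfs hgs hft hgt h.le]; simp
  · rw [pathMatrix_eq f g hst hfs hgs hft hgt hi,
      pathMatrix_eq f g hst hfs hgs hft hgt (Nat.zero_le k)]
    simp [Matrix.mul_apply, Fin.sum_univ_three, mul_comm]

theorem cycMatrix_two_two (hst : s ≠ t) (hfs : f s = 1) (hgs : g s = 1) (hft : f t = 1)
    (hgt : g t = 1) (hi : i ≤ N) : cycMatrix N f g s t i k 2 2 = cycProd N f i k := by
  unfold cycMatrix cycProd
  split_ifs with h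
  · rw [pathMatrix_eq f g hst hfs hgs hft hgt h.le]; simp
  · rw [pathMatrix_eq f g hst hfs hgs hft hgt hi,
      pathMatrix_eq f g hst hfs hgs hft hgt (Nat.zero_le k)]
    simp [Matrix.mul_apply, Fin.sum_univ_three, mul_comm]

theorem cycMatrix_eq_zero (hst : s ≠ t) (hfs : f s = 1) (hgs : g s = 1) (hft : f t = 1)
    (hgt : g t = 1) (hi : i ≤ N) {a b : Fin 3} (hab : a < b) : cycMatrix N f g s t i k a b = 0 := by
  unfold cycMatrix
  split_ifs with h
  · rw [pathMatrix_eq f g hst hfs hgs hft hgt h.le]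
    fin_cases a <;> fin_cases b <;> simp at hab ⊢
  · rw [pathMatrix_eq f g hst hfs hgs hft hgt hi,
      pathMatrix_eq f g hst hfs hgs hft hgt (Nat.zero_le k)]
    fin_cases a <;> fin_cases b <;> simp [Matrix.mul_apply, Fin.sum_univ_three] at hab ⊢

theorem cycMatrix_one_zero (hst : s ≠ t) (hfs : f s = 1) (hgs : g s = 1) (hft : f t = 1)
    (hgt : g t = 1) (hi : i ≤ N) (hsN : s < N) (his : i ≠ s) (hik : i ≠ k) :
    cycMatrix N f g s t i k 1 0 =
      if CycLT i s k then cycProd N f i s * cycProd N g s k else 0 := by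
  unfold cycMatrix
  split_ifs with h h' h'
  · have : i < s ∧ s < k := by unfold CycLT at h'; omega
    rw [pathMatrix_eq f g hst hfs hgs hft hgt h.le]
    simp [cycProd, this, this.1.le]
  · have : ¬ (i ≤ s ∧ s < k) := by unfold CycLT at h'; omega
    rw [pathMatrix_eq f g hst hfs hgs hft hgt h.le]
    simp [this]
  · rw [pathMatrix_eq f g hst hfs hgs hft hgt hi,
      pathMatrix_eq f g hst hfs hgs hft hgt (Nat.zero_le k)]
    rcases lt_or_ge s k with hs | hs
    · have h₁ : ¬ i < s := by omega
      have h₂ : ¬ i ≤ s := by omega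
      simp only [Matrix.mul_apply, Fin.sum_univ_three]
      simp [cycProd, hs, h₁, h₂]
      ring
    · have h₁ : i < s := by unfold CycLT at h'; omega
      simp only [Matrix.mul_apply, Fin.sum_univ_three]
      simp [cycProd, hs.not_gt, h₁, h₁.le, hsN]
      ring
  · have h₁ : ¬ (i ≤ s ∧ s < N) := by unfold CycLT at h'; omega
    have h₂ : ¬ s < k := by unfold CycLT at h'; omega
    rw [pathMatrix_eq f g hst hfs hgs hft hgt hi,
      pathMatrix_eq f g hst hfs hgs hft hgt (Nat.zero_le k)]
    simp [Matrix.mul_apply, Fin.sum_univ_three, h₁, h₂]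

theorem cycMatrix_two_one (hst : s ≠ t) (hfs : f s = 1) (hgs : g s = 1) (hft : f t = 1)
    (hgt : g t = 1) (hi : i ≤ N) (htN : t < N) (hit : i ≠ t) (hik : i ≠ k) :
    cycMatrix N f g s t i k 2 1 =
      if CycLT i t k then cycProd N g i t * cycProd N f t k else 0 := by
  unfold cycMatrix
  split_ifs with h h' h'
  · have : i < t ∧ t < k := by unfold CycLT at h'; omega
    rw [pathMatrix_eq f g hst hfs hgs hft hgt h.le]
    simp [cycProd, this, this.1.le]
  · have : ¬ (i ≤ t ∧ t < k) := by unfold CycLT at h'; omega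
    rw [pathMatrix_eq f g hst hfs hgs hft hgt h.le]
    simp [this]
  · rw [pathMatrix_eq f g hst hfs hgs hft hgt hi,
      pathMatrix_eq f g hst hfs hgs hft hgt (Nat.zero_le k)]
    rcases lt_or_ge t k with hs | hs
    · have h₁ : ¬ i < t := by omega
      have h₂ : ¬ i ≤ t := by omega
      simp only [Matrix.mul_apply, Fin.sum_univ_three]
      simp [cycProd, hs, h₁, h₂]
      ring
    · have h₁ : i < t := by unfold CycLT at h'; omega
      simp only [Matrix.mul_apply, Fin.sum_univ_three]
      simp [cycProd, hs.not_gt, h₁, h₁.le, htN]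
      ring
  · have h₁ : ¬ (i ≤ t ∧ t < N) := by unfold CycLT at h'; omega
    have h₂ : ¬ t < k := by unfold CycLT at h'; omega
    rw [pathMatrix_eq f g hst hfs hgs hft hgt hi,
      pathMatrix_eq f g hst hfs hgs hft hgt (Nat.zero_le k)]
    simp [Matrix.mul_apply, Fin.sum_univ_three, h₁, h₂]

theorem cycMatrix_two_zero (hst : s ≠ t) (hfs : f s = 1) (hgs : g s = 1) (hft : f t = 1)
    (hgt : g t = 1) (hi : i ≤ N) (hsN : s < N) (htN : t < N) (his : i ≠ s) (hit : i ≠ t)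
    (hik : i ≠ k) (hsk : s ≠ k) (htk : t ≠ k) :
    cycMatrix N f g s t i k 2 0 =
      if CycLT i s t ∧ CycLT s t k ∧ CycLT i t k then
        cycProd N f i s * cycProd N g s t * cycProd N f t k else 0 := by
  unfold cycMatrix
  split_ifs with h h' h'
  · have : i < s ∧ s < t ∧ t < k := by unfold CycLT at h'; omega
    rw [pathMatrix_eq f g hst hfs hgs hft hgt h.le]
    simp [cycProd, this, this.1.le]
  · have : ¬ (i ≤ s ∧ s < t ∧ t < k) := by unfold CycLT at h'; omega
    rw [pathMatrix_eq f g hst hfs hgs hft hgt h.le]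
    simp [this]
  · rw [pathMatrix_eq f g hst hfs hgs hft hgt hi,
      pathMatrix_eq f g hst hfs hgs hft hgt (Nat.zero_le k)]
    -- A path through height `0` is a product of two path matrices. The two changes lie both after
    -- `0`, on different sides of it, or both before it.
    rcases lt_or_ge s k with hs | hs
    · have h₀ : s < t ∧ t < k := by unfold CycLT at h'; omega
      have h₁ : ¬ i < s := by omega
      have h₂ : ¬ i ≤ s := by omega
      have h₃ : ¬ i ≤ t := by omega
      simp only [Matrix.mul_apply, Fin.sum_univ_three]
      simp [cycProd, h₀, h₁, h₂, h₃]
      ring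
    · have h₁ : i < s := by unfold CycLT at h'; omega
      rcases lt_or_ge t k with ht | ht
      · have h₂ : ¬ i ≤ t := by omega
        have h₃ : ¬ s < t := by omega
        simp only [Matrix.mul_apply, Fin.sum_univ_three]
        simp [cycProd, hs.not_gt, h₁, h₁.le, h₂, h₃, hsN, ht]
        ring
      · have h₂ : s < t := by unfold CycLT at h'; omega
        simp only [Matrix.mul_apply, Fin.sum_univ_three]
        simp [cycProd, hs.not_gt, h₁, h₁.le, h₂, htN, ht.not_gt]
        ring
  · have h₁ : ¬ (i ≤ s ∧ s < t ∧ t < N) := by unfold CycLT at h'; omega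
    have h₂ : ¬ (s < t ∧ t < k) := by unfold CycLT at h'; omega
    have h₃ : ¬ (t < k ∧ (i ≤ s ∧ s < N)) := by unfold CycLT at h'; omega
    rw [pathMatrix_eq f g hst hfs hgs hft hgt hi,
      pathMatrix_eq f g hst hfs hgs hft hgt (Nat.zero_le k)]
    by_cases ht : t < k
    · have h₄ : ¬ (i ≤ s ∧ s < N) := fun h => h₃ ⟨ht, h⟩
      simp [Matrix.mul_apply, Fin.sum_univ_three, h₁, h₂, h₄]
    · simp [Matrix.mul_apply, Fin.sum_univ_three, h₁, ht]

/-- The product of a function that differs from `1` at one height only. -/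
theorem cycProd_single {u : ℕ} (z : R) (hu : u < N) (hiu : i ≠ u) (hik : i ≠ k) :
    cycProd N (fun h => if h = u then z else 1) i k = if CycLT i u k then z else 1 := by
  unfold cycProd
  simp only [Finset.prod_ite_eq', Finset.mem_Ico, Nat.zero_le, true_and, hu, and_true]
  rcases lt_or_ge i k with h | h
  · rw [if_pos h]
    exact if_congr (by unfold CycLT; omega) rfl rfl
  · rw [if_neg h.not_gt]
    by_cases h₁ : i ≤ u
    · rw [if_pos h₁, if_neg (by omega), if_pos (by unfold CycLT; omega), mul_one]
    · rw [if_neg h₁, one_mul]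
      exact if_congr (by unfold CycLT; omega) rfl rfl

end PathMatrices
end GridHomology
end

/-! ### Two diagrams on one torus and the matrix weight of a box -/

noncomputable section
namespace GridHomology
open GridDiagram

/-- Two diagrams which differ by an interchange of the consecutive columns `l` and `r`, together with
the heights of two intersection points of the circles that separate these columns in the two
diagrams. -/
structure BrokenCircle (n : ℕ) where
  G : GridDiagram n
  G' : GridDiagram n
  l : Fin n
  r : Fin n
  succ : (r : ℕ) = l + 1
  swap_O : G'.O = G.O * Equiv.swap l r
  s : ℕ
  t : ℕ
  s_odd : s % 2 = 1
  t_odd : t % 2 = 1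
  s_lt : s < 4 * n
  t_lt : t < 4 * n
  ne : s ≠ t

namespace BrokenCircle

variable {n : ℕ} (F : BrokenCircle n)

/-- The weight of a left side on the circle of `G`. -/
def leftWeight (h : ℕ) : BaseRing n :=
  if h = 4 * (F.G.O F.r : ℕ) + 2 then MvPolynomial.X (F.G.O F.r) else 1

/-- The weight of a right side on the circle of `G`. -/
def rightWeight (h : ℕ) : BaseRing n :=
  if h = 4 * (F.G.O F.l : ℕ) + 2 then MvPolynomial.X (F.G.O F.l) else 1

/-- The weights of the rows whose `O` does not lie in one of the columns `l` and `r`. -/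
def commonWeight (ρ : Fin n) : BaseRing n :=
  if ρ = F.G.O F.r ∨ ρ = F.G.O F.l then 1 else MvPolynomial.X ρ

theorem leftWeight_odd {h : ℕ} (hh : h % 2 = 1) : F.leftWeight h = 1 := if_neg (by omega)

theorem rightWeight_odd {h : ℕ} (hh : h % 2 = 1) : F.rightWeight h = 1 := if_neg (by omega)

theorem l_ne_r : F.l ≠ F.r := ne_of_val (by have := F.succ; omega)

theorem baseRing_add_self (z : BaseRing n) : z + z = 0 := CharTwo.add_self_eq_zero z

/-- The weights of the sides on the special circle. -/
def transport : SideTransport n (BaseRing n) (Matrix (Fin 3) (Fin 3) (BaseRing n)) where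
  up A B := cycMatrix (4 * n) F.leftWeight F.rightWeight F.s F.t (4 * A) (4 * B)
  down A B := antiTranspose (cycMatrix (4 * n) F.rightWeight F.leftWeight F.t F.s (4 * A) (4 * B))
  full A B := cycProd (4 * n) (fun h => F.leftWeight h * F.rightWeight h) (4 * A) (4 * B)
  up_mul_up {A B C} h := cycMatrix_mul_cycMatrix _ _ _ _ (by omega) (h.mul_left 4 four_pos)
  down_mul_down {A B C} h := by
    rw [← antiTranspose_mul, cycMatrix_mul_cycMatrix _ _ _ _ (by omega) (h.mul_left 4 four_pos)]
  full_mul_full {A B C} h := cycProd_mul_cycProd _ (by omega) (h.mul_left 4 four_pos)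
  up_mul_down {A B} _ := cycMatrix_mul_antiTranspose _ _ baseRing_add_self F.ne (by omega)
  down_mul_up {A B} _ := antiTranspose_mul_cycMatrix _ _ baseRing_add_self F.ne (by omega)

theorem cycMatrix_mul_loop {R : Type*} [CommRing R] (f g : ℕ → R) (s t : ℕ) {N i j : ℕ} (hij : i ≠ j)
    (hj : j ≤ N) : cycMatrix N f g s t j i * cycMatrix N f g s t i j =
      pathMatrix f g s t 0 i * pathMatrix f g s t i N := by
  unfold cycMatrix
  rcases lt_or_gt_of_ne hij with h | h
  · rw [if_pos h, if_neg h.not_gt, mul_assoc, pathMatrix_mul_pathMatrix _ _ _ _ h.le hj]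
  · rw [if_pos h, if_neg h.not_gt, ← mul_assoc, pathMatrix_mul_pathMatrix _ _ _ _ (by omega) h.le]

/-- These are the vertical annuli on the two sides of the special circle. Going once around collects
every left weight or every right weight, whence the diagonal; single changes occur in both loops
with equal weight and cancel. -/
theorem transport_loop {z : BaseRing n}
    (hz : pathMatrix F.leftWeight F.rightWeight F.s F.t 0 (4 * n) 2 0 +
      pathMatrix F.rightWeight F.leftWeight F.t F.s 0 (4 * n) 2 0 = z)
    (A B C : Fin n) (hAB : A ≠ B) (hAC : A ≠ C) :
    F.transport.up B A * F.transport.up A B + F.transport.down A C * F.transport.down C A =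
      !![MvPolynomial.X (F.G.O F.r) + MvPolynomial.X (F.G.O F.l), 0, 0;
        0, MvPolynomial.X (F.G.O F.r) + MvPolynomial.X (F.G.O F.l), 0;
        z, 0, MvPolynomial.X (F.G.O F.r) + MvPolynomial.X (F.G.O F.l)] := by
  have hs := F.s_odd
  have ht := F.t_odd
  simp only [transport]
  rw [← antiTranspose_mul, cycMatrix_mul_loop, cycMatrix_mul_loop]
  · apply loop_add_loop_eq _ _ baseRing_add_self F.ne
    · intro h
      refine (IsRegular.of_ne_zero (mul_ne_zero ?_ ?_)).left
      · unfold leftWeight; split_ifs <;> simp [MvPolynomial.X_ne_zero]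
      · unfold rightWeight; split_ifs <;> simp [MvPolynomial.X_ne_zero]
    · have hf : ∏ h ∈ Finset.Ico 0 (4 * n), F.leftWeight h = MvPolynomial.X (F.G.O F.r) := by
        unfold leftWeight
        rw [Finset.prod_ite_eq', if_pos]
        simp; omega
      have hg : ∏ h ∈ Finset.Ico 0 (4 * n), F.rightWeight h = MvPolynomial.X (F.G.O F.l) := by
        unfold rightWeight
        rw [Finset.prod_ite_eq', if_pos]
        simp; omega
      rw [pathMatrix_eq _ _ F.ne (F.leftWeight_odd hs) (F.rightWeight_odd hs)
        (F.leftWeight_odd ht) (F.rightWeight_odd ht) (Nat.zero_le _),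
        pathMatrix_eq _ _ F.ne.symm (F.rightWeight_odd ht) (F.leftWeight_odd ht)
        (F.rightWeight_odd hs) (F.leftWeight_odd hs) (Nat.zero_le _)] at hz ⊢
      rw [hf, hg]
      refine Matrix.ext fun a b => ?_
      fin_cases a <;> fin_cases b <;>
        simp [antiTranspose, Fin.rev, add_comm, CharTwo.add_self_eq_zero]
      simpa using hz
    · omega
  all_goals omega

theorem cycNext_l : cycNext F.l = F.r := by
  have := F.succ; have := F.r.isLt
  ext
  simp only [cycNext]
  rw [if_pos] <;> omega

theorem cycProd_mul {R : Type*} [CommRing R] (N : ℕ) (f g : ℕ → R) (i k : ℕ) :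
    cycProd N (fun h => f h * g h) i k = cycProd N f i k * cycProd N g i k := by
  unfold cycProd
  split_ifs <;> simp only [Finset.prod_mul_distrib]
  ring

theorem cycProd_leftWeight {i k : ℕ} (hi : i ≠ k)
    (hi' : i ≠ 4 * F.G.O F.r + 2) :
    cycProd (4 * n) F.leftWeight i k =
      if CycLT i (4 * F.G.O F.r + 2) k then MvPolynomial.X (F.G.O F.r) else 1 :=
  cycProd_single _ (by omega) hi' hi

theorem cycProd_rightWeight {i k : ℕ} (hi : i ≠ k)
    (hi' : i ≠ 4 * F.G.O F.l + 2) :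
    cycProd (4 * n) F.rightWeight i k =
      if CycLT i (4 * F.G.O F.l + 2) k then MvPolynomial.X (F.G.O F.l) else 1 :=
  cycProd_single _ (by omega) hi' hi

/-- A horizontal annulus of height one contains just the `O` of its row. It is accounted for by the
common weight, or by the special circle if it lies in one of the two columns. -/
theorem commonWeight_mul_full (hn : 2 ≤ n) (ρ : Fin n) :
    F.commonWeight ρ * F.transport.full ρ (cycNext ρ) = MvPolynomial.X ρ := by
  have hne : ρ ≠ cycNext ρ := ((eq_cycNext_iff hn ρ _).2 rfl).1
  have hne' : 4 * (ρ : ℕ) ≠ 4 * (cycNext ρ : Fin n) := by have := val_ne hne; omega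
  have e (m : Fin n) : CycLT (4 * ρ) (4 * m + 2) (4 * (cycNext ρ : Fin n)) ↔ m = ρ := by
    have := arcInd_rows_cycNext hn ρ m
    unfold arcInd at this
    by_cases h : m = ρ
    · simpa [h] using this
    · simpa [h] using this
  have hlr : F.G.O F.l ≠ F.G.O F.r := fun h => F.l_ne_r (F.G.O.injective h)
  simp only [transport]
  rw [cycProd_mul, F.cycProd_leftWeight hne' (by omega), F.cycProd_rightWeight hne' (by omega)]
  simp only [e]
  unfold commonWeight
  rcases eq_or_ne ρ (F.G.O F.r) with rfl | h₁
  · simp [hlr]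
  rcases eq_or_ne ρ (F.G.O F.l) with rfl | h₂
  · simp [hlr.symm]
  · simp [h₁, h₁.symm, h₂, h₂.symm]

/-- The matrix of weights of a box, zero unless the box is empty. -/
def weight (x : GridState n) (a b : Fin n) : Matrix (Fin 3) (Fin 3) (BaseRing n) :=
  F.transport.boxTerm F.commonWeight F.G.O.symm F.r x a b

/-- The operator that counts all empty boxes with their matrices of weights has a simple square. -/
theorem sum_single_weight_mul_weight (hn : 2 ≤ n) {z : BaseRing n}
    (hz : pathMatrix F.leftWeight F.rightWeight F.s F.t 0 (4 * n) 2 0 +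
      pathMatrix F.rightWeight F.leftWeight F.t F.s 0 (4 * n) 2 0 = z) (x : GridState n) :
    ∑ a, ∑ b, ∑ c, ∑ d, Finsupp.single (x * Equiv.swap a b * Equiv.swap c d)
      (F.weight (x * Equiv.swap a b) c d * F.weight x a b) =
      Finsupp.single x !![0, 0, 0; 0, 0, 0; z, 0, 0] := by
  have h := F.transport.sum_pairTerm_eq F.commonWeight F.G.O.symm F.r x hn
    (fun z => Matrix.ext fun a b => baseRing_add_self _) F.cycNext_l
    (by simp [commonWeight]) (by simp [commonWeight])
    (F.transport_loop hz) F.l_ne_r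
  refine Eq.trans h (congrArg _ ?_)
  -- Every column other than `l` and `r` cancels the horizontal annulus through its `O`. The two
  -- variables left over are the diagonal entry of the loop matrix, so only the lower left entry
  -- survives.
  have e : (∑ a, if a ≠ F.l ∧ a ≠ F.r then F.commonWeight (F.G.O.symm.symm a) else 0) +
      ∑ ρ, F.commonWeight ρ * F.transport.full ρ (cycNext ρ) =
      MvPolynomial.X (F.G.O F.l) + MvPolynomial.X (F.G.O F.r) := by
    simp only [F.commonWeight_mul_full hn]
    rw [← Equiv.sum_comp F.G.O (fun ρ => (MvPolynomial.X ρ : BaseRing n)),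
      sum_eq_add_add_sum_ite F.l_ne_r (fun a => (MvPolynomial.X (F.G.O a) : BaseRing n)),
      add_left_comm]
    rw [← Finset.sum_add_distrib, Finset.sum_eq_zero, add_zero]
    intro a _
    split_ifs with ha
    · simp [commonWeight, ha.1, ha.2, baseRing_add_self]
    · exact add_zero 0
  rw [e]
  refine Matrix.ext fun a b => ?_
  fin_cases a <;> fin_cases b <;>
    simp [Matrix.algebraMap_matrix_apply, baseRing_add_self, add_comm]

/-- The product of the weights of the circle of `G` along a left side. -/
def leftArc (i k : ℕ) : BaseRing n :=
  if CycLT i (4 * F.G.O F.r + 2) k then MvPolynomial.X (F.G.O F.r) else 1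

/-- The product of the weights of the circle of `G` along a right side. -/
def rightArc (i k : ℕ) : BaseRing n :=
  if CycLT i (4 * F.G.O F.l + 2) k then MvPolynomial.X (F.G.O F.l) else 1

section Monomials

variable {x : GridState n} {a b : Fin n}

/-- Column `r` lies immediately to the right of the circle `r` and column `l` immediately to its
left. So a box contains the one or the other according to which of its sides is on that circle, and
both if it reaches across. -/
theorem coversO_right (hab : a ≠ b) : CoversO F.G x (a, b) (F.G.O F.r) ↔
    CycLT (4 * x a) (4 * F.G.O F.r + 2) (4 * x b) ∧ (a = F.r ∨ CycLT a F.r b) := by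
  have := val_ne hab
  rw [CoversO, Equiv.symm_apply_apply, Fin.ext_iff]
  refine and_congr Iff.rfl ?_
  unfold CycLT; dsimp only; omega

theorem coversO_left (hab : a ≠ b) : CoversO F.G x (a, b) (F.G.O F.l) ↔
    CycLT (4 * x a) (4 * F.G.O F.l + 2) (4 * x b) ∧ (b = F.r ∨ CycLT a F.r b) := by
  have := val_ne hab
  have := F.succ
  rw [CoversO, Equiv.symm_apply_apply, Fin.ext_iff]
  refine and_congr Iff.rfl ?_
  unfold CycLT; dsimp only; omega

theorem coversO_right' (hab : a ≠ b) : CoversO F.G' x (a, b) (F.G.O F.r) ↔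
    CycLT (4 * x a) (4 * F.G.O F.r + 2) (4 * x b) ∧ (b = F.r ∨ CycLT a F.r b) := by
  have := val_ne hab
  have := F.succ
  have e : F.G'.O.symm (F.G.O F.r) = F.l := by
    rw [Equiv.symm_apply_eq, F.swap_O, Equiv.Perm.mul_apply, Equiv.swap_apply_left]
  rw [CoversO, e, Fin.ext_iff]
  refine and_congr Iff.rfl ?_
  unfold CycLT; dsimp only; omega

theorem coversO_left' (hab : a ≠ b) : CoversO F.G' x (a, b) (F.G.O F.l) ↔
    CycLT (4 * x a) (4 * F.G.O F.l + 2) (4 * x b) ∧ (a = F.r ∨ CycLT a F.r b) := by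
  have := val_ne hab
  have e : F.G'.O.symm (F.G.O F.l) = F.r := by
    rw [Equiv.symm_apply_eq, F.swap_O, Equiv.Perm.mul_apply, Equiv.swap_apply_right]
  rw [CoversO, e, Fin.ext_iff]
  refine and_congr Iff.rfl ?_
  unfold CycLT; dsimp only; omega

/-- Splitting off the two `O`s whose position relative to the broken circle matters. -/
theorem monomialOf_eq (side : Fin n → GridDiagram n) (hside : ∀ ρ, side ρ = F.G ∨ side ρ = F.G') :
    monomialOf side x (a, b) =
      markWeight F.commonWeight F.G.O.symm a b (x a) (x b) *
      ((if CoversO (side (F.G.O F.r)) x (a, b) (F.G.O F.r) then MvPolynomial.X (F.G.O F.r) else 1) *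
        (if CoversO (side (F.G.O F.l)) x (a, b) (F.G.O F.l) then MvPolynomial.X (F.G.O F.l)
          else 1)) := by
  have hlr : F.G.O F.r ≠ F.G.O F.l := fun h => F.l_ne_r (F.G.O.injective h).symm
  have e (ρ₀ : Fin n) : (if CoversO (side ρ₀) x (a, b) ρ₀ then (MvPolynomial.X ρ₀ : BaseRing n) else 1) =
      ∏ ρ, if ρ = ρ₀ then (if CoversO (side ρ) x (a, b) ρ then MvPolynomial.X ρ else 1) else 1 := by
    rw [Finset.prod_ite_eq', if_pos (Finset.mem_univ _)]
  rw [e, e, monomialOf, markWeight, ← Finset.prod_mul_distrib, ← Finset.prod_mul_distrib]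
  refine Finset.prod_congr rfl fun ρ _ => ?_
  rcases eq_or_ne ρ (F.G.O F.r) with rfl | h₁
  · simp [commonWeight, hlr, pow_ite]
  rcases eq_or_ne ρ (F.G.O F.l) with rfl | h₂
  · simp [commonWeight, h₁, pow_ite]
  have hcol : (side ρ).O.symm ρ = F.G.O.symm ρ := by
    rcases hside ρ with h | h
    · rw [h]
    · rw [h, Equiv.symm_apply_eq, F.swap_O, Equiv.Perm.mul_apply, Equiv.swap_apply_of_ne_of_ne,
        Equiv.apply_symm_apply]
      · rwa [ne_eq, Equiv.symm_apply_eq]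
      · rwa [ne_eq, Equiv.symm_apply_eq]
  simp only [commonWeight, h₁, h₂, or_self, if_false, mul_one, CoversO, hcol, arcInd, ite_and,
    mul_ite, mul_zero]

theorem weight_apply (i j : Fin 3) : F.weight x a b i j =
    if a ≠ b ∧ IsEmptyBox x (a, b) then
      markWeight F.commonWeight F.G.O.symm a b (x a) (x b) *
        F.transport.factor F.r a b (x a) (x b) i j else 0 := by
  unfold weight SideTransport.boxTerm
  split_ifs <;> simp

theorem full_eq {A B : Fin n} (hAB : A ≠ B) : F.transport.full A B =
    (if CycLT (4 * A) (4 * F.G.O F.r + 2) (4 * B) then MvPolynomial.X (F.G.O F.r) else 1) *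
    (if CycLT (4 * A) (4 * F.G.O F.l + 2) (4 * B) then MvPolynomial.X (F.G.O F.l) else 1) := by
  have := val_ne hAB
  simp only [transport]
  rw [cycProd_mul, F.cycProd_leftWeight (by omega) (by omega),
    F.cycProd_rightWeight (by omega) (by omega)]

theorem transport_up_apply {A B : Fin n} (hAB : A ≠ B) :
    F.transport.up A B = !![
      F.leftArc (4 * A) (4 * B), 0, 0;
      if CycLT (4 * A) F.s (4 * B) then F.leftArc (4 * A) F.s * F.rightArc F.s (4 * B) else 0,
      F.rightArc (4 * A) (4 * B), 0;
      if CycLT (4 * A) F.s F.t ∧ CycLT F.s F.t (4 * B) ∧ CycLT (4 * A) F.t (4 * B) then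
        F.leftArc (4 * A) F.s * F.rightArc F.s F.t * F.leftArc F.t (4 * B) else 0,
      if CycLT (4 * A) F.t (4 * B) then F.rightArc (4 * A) F.t * F.leftArc F.t (4 * B) else 0,
      F.leftArc (4 * A) (4 * B)] := by
  have hs := F.s_odd
  have ht := F.t_odd
  have hst := F.ne
  have hs' := F.s_lt
  have ht' := F.t_lt
  have hv := val_ne hAB
  have h₁ := F.leftWeight_odd hs
  have h₂ := F.rightWeight_odd hs
  have h₃ := F.leftWeight_odd ht
  have h₄ := F.rightWeight_odd ht
  refine Matrix.ext fun i j => ?_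
  fin_cases i <;> fin_cases j
  · refine (cycMatrix_zero_zero _ _ hst h₁ h₂ h₃ h₄ (by omega)).trans ?_
    exact F.cycProd_leftWeight (by omega) (by omega)
  · exact cycMatrix_eq_zero _ _ hst h₁ h₂ h₃ h₄ (by omega) (by decide)
  · exact cycMatrix_eq_zero _ _ hst h₁ h₂ h₃ h₄ (by omega) (by decide)
  · refine (cycMatrix_one_zero _ _ hst h₁ h₂ h₃ h₄ (by omega) hs' (by omega) (by omega)).trans ?_
    rw [F.cycProd_leftWeight (by omega) (by omega), F.cycProd_rightWeight (by omega) (by omega)]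
    rfl
  · refine (cycMatrix_one_one _ _ hst h₁ h₂ h₃ h₄ (by omega)).trans ?_
    exact F.cycProd_rightWeight (by omega) (by omega)
  · exact cycMatrix_eq_zero _ _ hst h₁ h₂ h₃ h₄ (by omega) (by decide)
  · refine (cycMatrix_two_zero _ _ hst h₁ h₂ h₃ h₄ (by omega) hs' ht' (by omega) (by omega)
      (by omega) (by omega) (by omega)).trans ?_
    rw [F.cycProd_leftWeight (by omega) (by omega), F.cycProd_leftWeight (by omega) (by omega),
      F.cycProd_rightWeight (by omega) (by omega)]
    rfl
  · refine (cycMatrix_two_one _ _ hst h₁ h₂ h₃ h₄ (by omega) ht' (by omega) (by omega)).trans ?_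
    rw [F.cycProd_leftWeight (by omega) (by omega), F.cycProd_rightWeight (by omega) (by omega)]
    rfl
  · refine (cycMatrix_two_two _ _ hst h₁ h₂ h₃ h₄ (by omega)).trans ?_
    exact F.cycProd_leftWeight (by omega) (by omega)

/-- A right side is traversed downward from the initial corner. The antitransposition reverses the
order of the changes, so an entry for a change at `s` comes from the upward path with the circles
and the points exchanged. -/
theorem transport_down_apply {A B : Fin n} (hAB : A ≠ B) :
    F.transport.down A B = !![
      F.rightArc (4 * A) (4 * B), 0, 0;
      if CycLT (4 * A) F.s (4 * B) then F.leftArc (4 * A) F.s * F.rightArc F.s (4 * B) else 0,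
      F.leftArc (4 * A) (4 * B), 0;
      if CycLT (4 * A) F.t F.s ∧ CycLT F.t F.s (4 * B) ∧ CycLT (4 * A) F.s (4 * B) then
        F.rightArc (4 * A) F.t * F.leftArc F.t F.s * F.rightArc F.s (4 * B) else 0,
      if CycLT (4 * A) F.t (4 * B) then F.rightArc (4 * A) F.t * F.leftArc F.t (4 * B) else 0,
      F.rightArc (4 * A) (4 * B)] := by
  have hs := F.s_odd
  have ht := F.t_odd
  have hst := F.ne.symm
  have hs' := F.s_lt
  have ht' := F.t_lt
  have hv := val_ne hAB
  have h₁ := F.leftWeight_odd hs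
  have h₂ := F.rightWeight_odd hs
  have h₃ := F.leftWeight_odd ht
  have h₄ := F.rightWeight_odd ht
  refine Matrix.ext fun i j => ?_
  fin_cases i <;> fin_cases j
  · refine (cycMatrix_two_two _ _ hst h₄ h₃ h₂ h₁ (by omega)).trans ?_
    exact F.cycProd_rightWeight (by omega) (by omega)
  · exact cycMatrix_eq_zero _ _ hst h₄ h₃ h₂ h₁ (by omega) (by decide)
  · exact cycMatrix_eq_zero _ _ hst h₄ h₃ h₂ h₁ (by omega) (by decide)
  · refine (cycMatrix_two_one _ _ hst h₄ h₃ h₂ h₁ (by omega) hs' (by omega) (by omega)).trans ?_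
    rw [F.cycProd_leftWeight (by omega) (by omega), F.cycProd_rightWeight (by omega) (by omega)]
    rfl
  · refine (cycMatrix_one_one _ _ hst h₄ h₃ h₂ h₁ (by omega)).trans ?_
    exact F.cycProd_leftWeight (by omega) (by omega)
  · exact cycMatrix_eq_zero _ _ hst h₄ h₃ h₂ h₁ (by omega) (by decide)
  · refine (cycMatrix_two_zero _ _ hst h₄ h₃ h₂ h₁ (by omega) ht' hs' (by omega) (by omega)
      (by omega) (by omega) (by omega)).trans ?_
    rw [F.cycProd_rightWeight (by omega) (by omega), F.cycProd_rightWeight (by omega) (by omega),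
      F.cycProd_leftWeight (by omega) (by omega)]
    rfl
  · refine (cycMatrix_one_zero _ _ hst h₄ h₃ h₂ h₁ (by omega) ht' (by omega) (by omega)).trans ?_
    rw [F.cycProd_leftWeight (by omega) (by omega), F.cycProd_rightWeight (by omega) (by omega)]
    rfl
  · refine (cycMatrix_zero_zero _ _ hst h₄ h₃ h₂ h₁ (by omega)).trans ?_
    exact F.cycProd_rightWeight (by omega) (by omega)

/-- A diagonal entry means that no change of circle takes place, so the box is a rectangle of `G` in
the outer states and of `G'` in the middle state. -/
theorem weight_diag (side : GridDiagram n) (i : Fin 3)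
    (hi : (i = 1 ∧ side = F.G') ∨ (i ≠ 1 ∧ side = F.G)) : F.weight x a b i i =
    if a ≠ b ∧ IsEmptyBox x (a, b) then monomialOf (fun _ => side) x (a, b) else 0 := by
  rw [weight_apply]
  refine ite_congr rfl (fun h => ?_) fun _ => rfl
  have hab := h.1
  have hx := val_apply_ne x hab
  rw [F.monomialOf_eq (fun _ => side) fun _ => by tauto]
  congr 1
  rcases eq_or_ne a F.r with rfl | ha
  · rw [SideTransport.factor_left, F.transport_up_apply (ne_of_val hx)]
    rcases hi with ⟨rfl, rfl⟩ | ⟨hi, rfl⟩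
    · simp [F.coversO_right' hab, F.coversO_left' hab, hab.symm, not_cycLT_left, rightArc]
    · fin_cases i <;>
        simp [F.coversO_right hab, F.coversO_left hab, hab.symm, not_cycLT_left, leftArc] at hi ⊢
  rcases eq_or_ne b F.r with rfl | hb
  · rw [SideTransport.factor_right _ ha, F.transport_down_apply (ne_of_val hx)]
    rcases hi with ⟨rfl, rfl⟩ | ⟨hi, rfl⟩
    · simp [F.coversO_right' hab, F.coversO_left' hab, ha, not_cycLT_right, leftArc]
    · fin_cases i <;>
        simp [F.coversO_right hab, F.coversO_left hab, ha, not_cycLT_right, rightArc] at hi ⊢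
  · rw [SideTransport.factor_of_ne _ ha hb]
    simp only [Matrix.algebraMap_matrix_apply, F.full_eq (ne_of_val hx)]
    rcases hi with ⟨rfl, rfl⟩ | ⟨hi, rfl⟩ <;>
    by_cases g : CycLT a F.r b <;>
      simp [ha, hb, g, F.coversO_right hab, F.coversO_left hab, F.coversO_right' hab,
        F.coversO_left' hab]

theorem and_cycLT_iff {i s k u : ℕ} (h : CycLT i s k) : CycLT i u k ∧ CycLT i u s ↔ CycLT i u s := by
  unfold CycLT at *; omega

theorem and_not_cycLT_iff {i s k u : ℕ} (h : CycLT i s k) (hu : u ≠ s) :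
    CycLT i u k ∧ ¬ CycLT i u s ↔ CycLT s u k := by
  unfold CycLT at *; omega

theorem coversO_ite_left {P : Prop} [Decidable P] (hab : F.r ≠ b) :
    (CoversO (if P then F.G else F.G') x (F.r, b) (F.G.O F.r) ↔
      CycLT (4 * x F.r) (4 * F.G.O F.r + 2) (4 * x b) ∧ P) ∧
    (CoversO (if P then F.G else F.G') x (F.r, b) (F.G.O F.l) ↔
      CycLT (4 * x F.r) (4 * F.G.O F.l + 2) (4 * x b) ∧ ¬ P) := by
  by_cases h : P <;>
    simp [h, F.coversO_right hab, F.coversO_left hab, F.coversO_right' hab, F.coversO_left' hab,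
      hab.symm, not_cycLT_left]

theorem coversO_ite_right {P : Prop} [Decidable P] (hab : a ≠ F.r) :
    (CoversO (if P then F.G else F.G') x (a, F.r) (F.G.O F.r) ↔
      CycLT (4 * x a) (4 * F.G.O F.r + 2) (4 * x F.r) ∧ ¬ P) ∧
    (CoversO (if P then F.G else F.G') x (a, F.r) (F.G.O F.l) ↔
      CycLT (4 * x a) (4 * F.G.O F.l + 2) (4 * x F.r) ∧ P) := by
  by_cases h : P <;>
    simp [h, F.coversO_right hab, F.coversO_left hab, F.coversO_right' hab, F.coversO_left' hab,
      hab, not_cycLT_right]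

/-- Exactly one change, at `s`, makes the box a pentagon. A box without a side on the special circle
has a scalar factor, whose off-diagonal entries vanish. -/
theorem weight_one_zero (D : CrossingChange n) (hD : D.right = F.r) : F.weight x a b 1 0 =
    if a ≠ b ∧ (a = F.r ∨ b = F.r) ∧ CycLT (4 * x a) F.s (4 * x b) ∧ IsEmptyBox x (a, b) then
      monomialOf (D.pentagonSide F.G F.G' F.s x (a, b)) x (a, b) else 0 := by
  rw [weight_apply]
  by_cases hab : a ≠ b ∧ IsEmptyBox x (a, b)
  swap
  · rw [if_neg hab, if_neg (by tauto)]
  rw [if_pos hab]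
  simp only [hab.1, hab.2, and_true, true_and, ne_eq, not_false_eq_true]
  have hab := hab.1
  have hx := val_apply_ne x hab
  have hs := F.s_odd
  rw [F.monomialOf_eq (D.pentagonSide F.G F.G' F.s x (a, b))
    fun _ => by unfold CrossingChange.pentagonSide; split_ifs <;> simp, ← mul_ite_zero]
  congr 1
  rcases eq_or_ne a F.r with rfl | ha
  · rw [SideTransport.factor_left, F.transport_up_apply (ne_of_val hx)]
    simp only [Matrix.of_apply, Matrix.cons_val', Matrix.cons_val_zero, Matrix.cons_val_one,
      true_or, true_and]
    refine ite_congr rfl (fun h => ?_) fun _ => rfl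
    simp only [CrossingChange.pentagonSide, hD, if_true, (F.coversO_ite_left hab).1,
      (F.coversO_ite_left hab).2, and_cycLT_iff h,
      and_not_cycLT_iff h (show 4 * (F.G.O F.l : ℕ) + 2 ≠ F.s by omega), leftArc, rightArc]
  rcases eq_or_ne b F.r with rfl | hb
  · rw [SideTransport.factor_right _ ha, F.transport_down_apply (ne_of_val hx)]
    simp only [Matrix.of_apply, Matrix.cons_val', Matrix.cons_val_zero, Matrix.cons_val_one,
      or_true, true_and]
    refine ite_congr rfl (fun h => ?_) fun _ => rfl
    simp only [CrossingChange.pentagonSide, hD, ha, if_false]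
    simp only [← ite_not _ F.G F.G',
      (F.coversO_ite_right hab).1, (F.coversO_ite_right hab).2, not_not, and_cycLT_iff h,
      and_not_cycLT_iff h (show 4 * (F.G.O F.l : ℕ) + 2 ≠ F.s by omega), leftArc, rightArc]
  · rw [SideTransport.factor_of_ne _ ha hb]
    simp [Matrix.algebraMap_matrix_apply, ha, hb]

theorem weight_two_one (D : CrossingChange n) (hD : D.right = F.r) : F.weight x a b 2 1 =
    if a ≠ b ∧ (a = F.r ∨ b = F.r) ∧ CycLT (4 * x a) F.t (4 * x b) ∧ IsEmptyBox x (a, b) then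
      monomialOf (D.pentagonSide F.G' F.G F.t x (a, b)) x (a, b) else 0 := by
  rw [weight_apply]
  by_cases hab : a ≠ b ∧ IsEmptyBox x (a, b)
  swap
  · rw [if_neg hab, if_neg (by tauto)]
  rw [if_pos hab]
  simp only [hab.1, hab.2, and_true, true_and, ne_eq, not_false_eq_true]
  have hab := hab.1
  have hx := val_apply_ne x hab
  have ht := F.t_odd
  rw [F.monomialOf_eq (D.pentagonSide F.G' F.G F.t x (a, b))
    fun _ => by unfold CrossingChange.pentagonSide; split_ifs <;> simp, ← mul_ite_zero]
  congr 1
  rcases eq_or_ne a F.r with rfl | ha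
  · rw [SideTransport.factor_left, F.transport_up_apply (ne_of_val hx)]
    simp only [Matrix.of_apply, Matrix.cons_val', Matrix.cons_val_two, Matrix.cons_val_one,
      true_or, true_and, Matrix.cons_val]
    refine ite_congr rfl (fun h => ?_) fun _ => rfl
    simp only [CrossingChange.pentagonSide, hD, if_true]
    simp only [← ite_not _ F.G F.G',
      (F.coversO_ite_left hab).1, (F.coversO_ite_left hab).2, not_not, and_cycLT_iff h,
      and_not_cycLT_iff h (show 4 * (F.G.O F.r : ℕ) + 2 ≠ F.t by omega), leftArc, rightArc,
      mul_comm]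
  rcases eq_or_ne b F.r with rfl | hb
  · rw [SideTransport.factor_right _ ha, F.transport_down_apply (ne_of_val hx)]
    simp only [Matrix.of_apply, Matrix.cons_val', Matrix.cons_val_two, Matrix.cons_val_one,
      or_true, true_and, Matrix.cons_val]
    refine ite_congr rfl (fun h => ?_) fun _ => rfl
    simp only [CrossingChange.pentagonSide, hD, ha, if_false,
      (F.coversO_ite_right hab).1, (F.coversO_ite_right hab).2, and_cycLT_iff h,
      and_not_cycLT_iff h (show 4 * (F.G.O F.r : ℕ) + 2 ≠ F.t by omega), leftArc, rightArc,
      mul_comm]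
  · rw [SideTransport.factor_of_ne _ ha hb]
    simp [Matrix.algebraMap_matrix_apply, ha, hb]

theorem ite_mul_ite_eq_ite_of_arcs {R : Type*} [CommRing R] {i s t k u : ℕ} (h : CycLT i s t)
    (h' : CycLT s t k) (h'' : CycLT i t k) (hs : u ≠ s) (ht : u ≠ t) (z : R) :
    (if CycLT i u s then z else 1) * (if CycLT t u k then z else 1) =
      if CycLT i u k ∧ ¬ CycLT s u t then z else 1 := by
  have e : CycLT i u k ∧ ¬ CycLT s u t ↔ CycLT i u s ∨ CycLT t u k := by
    unfold CycLT at *; omega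
  have e' : ¬ (CycLT i u s ∧ CycLT t u k) := by
    unfold CycLT at *; omega
  simp only [e]
  by_cases h₁ : CycLT i u s <;> by_cases h₂ : CycLT t u k <;> simp_all

theorem and_cycLT_middle_iff {i s t k u : ℕ} (h : CycLT i s t) (h' : CycLT s t k)
    (h'' : CycLT i t k) : CycLT i u k ∧ CycLT s u t ↔ CycLT s u t := by
  unfold CycLT at *; omega

theorem weight_two_zero (D : CrossingChange n) (hD : D.right = F.r) : F.weight x a b 2 0 =
    if a ≠ b ∧ (a = F.r ∨ b = F.r) ∧
      CycLT (4 * x a) (D.lowerCorner F.t F.s (a, b)) (D.upperCorner F.t F.s (a, b)) ∧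
      CycLT (D.lowerCorner F.t F.s (a, b)) (D.upperCorner F.t F.s (a, b)) (4 * x b) ∧
      CycLT (4 * x a) (D.upperCorner F.t F.s (a, b)) (4 * x b) ∧ IsEmptyBox x (a, b) then
      monomialOf (D.hexagonSide F.G F.G' F.t F.s (a, b)) x (a, b) else 0 := by
  rw [weight_apply]
  by_cases hab : a ≠ b ∧ IsEmptyBox x (a, b)
  swap
  · rw [if_neg hab, if_neg (by tauto)]
  rw [if_pos hab]
  simp only [hab.1, hab.2, and_true, true_and, ne_eq, not_false_eq_true]
  have hab := hab.1
  have hx := val_apply_ne x hab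
  have hs := F.s_odd
  have ht := F.t_odd
  rw [F.monomialOf_eq (D.hexagonSide F.G F.G' F.t F.s (a, b))
    fun _ => by unfold CrossingChange.hexagonSide; split_ifs <;> simp, ← mul_ite_zero]
  congr 1
  rcases eq_or_ne a F.r with rfl | ha
  · rw [SideTransport.factor_left, F.transport_up_apply (ne_of_val hx)]
    simp only [Matrix.of_apply, Matrix.cons_val', Matrix.cons_val_two, Matrix.cons_val_zero,
      true_or, true_and, CrossingChange.hexagonSide, CrossingChange.lowerCorner,
      CrossingChange.upperCorner, hD, if_true]
    refine ite_congr rfl (fun h => ?_) fun _ => rfl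
    simp only [← ite_not _ F.G F.G',
      (F.coversO_ite_left hab).1, (F.coversO_ite_left hab).2, not_not,
      and_cycLT_middle_iff h.1 h.2.1 h.2.2, leftArc, rightArc]
    -- The two outer parts of the broken side run along `G`; together they make up the side without
    -- the middle part.
    rw [mul_right_comm, ite_mul_ite_eq_ite_of_arcs h.1 h.2.1 h.2.2 (by omega) (by omega)]
  rcases eq_or_ne b F.r with rfl | hb
  · rw [SideTransport.factor_right _ ha, F.transport_down_apply (ne_of_val hx)]
    simp only [Matrix.of_apply, Matrix.cons_val', Matrix.cons_val_two, Matrix.cons_val_zero,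
      or_true, true_and, CrossingChange.hexagonSide, CrossingChange.lowerCorner,
      CrossingChange.upperCorner, hD, ha, if_false]
    refine ite_congr rfl (fun h => ?_) fun _ => rfl
    simp only [← ite_not _ F.G F.G',
      (F.coversO_ite_right hab).1, (F.coversO_ite_right hab).2, not_not,
      and_cycLT_middle_iff h.1 h.2.1 h.2.2, leftArc, rightArc]
    rw [mul_right_comm, ite_mul_ite_eq_ite_of_arcs h.1 h.2.1 h.2.2 (by omega) (by omega), mul_comm]
  · rw [SideTransport.factor_of_ne _ ha hb]
    simp [Matrix.algebraMap_matrix_apply, ha, hb]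

/-- Changes of circle only raise the state. -/
theorem weight_eq_zero {i j : Fin 3} (hij : i < j) : F.weight x a b i j = 0 := by
  rw [weight_apply]
  refine ite_eq_right_iff.2 fun hab => ?_
  have hab := hab.1
  have hx := val_apply_ne x hab
  rcases eq_or_ne a F.r with rfl | ha
  · rw [SideTransport.factor_left, F.transport_up_apply (ne_of_val hx)]
    fin_cases i <;> fin_cases j <;> simp at hij ⊢
  rcases eq_or_ne b F.r with rfl | hb
  · rw [SideTransport.factor_right _ ha, F.transport_down_apply (ne_of_val hx)]
    fin_cases i <;> fin_cases j <;> simp at hij ⊢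
  · rw [SideTransport.factor_of_ne _ ha hb]
    simp [Matrix.algebraMap_matrix_apply, hij.ne]

end Monomials
end BrokenCircle
end GridHomology
end

/-! ### Maslov functions along empty boxes -/

noncomputable section
namespace GridHomology
open GridDiagram

section Gradings

variable {n : ℕ}

theorem pairCount_image (f g : Fin n → ℕ × ℕ) (hf : Function.Injective f)
    (hg : Function.Injective g) :
    pairCount (Finset.univ.image f) (Finset.univ.image g) =
      ∑ i, ∑ j, if (f i).1 < (g j).1 ∧ (f i).2 < (g j).2 then (1 : ℤ) else 0 := by
  unfold pairCount
  rw [Finset.natCast_card_filter, Finset.sum_product, Finset.sum_image hf.injOn]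
  exact Finset.sum_congr rfl fun i _ => Finset.sum_image hg.injOn

theorem statePoint_injective (x : GridState n) :
    Function.Injective fun m : Fin n => (2 * (m : ℕ), 2 * (x m : ℕ)) := by
  intro i j h
  simp only [Prod.mk.injEq] at h
  exact Fin.ext (by omega)

theorem markPoint_injective (σ : Equiv.Perm (Fin n)) :
    Function.Injective fun m : Fin n => (2 * (m : ℕ) + 1, 2 * (σ m : ℕ) + 1) := by
  intro i j h
  simp only [Prod.mk.injEq] at h
  exact Fin.ext (by omega)

/-- State points are lower left corners of squares and markings are centres, so comparisons from a
state point to a marking are weak and the reverse ones strict. -/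
theorem maslovOf_eq (σ : Equiv.Perm (Fin n)) (x : GridState n) :
    maslovOf σ x = (∑ i, ∑ j, if i < j ∧ x i < x j then (1 : ℤ) else 0)
      - (∑ i, ∑ c, if i ≤ c ∧ x i ≤ σ c then (1 : ℤ) else 0)
      - (∑ i, ∑ c, if c < i ∧ σ c < x i then (1 : ℤ) else 0)
      + (∑ c, ∑ d, if c < d ∧ σ c < σ d then (1 : ℤ) else 0) + 1 := by
  unfold maslovOf statePoints markPoints
  rw [pairCount_image _ _ (statePoint_injective x) (statePoint_injective x),
    pairCount_image _ _ (statePoint_injective x) (markPoint_injective σ),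
    pairCount_image _ _ (markPoint_injective σ) (statePoint_injective x),
    pairCount_image _ _ (markPoint_injective σ) (markPoint_injective σ),
    Finset.sum_comm (f := fun c i : Fin n => if 2 * (c : ℕ) + 1 < 2 * (i : ℕ) ∧
      2 * (σ c : ℕ) + 1 < 2 * (x i : ℕ) then (1 : ℤ) else 0)]
  have e₁ (i j : ℕ) : 2 * i < 2 * j ↔ i < j := by omega
  have e₂ (i j : ℕ) : 2 * i < 2 * j + 1 ↔ i ≤ j := by omega
  have e₃ (i j : ℕ) : 2 * i + 1 < 2 * j ↔ i < j := by omega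
  have e₄ (i j : ℕ) : 2 * i + 1 < 2 * j + 1 ↔ i < j := by omega
  simp only [e₁, e₂, e₃, e₄, Fin.lt_def, Fin.le_def]

theorem sum_swap_sub_sum {ι : Type*} [Fintype ι] [DecidableEq ι] {a b : ι} (hab : a ≠ b) (f g : ι → ℤ)
    (h : ∀ c, c ≠ a → c ≠ b → f c = g c) : ∑ c, f c - ∑ c, g c = f a + f b - (g a + g b) := by
  rw [sum_eq_add_add_sum_ite hab f, sum_eq_add_add_sum_ite hab g]
  have : (∑ c, if c ≠ a ∧ c ≠ b then f c else 0) = ∑ c, if c ≠ a ∧ c ≠ b then g c else 0 :=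
    Finset.sum_congr rfl fun c _ => ite_congr rfl (fun hc => h c hc.1 hc.2) fun _ => rfl
  rw [this]; ring

theorem sum_sum_swap_sub {ι : Type*} [Fintype ι] [DecidableEq ι] {a b : ι} (hab : a ≠ b)
    (f g : ι → ι → ℤ) (h : ∀ c d, c ≠ a → c ≠ b → d ≠ a → d ≠ b → f c d = g c d)
    (ha : f a a = g a a) (hb : f b b = g b b) :
    ∑ c, ∑ d, f c d - ∑ c, ∑ d, g c d = f a b + f b a - (g a b + g b a) +
      ∑ c, if c ≠ a ∧ c ≠ b then (f a c + f b c + f c a + f c b) - (g a c + g b c + g c a + g c b)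
        else 0 := by
  have key (f : ι → ι → ℤ) : ∑ c, ∑ d, f c d = f a a + f b b + (f a b + f b a) +
      (∑ c, if c ≠ a ∧ c ≠ b then (f a c + f b c + f c a + f c b) else 0) +
      ∑ c, ∑ d, if (c ≠ a ∧ c ≠ b) ∧ (d ≠ a ∧ d ≠ b) then f c d else 0 := by
    simp only [sum_eq_add_add_sum_ite hab (f _)]
    rw [sum_eq_add_add_sum_ite hab]
    have e : ∀ c, (if c ≠ a ∧ c ≠ b then f c a + f c b
          + (∑ d, if d ≠ a ∧ d ≠ b then f c d else 0) else 0) =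
          (if c ≠ a ∧ c ≠ b then f c a else 0) + (if c ≠ a ∧ c ≠ b then f c b else 0) +
          (∑ d, if (c ≠ a ∧ c ≠ b) ∧ d ≠ a ∧ d ≠ b then f c d else 0) := by
      intro c
      by_cases h : c ≠ a ∧ c ≠ b <;> simp [h]
    have e' : ∀ c, (if c ≠ a ∧ c ≠ b then f a c + f b c + f c a + f c b else 0) =
          (if c ≠ a ∧ c ≠ b then f a c else 0) + (if c ≠ a ∧ c ≠ b then f b c else 0) +
          (if c ≠ a ∧ c ≠ b then f c a else 0) + (if c ≠ a ∧ c ≠ b then f c b else 0) := by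
      intro c
      by_cases h : c ≠ a ∧ c ≠ b <;> simp [h]
    simp only [e, e', Finset.sum_add_distrib]
    ring
  have e₁ : (∑ c, ∑ d, if (c ≠ a ∧ c ≠ b) ∧ (d ≠ a ∧ d ≠ b) then f c d else 0) =
      ∑ c, ∑ d, if (c ≠ a ∧ c ≠ b) ∧ (d ≠ a ∧ d ≠ b) then g c d else 0 :=
    Finset.sum_congr rfl fun c _ => Finset.sum_congr rfl fun d _ =>
      ite_congr rfl (fun hc => h c d hc.1.1 hc.1.2 hc.2.1 hc.2.2) fun _ => rfl
  have e₂ : (∑ c, if c ≠ a ∧ c ≠ b then (f a c + f b c + f c a + f c b) - (g a c + g b c + g c a + g c b)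
      else 0) = (∑ c, if c ≠ a ∧ c ≠ b then (f a c + f b c + f c a + f c b) else 0) -
      ∑ c, if c ≠ a ∧ c ≠ b then (g a c + g b c + g c a + g c b) else 0 := by
    rw [← Finset.sum_sub_distrib]
    exact Finset.sum_congr rfl fun c _ => by split_ifs <;> simp
  rw [key f, key g, e₁, e₂, ha, hb]
  ring

/-- The number of state points in the interior of a planar rectangle. -/
def innerCount (x : GridState n) (a b A B : Fin n) : ℤ :=
  ∑ m, if (a < m ∧ m < b) ∧ A < x m ∧ x m < B then 1 else 0

/-- The number of markings in a planar rectangle. -/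
def markCount (σ : Equiv.Perm (Fin n)) (a b A B : Fin n) : ℤ :=
  ∑ c, if (a ≤ c ∧ c < b) ∧ A ≤ σ c ∧ σ c < B then 1 else 0

/-- The pair of corners contributes 1. Each state point inside the rectangle loses a relation to
either corner, and each marking inside changes both mixed counts by one. -/
theorem maslovOf_sub_maslovOf_swap (σ : Equiv.Perm (Fin n)) (x : GridState n) {a b : Fin n}
    (hab : a < b) (hx : x a < x b) :
    maslovOf σ x - maslovOf σ (x * Equiv.swap a b) =
      1 + 2 * innerCount x a b (x a) (x b) - 2 * markCount σ a b (x a) (x b) := by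
  have h₁ := sum_sum_swap_sub hab.ne (fun i j => if i < j ∧ x i < x j then (1 : ℤ) else 0)
    (fun i j => if i < j ∧ (x * Equiv.swap a b) i < (x * Equiv.swap a b) j then (1 : ℤ) else 0)
    (fun c d hca hcb hda hdb => by
      simp only [mul_swap_of_ne x hca hcb, mul_swap_of_ne x hda hdb]) (by simp) (by simp)
  have h₂ := sum_swap_sub_sum hab.ne (fun i => ∑ c, if i ≤ c ∧ x i ≤ σ c then (1 : ℤ) else 0)
    (fun i => ∑ c, if i ≤ c ∧ (x * Equiv.swap a b) i ≤ σ c then (1 : ℤ) else 0)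
    (fun c hca hcb => by simp only [mul_swap_of_ne x hca hcb])
  have h₃ := sum_swap_sub_sum hab.ne (fun i => ∑ c, if c < i ∧ σ c < x i then (1 : ℤ) else 0)
    (fun i => ∑ c, if c < i ∧ σ c < (x * Equiv.swap a b) i then (1 : ℤ) else 0)
    (fun c hca hcb => by simp only [mul_swap_of_ne x hca hcb])
  simp only [mul_swap_left, mul_swap_right] at h₁ h₂ h₃
  have e₁ : (∑ c, if c ≠ a ∧ c ≠ b then
      ((if a < c ∧ x a < x c then (1 : ℤ) else 0) + (if b < c ∧ x b < x c then 1 else 0) +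
        (if c < a ∧ x c < x a then 1 else 0) + (if c < b ∧ x c < x b then 1 else 0)) -
      ((if a < c ∧ x b < (x * Equiv.swap a b) c then 1 else 0) +
        (if b < c ∧ x a < (x * Equiv.swap a b) c then 1 else 0) +
        (if c < a ∧ (x * Equiv.swap a b) c < x b then 1 else 0) +
        (if c < b ∧ (x * Equiv.swap a b) c < x a then 1 else 0)) else 0) =
      2 * innerCount x a b (x a) (x b) := by
    rw [innerCount, Finset.mul_sum]
    refine Finset.sum_congr rfl fun c _ => ?_
    by_cases hc : c ≠ a ∧ c ≠ b
    · have ha := val_ne hc.1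
      have hb := val_ne hc.2
      have ha' := val_apply_ne x hc.1
      have hb' := val_apply_ne x hc.2
      rw [if_pos hc, mul_swap_of_ne x hc.1 hc.2]
      simp only [Fin.lt_def] at *
      have e₁ : (c : ℕ) < a ↔ ¬ ((a : ℕ) < c) := by omega
      have e₂ : (c : ℕ) < b ↔ ¬ ((b : ℕ) < c) := by omega
      have e₃ : (x c : ℕ) < x a ↔ ¬ ((x a : ℕ) < x c) := by omega
      have e₄ : (x c : ℕ) < x b ↔ ¬ ((x b : ℕ) < x c) := by omega
      simp only [e₁, e₂, e₃, e₄]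
      by_cases g₁ : (a : ℕ) < c <;> by_cases g₂ : (b : ℕ) < c <;>
        by_cases g₃ : (x a : ℕ) < x c <;> by_cases g₄ : (x b : ℕ) < x c <;>
        simp [g₁, g₂, g₃, g₄] <;> omega
    · rw [if_neg hc, if_neg, mul_zero]
      rintro ⟨⟨g₁, g₂⟩, -⟩
      exact hc ⟨g₁.ne', g₂.ne⟩
  have e₂ : ((∑ c, if a ≤ c ∧ x a ≤ σ c then (1 : ℤ) else 0) +
      (∑ c, if b ≤ c ∧ x b ≤ σ c then 1 else 0)) -
      ((∑ c, if a ≤ c ∧ x b ≤ σ c then 1 else 0) + (∑ c, if b ≤ c ∧ x a ≤ σ c then 1 else 0)) =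
      markCount σ a b (x a) (x b) := by
    rw [← Finset.sum_add_distrib, ← Finset.sum_add_distrib, ← Finset.sum_sub_distrib]
    refine Finset.sum_congr rfl fun c _ => ?_
    simp only [Fin.lt_def, Fin.le_def] at hab hx ⊢
    by_cases g₁ : (a : ℕ) ≤ c <;> by_cases g₂ : (c : ℕ) < b <;>
      by_cases g₃ : (x a : ℕ) ≤ σ c <;> by_cases g₄ : (σ c : ℕ) < x b <;>
      simp [g₁, g₂, g₃, g₄, ← not_lt] <;> omega
  have e₃ : ((∑ c, if c < a ∧ σ c < x a then (1 : ℤ) else 0) +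
      (∑ c, if c < b ∧ σ c < x b then 1 else 0)) -
      ((∑ c, if c < a ∧ σ c < x b then 1 else 0) + (∑ c, if c < b ∧ σ c < x a then 1 else 0)) =
      markCount σ a b (x a) (x b) := by
    rw [← Finset.sum_add_distrib, ← Finset.sum_add_distrib, ← Finset.sum_sub_distrib]
    refine Finset.sum_congr rfl fun c _ => ?_
    simp only [Fin.lt_def, Fin.le_def] at hab hx ⊢
    by_cases g₁ : (c : ℕ) < a <;> by_cases g₂ : (c : ℕ) < b <;>
      by_cases g₃ : (σ c : ℕ) < x a <;> by_cases g₄ : (σ c : ℕ) < x b <;>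
      simp [g₁, g₂, g₃, g₄, ← not_lt] <;> omega
  rw [e₁] at h₁
  rw [e₂] at h₂
  rw [e₃] at h₃
  simp only [hab, hx, hab.not_gt, hx.not_gt, and_self, and_true, and_false, if_true, if_false] at h₁
  rw [maslovOf_eq, maslovOf_eq]
  linarith

/-- The number of markings in a box on the torus. -/
def boxCount (σ : Equiv.Perm (Fin n)) (x : GridState n) (a b : Fin n) : ℤ :=
  ∑ c : Fin n, if CycLT (2 * a) (2 * c + 1) (2 * b) ∧ CycLT (4 * x a) (4 * σ c + 2) (4 * x b) then 1 else 0

theorem sum_Ico {u w : Fin n} (h : u ≤ w) : ∑ c, (if u ≤ c ∧ c < w then (1 : ℤ) else 0) = w - u := by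
  rw [Finset.sum_boole]
  have : (Finset.univ.filter fun c => u ≤ c ∧ c < w) = Finset.Ico u w := by ext; simp
  rw [this, Fin.card_Ico, Nat.cast_sub h]

theorem sum_Ioo {u w : Fin n} (h : u < w) :
    ∑ c, (if u < c ∧ c < w then (1 : ℤ) else 0) = w - u - 1 := by
  rw [Finset.sum_boole]
  have : (Finset.univ.filter fun c => u < c ∧ c < w) = Finset.Ioo u w := by ext; simp
  have h' : (u : ℕ) < w := h
  rw [this, Fin.card_Ioo]
  omega

theorem sum_Icc {u w : Fin n} (h : u ≤ w) :
    ∑ c, (if u ≤ c ∧ c ≤ w then (1 : ℤ) else 0) = w - u + 1 := by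
  rw [Finset.sum_boole]
  have : (Finset.univ.filter fun c => u ≤ c ∧ c ≤ w) = Finset.Icc u w := by ext; simp
  have h' : (u : ℕ) ≤ w := h
  rw [this, Fin.card_Icc]
  omega

/-- The Maslov function along an empty box. -/
theorem maslovOf_mul_swap (σ : Equiv.Perm (Fin n)) (x : GridState n) {a b : Fin n} (hab : a ≠ b)
    (he : IsEmptyBox x (a, b)) :
    maslovOf σ (x * Equiv.swap a b) = maslovOf σ x - 1 + 2 * boxCount σ x a b := by
  have h0 : ∑ m : Fin n, (if CycLT a m b ∧ CycLT (x a) (x m) (x b) then (1 : ℤ) else 0) = 0 :=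
    Finset.sum_eq_zero fun m _ => if_neg (he m)
  have hx : x a ≠ x b := fun h => hab (x.injective h)
  have e₂ (i j : ℕ) : 2 * i < 2 * j + 1 ↔ i ≤ j := by omega
  have e₃ (i j : ℕ) : 2 * i + 1 < 2 * j ↔ i < j := by omega
  have e₄ (i j : ℕ) : 4 * i < 4 * j + 2 ↔ i ≤ j := by omega
  have e₅ (i j : ℕ) : 4 * i + 2 < 4 * j ↔ i < j := by omega
  have ex (f : Fin n → ℤ) : ∑ c, f (x c) = ∑ c, f c := Equiv.sum_comp x f
  have eσ (f : Fin n → ℤ) : ∑ c, f (σ c) = ∑ c, f c := Equiv.sum_comp σ f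
  have inner' (A B : Fin n) {lo hi : Fin n} (h : (lo = a ∧ hi = b) ∨ (lo = b ∧ hi = a)) :
      innerCount (x * Equiv.swap a b) lo hi A B = innerCount x lo hi A B := by
    refine Finset.sum_congr rfl fun m _ => ?_
    rcases eq_or_ne m a with rfl | ha
    · rcases h with ⟨rfl, rfl⟩ | ⟨rfl, rfl⟩ <;> simp
    rcases eq_or_ne m b with rfl | hb
    · rcases h with ⟨rfl, rfl⟩ | ⟨rfl, rfl⟩ <;> simp
    · rw [mul_swap_of_ne x ha hb]
  -- According to whether the box wraps around horizontally or vertically, it is compared with a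
  -- planar rectangle on the same two circles and rows.
  rcases lt_or_gt_of_ne hab with h | h <;> rcases lt_or_gt_of_ne hx with h' | h'
  · have key := maslovOf_sub_maslovOf_swap σ x h h'
    have c₁ : boxCount σ x a b = markCount σ a b (x a) (x b) := by
      refine Finset.sum_congr rfl fun c _ => if_congr ?_ rfl rfl
      simp only [CycLT, e₂, e₃, e₄, e₅, Fin.lt_def, Fin.le_def] at *
      omega
    have c₂ : innerCount x a b (x a) (x b) = 0 := by
      rw [← h0]
      refine Finset.sum_congr rfl fun c _ => if_congr ?_ rfl rfl
      simp only [CycLT, Fin.lt_def] at *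
      omega
    rw [c₁]; rw [c₂] at key; linarith
  -- If only the heights wrap around, the complement of the box in its vertical strip is a planar
  -- rectangle leading back from the terminal state. Emptiness puts all state points strictly inside
  -- the strip into it.
  · have key := maslovOf_sub_maslovOf_swap σ (x * Equiv.swap a b) h (by simpa using h')
    rw [mul_assoc, Equiv.swap_mul_self, mul_one, mul_swap_left, mul_swap_right,
      inner' _ _ (Or.inl ⟨rfl, rfl⟩)] at key
    have c₁ : boxCount σ x a b = b - a - markCount σ a b (x b) (x a) := by
      rw [← sum_Ico h.le, boxCount, markCount, ← Finset.sum_sub_distrib]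
      refine Finset.sum_congr rfl fun c _ => ?_
      simp only [CycLT, e₂, e₃, e₄, e₅, Fin.lt_def, Fin.le_def] at h h' ⊢
      split_ifs <;> omega
    have c₂ : innerCount x a b (x b) (x a) = b - a - 1 := by
      suffices e : innerCount x a b (x b) (x a) =
          (∑ c : Fin n, if a < c ∧ c < b then (1 : ℤ) else 0) -
          ∑ m : Fin n, if CycLT a m b ∧ CycLT (x a) (x m) (x b) then (1 : ℤ) else 0 by
        rw [e, h0, sub_zero, sum_Ioo h]
      rw [innerCount, ← Finset.sum_sub_distrib]
      refine Finset.sum_congr rfl fun c _ => ?_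
      have e : c ≠ a → c ≠ b → (x c : ℕ) ≠ x a ∧ (x c : ℕ) ≠ x b :=
        fun h₁ h₂ => ⟨val_apply_ne x h₁, val_apply_ne x h₂⟩
      simp only [CycLT, Fin.lt_def, ne_eq, Fin.ext_iff] at h h' e ⊢
      split_ifs <;> omega
    rw [c₁]; rw [c₂] at key; linarith
  · have key := maslovOf_sub_maslovOf_swap σ (x * Equiv.swap a b) h (by simpa using h')
    rw [Equiv.swap_comm b a, mul_assoc, Equiv.swap_mul_self, mul_one, mul_swap_left, mul_swap_right,
      inner' _ _ (Or.inr ⟨rfl, rfl⟩)] at key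
    have c₁ : boxCount σ x a b = x b - x a - markCount σ b a (x a) (x b) := by
      rw [← sum_Ico h'.le, boxCount, markCount, ← eσ fun c => if x a ≤ c ∧ c < x b then 1 else 0,
        ← Finset.sum_sub_distrib]
      refine Finset.sum_congr rfl fun c _ => ?_
      simp only [CycLT, e₂, e₃, e₄, e₅, Fin.lt_def, Fin.le_def] at h h' ⊢
      split_ifs <;> omega
    have c₂ : innerCount x b a (x a) (x b) = x b - x a - 1 := by
      suffices e : innerCount x b a (x a) (x b) =
          (∑ c : Fin n, if x a < x c ∧ x c < x b then (1 : ℤ) else 0) -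
          ∑ m : Fin n, if CycLT a m b ∧ CycLT (x a) (x m) (x b) then (1 : ℤ) else 0 by
        rw [e, h0, sub_zero, ex fun c => if x a < c ∧ c < x b then (1 : ℤ) else 0, sum_Ioo h']
      rw [innerCount, ← Finset.sum_sub_distrib]
      refine Finset.sum_congr rfl fun c _ => ?_
      have e₁ : c = a → (x c : ℕ) = x a := fun h => by rw [h]
      have e₂ : c = b → (x c : ℕ) = x b := fun h => by rw [h]
      simp only [CycLT, Fin.lt_def, Fin.ext_iff] at h h' e₁ e₂ ⊢
      split_ifs <;> omega
    rw [c₁]; rw [c₂] at key; linarith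
  · have key := maslovOf_sub_maslovOf_swap σ x h h'
    rw [Equiv.swap_comm b a] at key
    have hn : ∑ c : Fin n, (1 : ℤ) = n := by simp
    -- If both directions wrap around, the box is what lies outside the vertical and the horizontal
    -- strip of the planar rectangle, and inclusion–exclusion applies.
    have c₁ : boxCount σ x a b = n - (a - b) - (x a - x b) + markCount σ b a (x b) (x a) := by
      rw [← sum_Ico h.le, ← sum_Ico h'.le, ← hn, boxCount, markCount,
        ← eσ (fun c => if x b ≤ c ∧ c < x a then 1 else 0), ← Finset.sum_sub_distrib,
        ← Finset.sum_sub_distrib, ← Finset.sum_add_distrib]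
      refine Finset.sum_congr rfl fun c _ => ?_
      simp only [CycLT, e₂, e₃, e₄, e₅, Fin.lt_def, Fin.le_def] at h h' ⊢
      split_ifs <;> omega
    have c₂ : innerCount x b a (x b) (x a) = (a - b + 1) + (x a - x b + 1) - 2 - n := by
      have ha : ∑ c : Fin n, (if c = a then (1 : ℤ) else 0) = 1 := by simp
      have hb : ∑ c : Fin n, (if c = b then (1 : ℤ) else 0) = 1 := by simp
      have e : innerCount x b a (x b) (x a) =
          (∑ c : Fin n, if b ≤ c ∧ c ≤ a then (1 : ℤ) else 0) +
          (∑ c, if x b ≤ x c ∧ x c ≤ x a then (1 : ℤ) else 0) -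
          (∑ c : Fin n, if c = a then (1 : ℤ) else 0) - (∑ c : Fin n, if c = b then (1 : ℤ) else 0) -
          (∑ c : Fin n, (1 : ℤ)) +
          ∑ m : Fin n, if CycLT a m b ∧ CycLT (x a) (x m) (x b) then (1 : ℤ) else 0 := by
        rw [innerCount]
        simp only [← Finset.sum_sub_distrib, ← Finset.sum_add_distrib]
        refine Finset.sum_congr rfl fun c _ => ?_
        have e₁ : c = a ↔ (x c : ℕ) = x a := by rw [← Fin.ext_iff, x.apply_eq_iff_eq]
        have e₂ : c = b ↔ (x c : ℕ) = x b := by rw [← Fin.ext_iff, x.apply_eq_iff_eq]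
        simp only [CycLT, Fin.lt_def, Fin.le_def, Fin.ext_iff] at h h' e₁ e₂ ⊢
        rcases lt_trichotomy (c : ℕ) a with g | g | g <;>
        rcases lt_trichotomy (c : ℕ) b with g' | g' | g' <;>
        split_ifs <;> omega
      rw [e, ha, hb, hn, h0, sum_Icc h.le, ex (fun c => if x b ≤ c ∧ c ≤ x a then 1 else 0),
        sum_Icc h'.le]
      ring
    rw [c₁]; rw [c₂] at key; linarith

end Gradings
end GridHomology
end

/-! ### Maslov shifts of pentagons and hexagons -/

noncomputable section
namespace GridHomology
open GridDiagram

section CrossingGradings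

variable {n : ℕ}

/-- The sign which tells on which of the two arcs between the heights `u` and `w` the height `h`
lies. -/
def arcSign (u h w : ℕ) : ℤ := if CycLT u h w then 1 else -1

/-- The effect on the Maslov function of an interchange of the markings of consecutive columns. -/
theorem maslovOf_mul_swap_columns (σ : Equiv.Perm (Fin n)) (x : GridState n) {l r : Fin n}
    (hlr : (r : ℕ) = l + 1) :
    maslovOf (σ * Equiv.swap l r) x =
      maslovOf σ x + arcSign (4 * σ l + 2) (4 * x r) (4 * σ r + 2) := by
  have hne : l ≠ r := ne_of_val (by omega)
  have hσ : (σ l : ℕ) ≠ σ r := val_apply_ne σ hne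
  have h₁ := sum_sum_swap_sub hne (fun i j => if i < j ∧ σ i < σ j then (1 : ℤ) else 0)
    (fun i j => if i < j ∧ (σ * Equiv.swap l r) i < (σ * Equiv.swap l r) j then (1 : ℤ) else 0)
    (fun c d hca hcb hda hdb => by
      simp only [mul_swap_of_ne σ hca hcb, mul_swap_of_ne σ hda hdb]) (by simp) (by simp)
  have h₂ := sum_swap_sub_sum hne (fun c => ∑ i, if i ≤ c ∧ x i ≤ σ c then (1 : ℤ) else 0)
    (fun c => ∑ i, if i ≤ c ∧ x i ≤ (σ * Equiv.swap l r) c then (1 : ℤ) else 0)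
    (fun c hca hcb => by simp only [mul_swap_of_ne σ hca hcb])
  have h₃ := sum_swap_sub_sum hne (fun c => ∑ i, if c < i ∧ σ c < x i then (1 : ℤ) else 0)
    (fun c => ∑ i, if c < i ∧ (σ * Equiv.swap l r) c < x i then (1 : ℤ) else 0)
    (fun c hca hcb => by simp only [mul_swap_of_ne σ hca hcb])
  simp only [mul_swap_left, mul_swap_right] at h₁ h₂ h₃
  have e₁ : (∑ c, if c ≠ l ∧ c ≠ r then
      ((if l < c ∧ σ l < σ c then (1 : ℤ) else 0) + (if r < c ∧ σ r < σ c then 1 else 0) +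
        (if c < l ∧ σ c < σ l then 1 else 0) + (if c < r ∧ σ c < σ r then 1 else 0)) -
      ((if l < c ∧ σ r < (σ * Equiv.swap l r) c then 1 else 0) +
        (if r < c ∧ σ l < (σ * Equiv.swap l r) c then 1 else 0) +
        (if c < l ∧ (σ * Equiv.swap l r) c < σ r then 1 else 0) +
        (if c < r ∧ (σ * Equiv.swap l r) c < σ l then 1 else 0)) else 0) = 0 := by
    refine Finset.sum_eq_zero fun c _ => ?_
    by_cases hc : c ≠ l ∧ c ≠ r
    swap
    · rw [if_neg hc]
    rw [if_pos hc, mul_swap_of_ne σ hc.1 hc.2]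
    have ha := val_ne hc.1
    have hb := val_ne hc.2
    have e₁ : r < c ↔ l < c := by rw [Fin.lt_def, Fin.lt_def]; omega
    have e₂ : c < r ↔ c < l := by rw [Fin.lt_def, Fin.lt_def]; omega
    simp only [e₁, e₂]
    ring
  -- Only the state point on the circle `r` separates the two columns; the terms of all others
  -- cancel. The same holds in `e₃`.
  have e₂ : ((∑ i, if i ≤ l ∧ x i ≤ σ l then (1 : ℤ) else 0) +
      (∑ i, if i ≤ r ∧ x i ≤ σ r then 1 else 0)) -
      ((∑ i, if i ≤ l ∧ x i ≤ σ r then 1 else 0) + (∑ i, if i ≤ r ∧ x i ≤ σ l then 1 else 0)) =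
      (if x r ≤ σ r then 1 else 0) - (if x r ≤ σ l then 1 else 0) := by
    rw [← Finset.sum_add_distrib, ← Finset.sum_add_distrib, ← Finset.sum_sub_distrib,
      Finset.sum_eq_single r]
    · simp only [le_refl, true_and, (by rw [Fin.le_def]; omega : ¬ r ≤ l), false_and, if_false]
      ring
    · intro i _ hi
      have := val_ne hi
      have e : i ≤ r ↔ i ≤ l := by rw [Fin.le_def, Fin.le_def]; omega
      simp only [e]
      ring
    · simp
  have e₃ : ((∑ i, if l < i ∧ σ l < x i then (1 : ℤ) else 0) +
      (∑ i, if r < i ∧ σ r < x i then 1 else 0)) -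
      ((∑ i, if l < i ∧ σ r < x i then 1 else 0) + (∑ i, if r < i ∧ σ l < x i then 1 else 0)) =
      (if σ l < x r then 1 else 0) - (if σ r < x r then 1 else 0) := by
    rw [← Finset.sum_add_distrib, ← Finset.sum_add_distrib, ← Finset.sum_sub_distrib,
      Finset.sum_eq_single r]
    · simp only [lt_irrefl, true_and, (by rw [Fin.lt_def]; omega : l < r), false_and, if_false]
      ring
    · intro i _ hi
      have := val_ne hi
      have e : r < i ↔ l < i := by rw [Fin.lt_def, Fin.lt_def]; omega
      simp only [e]
      ring
    · simp
  rw [e₁] at h₁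
  rw [e₂] at h₂
  rw [e₃] at h₃
  rw [Finset.sum_comm, Finset.sum_comm (f := fun c i =>
    if i ≤ c ∧ x i ≤ (σ * Equiv.swap l r) c then (1 : ℤ) else 0)] at h₂
  rw [Finset.sum_comm, Finset.sum_comm (f := fun c i =>
    if c < i ∧ (σ * Equiv.swap l r) c < x i then (1 : ℤ) else 0)] at h₃
  simp only [(by rw [Fin.lt_def]; omega : l < r), (by rw [Fin.lt_def]; omega : ¬ r < l), true_and,
    false_and, if_false, add_zero] at h₁
  rw [maslovOf_eq, maslovOf_eq]
  have e₄ : arcSign (4 * σ l + 2) (4 * x r) (4 * σ r + 2) =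
      (if x r ≤ σ r then (1 : ℤ) else 0) - (if x r ≤ σ l then 1 else 0) +
      ((if σ l < x r then 1 else 0) - (if σ r < x r then 1 else 0)) -
      ((if σ l < σ r then 1 else 0) - (if σ r < σ l then 1 else 0)) := by
    unfold arcSign CycLT
    simp only [Fin.lt_def, Fin.le_def]
    split_ifs <;> omega
  rw [e₄]
  linarith

/-- The number of markings in a polygon whose vertical sides run, at the height of row `ρ`, along
vertical circles of the diagram with the markings `side ρ`. -/
def sideCount (side : Fin n → Equiv.Perm (Fin n)) (x : GridState n) (a b : Fin n) : ℤ :=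
  ∑ ρ : Fin n, if CycLT (4 * x a) (4 * ρ + 2) (4 * x b) ∧
    CycLT (2 * a) (2 * (side ρ).symm ρ + 1) (2 * b) then 1 else 0

theorem sideCount_nonneg (side : Fin n → Equiv.Perm (Fin n)) (x : GridState n) (a b : Fin n) :
    0 ≤ sideCount side x a b :=
  Finset.sum_nonneg fun _ _ => by split_ifs <;> norm_num

theorem sideCount_const (σ : Equiv.Perm (Fin n)) (x : GridState n) (a b : Fin n) :
    sideCount (fun _ => σ) x a b = boxCount σ x a b := by
  unfold sideCount boxCount
  rw [← Equiv.sum_comp σ]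
  simp only [Equiv.symm_apply_apply, and_comm]

variable (σ : Equiv.Perm (Fin n)) (x : GridState n) {a b l r : Fin n} (P : Fin n → Prop)
  [DecidablePred P]

/-- Replacing the special circle on part of the rows only affects the two rows whose markings are
moved by the interchange. -/
theorem sideCount_sub (hlr : (r : ℕ) = l + 1) :
    sideCount (fun ρ => if P ρ then σ else σ * Equiv.swap l r) x a b - boxCount σ x a b =
      (if CycLT (4 * x a) (4 * σ l + 2) (4 * x b) ∧ ¬ P (σ l) then
        arcInd (2 * a) (2 * r + 1) (2 * b) - (arcInd (2 * a) (2 * l + 1) (2 * b) : ℤ) else 0) +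
      (if CycLT (4 * x a) (4 * σ r + 2) (4 * x b) ∧ ¬ P (σ r) then
        arcInd (2 * a) (2 * l + 1) (2 * b) - (arcInd (2 * a) (2 * r + 1) (2 * b) : ℤ) else 0) := by
  have hne : l ≠ r := ne_of_val (by omega)
  have hσ : σ l ≠ σ r := ne_of_val (val_apply_ne σ hne)
  have e₁ : (σ * Equiv.swap l r).symm (σ l) = r := by
    rw [Equiv.symm_apply_eq, Equiv.Perm.mul_apply, Equiv.swap_apply_right]
  have e₂ : (σ * Equiv.swap l r).symm (σ r) = l := by
    rw [Equiv.symm_apply_eq, Equiv.Perm.mul_apply, Equiv.swap_apply_left]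
  rw [← sideCount_const, sideCount, sideCount, sum_swap_sub_sum hσ]
  · by_cases h₁ : P (σ l) <;> by_cases h₂ : P (σ r) <;>
    by_cases h₃ : CycLT (4 * x a) (4 * σ l + 2) (4 * x b) <;>
    by_cases h₄ : CycLT (4 * x a) (4 * σ r + 2) (4 * x b) <;>
    simp [h₁, h₂, h₃, h₄, e₁, e₂, arcInd] <;> ring
  · intro ρ h₁ h₂
    have e : (σ * Equiv.swap l r).symm ρ = σ.symm ρ := by
      rw [Equiv.symm_apply_eq, Equiv.Perm.mul_apply, Equiv.swap_apply_of_ne_of_ne,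
        Equiv.apply_symm_apply]
      · rwa [ne_eq, Equiv.symm_apply_eq]
      · rwa [ne_eq, Equiv.symm_apply_eq]
    by_cases h : P ρ <;> simp [h, e]

theorem arcInd_column_left (hlr : (r : ℕ) = l + 1) (hb : r ≠ b) :
    arcInd (2 * r) (2 * r + 1) (2 * b) = 1 ∧ arcInd (2 * r) (2 * l + 1) (2 * b) = 0 := by
  have := val_ne hb
  unfold arcInd CycLT
  constructor <;> simp <;> omega

theorem arcInd_column_right (hlr : (r : ℕ) = l + 1) (ha : a ≠ r) :
    arcInd (2 * a) (2 * r + 1) (2 * r) = 0 ∧ arcInd (2 * a) (2 * l + 1) (2 * r) = 1 := by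
  have := val_ne ha
  unfold arcInd CycLT
  constructor <;> simp <;> omega

/-- Moving the test height from `p` to `h` changes the sign exactly when the markings at `u` and `w`
are separated by the arc passed over. -/
theorem arcSign_sub {u w h p : ℕ} (huh : u ≠ h) (hwh : w ≠ h) (hup : u ≠ p)
    (hwp : w ≠ p) (hhp : h ≠ p) :
    arcSign u p w - 2 * (arcInd h u p - (arcInd h w p : ℤ)) = arcSign u h w := by
  unfold arcSign arcInd
  simp only [Nat.cast_ite, Nat.cast_one, Nat.cast_zero]
  split_ifs <;> unfold CycLT at * <;> omega

/-- A pentagon is compared with the rectangle of `G` on the same circles, followed by the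
interchange of columns. The sign from the interchange is taken at the terminal corner on the special
circle; the markings between that corner and `h`, counted differently by pentagon and rectangle,
move it to `h` by `arcSign_sub`. -/
theorem maslovOf_pentagon (D : CrossingChange n) (π : GridDiagram n → Equiv.Perm (Fin n))
    {G G' : GridDiagram n} (hπ : π G' = π G * Equiv.swap D.left D.right) (h : ℕ) (hh : h % 2 = 1)
    (hab : a ≠ b) (hr : a = D.right ∨ b = D.right) (harc : CycLT (4 * x a) h (4 * x b))
    (he : IsEmptyBox x (a, b)) :
    maslovOf (π G') (x * Equiv.swap a b) -
        2 * sideCount (fun ρ => π (D.pentagonSide G G' h x (a, b) ρ)) x a b =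
      maslovOf (π G) x - 1 + arcSign (4 * π G D.left + 2) h (4 * π G D.right + 2) := by
  have hlr := D.cross.1
  have hne : D.left ≠ D.right := ne_of_val (by omega)
  have hσ : (π G D.left : ℕ) ≠ π G D.right := val_apply_ne _ hne
  have hx := val_apply_ne x hab
  rw [hπ, maslovOf_mul_swap_columns _ _ hlr, maslovOf_mul_swap _ _ hab he]
  rcases hr with rfl | rfl
  · have e : (fun ρ => π (D.pentagonSide G G' h x (D.right, b) ρ)) = fun ρ : Fin n =>
        if CycLT (4 * x D.right) (4 * ρ + 2) h then π G else π G * Equiv.swap D.left D.right := by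
      funext ρ
      simp only [CrossingChange.pentagonSide, if_true, apply_ite π, hπ]
    have key := sideCount_sub (π G) x (a := D.right) (b := b)
      (fun ρ => CycLT (4 * x D.right) (4 * ρ + 2) h) hlr
    obtain ⟨c₁, c₂⟩ := arcInd_column_left hlr hab
    rw [c₁, c₂] at key
    push_cast at key
    simp only [BrokenCircle.and_not_cycLT_iff harc
      (show 4 * (π G D.left : ℕ) + 2 ≠ h by omega), BrokenCircle.and_not_cycLT_iff harc
      (show 4 * (π G D.right : ℕ) + 2 ≠ h by omega)] at key
    have := arcSign_sub (u := 4 * π G D.left + 2) (w := 4 * π G D.right + 2) (h := h) (p := 4 * x b)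
      (by omega) (by omega) (by omega) (by omega) (by omega)
    rw [mul_swap_left, e, ← this]
    unfold arcInd
    push_cast
    split_ifs at key ⊢ <;> linarith
  · have e : (fun ρ => π (D.pentagonSide G G' h x (a, D.right) ρ)) = fun ρ : Fin n =>
        if ¬ CycLT (4 * x a) (4 * ρ + 2) h then π G else π G * Equiv.swap D.left D.right := by
      funext ρ
      rw [ite_not]
      simp only [CrossingChange.pentagonSide, hab, if_false, apply_ite π, hπ]
    have key := sideCount_sub (π G) x (a := a) (b := D.right)
      (fun ρ => ¬ CycLT (4 * x a) (4 * ρ + 2) h) hlr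
    obtain ⟨c₁, c₂⟩ := arcInd_column_right hlr hab
    rw [c₁, c₂] at key
    push_cast at key
    simp only [not_not, BrokenCircle.and_cycLT_iff harc] at key
    have h₁ := SideTransport.arcInd_add_arcInd_swap (a := 4 * x a) (b := h) (m := 4 * π G D.left + 2)
      (by omega) (by omega) (by omega)
    have h₂ := SideTransport.arcInd_add_arcInd_swap (a := 4 * x a) (b := h) (m := 4 * π G D.right + 2)
      (by omega) (by omega) (by omega)
    have := arcSign_sub (u := 4 * π G D.left + 2) (w := 4 * π G D.right + 2) (h := h) (p := 4 * x a)
      (by omega) (by omega) (by omega) (by omega) (by omega)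
    rw [mul_swap_right, e, ← this]
    unfold arcInd at *
    push_cast at *
    split_ifs at * <;> omega

/-- Only the middle part of the broken side counts markings differently from a rectangle of `G`. On
a right side this is the complementary arc and the columns exchange roles, which yields the same
difference. -/
theorem maslovOf_hexagon (D : CrossingChange n) (π : GridDiagram n → Equiv.Perm (Fin n))
    {G G' : GridDiagram n} (hπ : π G' = π G * Equiv.swap D.left D.right) (h₁ h₂ : ℕ)
    (hh₁ : h₁ % 2 = 1) (hh₂ : h₂ % 2 = 1) (hne : h₁ ≠ h₂)
    (hab : a ≠ b) (hr : a = D.right ∨ b = D.right)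
    (harc₁ : CycLT (4 * x a) (D.lowerCorner h₁ h₂ (a, b)) (D.upperCorner h₁ h₂ (a, b)))
    (harc₂ : CycLT (D.lowerCorner h₁ h₂ (a, b)) (D.upperCorner h₁ h₂ (a, b)) (4 * x b))
    (harc₃ : CycLT (4 * x a) (D.upperCorner h₁ h₂ (a, b)) (4 * x b))
    (he : IsEmptyBox x (a, b)) :
    maslovOf (π G) (x * Equiv.swap a b) -
        2 * sideCount (fun ρ => π (D.hexagonSide G G' h₁ h₂ (a, b) ρ)) x a b =
      maslovOf (π G) x - 1 - 2 * (arcInd h₂ (4 * π G D.left + 2) h₁ -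
        arcInd h₂ (4 * π G D.right + 2) h₁) := by
  have hlr := D.cross.1
  have hx := val_apply_ne x hab
  rw [maslovOf_mul_swap _ _ hab he]
  have e : (fun ρ => π (D.hexagonSide G G' h₁ h₂ (a, b) ρ)) = fun ρ : Fin n =>
      if ¬ CycLT (D.lowerCorner h₁ h₂ (a, b)) (4 * ρ + 2) (D.upperCorner h₁ h₂ (a, b)) then π G
      else π G * Equiv.swap D.left D.right := by
    funext ρ
    rw [ite_not]
    simp only [CrossingChange.hexagonSide, apply_ite π, hπ]
  have key := sideCount_sub (π G) x (a := a) (b := b) (fun ρ =>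
    ¬ CycLT (D.lowerCorner h₁ h₂ (a, b)) (4 * ρ + 2) (D.upperCorner h₁ h₂ (a, b))) hlr
  simp only [not_not, BrokenCircle.and_cycLT_middle_iff harc₁ harc₂ harc₃] at key
  rw [e]
  rcases hr with rfl | rfl
  · obtain ⟨c₁, c₂⟩ := arcInd_column_left hlr hab
    rw [c₁, c₂] at key
    push_cast at key
    simp only [CrossingChange.lowerCorner, CrossingChange.upperCorner, if_true] at key ⊢
    unfold arcInd
    push_cast
    split_ifs at key ⊢ <;> linarith
  · obtain ⟨c₁, c₂⟩ := arcInd_column_right hlr hab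
    rw [c₁, c₂] at key
    push_cast at key
    simp only [CrossingChange.lowerCorner, CrossingChange.upperCorner, hab, if_false] at key ⊢
    have g₁ := SideTransport.arcInd_add_arcInd_swap (a := h₁) (b := h₂) (m := 4 * π G D.left + 2)
      (by omega) (by omega) (by omega)
    have g₂ := SideTransport.arcInd_add_arcInd_swap (a := h₁) (b := h₂) (m := 4 * π G D.right + 2)
      (by omega) (by omega) (by omega)
    unfold arcInd at *
    push_cast at *
    split_ifs at * <;> omega

end CrossingGradings
end GridHomology
end

/-! ### Homogeneity and the position of the two intersection points -/

noncomputable section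
namespace GridHomology
open GridDiagram

section Homogeneity

variable {n : ℕ}

theorem monomialOf_eq_monomial (side : Fin n → GridDiagram n) (x : GridState n) (p : Fin n × Fin n) :
    ∃ e : Fin n →₀ ℕ, monomialOf side x p = MvPolynomial.monomial e 1 ∧
      (e.degree : ℤ) = sideCount (fun ρ => (side ρ).O) x p.1 p.2 := by
  refine ⟨∑ ρ, Finsupp.single ρ (if CoversO (side ρ) x p ρ then 1 else 0), ?_, ?_⟩
  · rw [MvPolynomial.monomial_sum_one]
    exact Finset.prod_congr rfl fun ρ _ => MvPolynomial.X_pow_eq_monomial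
  · rw [map_sum]
    simp only [Finsupp.degree_single, Nat.cast_sum, Nat.cast_ite, Nat.cast_one, Nat.cast_zero]
    rfl

theorem map_single_monomial {G G' : GridDiagram n} (f : G.Complex →ₗ[BaseRing n] G'.Complex)
    (x : GridState n) (k : Fin n →₀ ℕ) :
    f (Finsupp.single x (MvPolynomial.monomial k 1)) =
      (MvPolynomial.monomial k 1 : BaseRing n) • f (Finsupp.single x 1) := by
  rw [← map_smul, Finsupp.smul_single, smul_eq_mul, mul_one]

/-- A map that counts polygons is homogeneous if the polygons shift the Maslov functions of the
`O`s and of the `X`s by constants. -/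
theorem homogeneousOfDegree_of_maslovOf {G G' : GridDiagram n}
    (f : G.Complex →ₗ[BaseRing n] G'.Complex) {m k t : ℤ}
    (P : GridState n → GridState n → Finset (Fin n × Fin n))
    (side : GridState n → Fin n × Fin n → Fin n → GridDiagram n)
    (hf : ∀ x, f (Finsupp.single x 1) =
      ∑ y, ∑ p ∈ P x y, Finsupp.single y (monomialOf (side x p) x p))
    (hO : ∀ x y, ∀ p ∈ P x y,
      maslovOf G'.O y - 2 * sideCount (fun ρ => (side x p ρ).O) x p.1 p.2 = maslovOf G.O x + m)
    (hX : ∀ x y, ∀ p ∈ P x y,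
      maslovOf G'.X y - 2 * sideCount (fun ρ => (side x p ρ).X) x p.1 p.2 = maslovOf G.X x + k)
    (hm : m - k ≤ 2 * t) : HomogeneousOfDegree G G' f m t := by
  have image (x : GridState n) (e : Fin n →₀ ℕ) (S : Submodule (ZMod 2) G'.Complex)
      (hS : ∀ y, ∀ p ∈ P x y, ∀ e' : Fin n →₀ ℕ,
        (e'.degree : ℤ) = e.degree + sideCount (fun ρ => (side x p ρ).O) x p.1 p.2 →
        Finsupp.single y (MvPolynomial.monomial e' 1) ∈ S) :
      f (Finsupp.single x (MvPolynomial.monomial e 1)) ∈ S := by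
    rw [map_single_monomial, hf, Finset.smul_sum]
    refine Submodule.sum_mem _ fun y _ => ?_
    rw [Finset.smul_sum]
    refine Submodule.sum_mem _ fun p hp => ?_
    obtain ⟨e', h₁, h₂⟩ := monomialOf_eq_monomial (side x p) x p
    rw [h₁, Finsupp.smul_single, smul_eq_mul, MvPolynomial.monomial_mul, mul_one]
    exact hS y p hp _ (by rw [map_add, ← h₂]; push_cast; rfl)
  constructor
  · intro d z hz
    have : G.gradedPart d ≤ (G'.gradedPart (d + m)).comap (f.restrictScalars (ZMod 2)) := by
      refine Submodule.span_le.2 ?_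
      rintro _ ⟨e, x, hd, rfl⟩
      refine image x e (G'.gradedPart (d + m)) fun y p hp e' he' => Submodule.subset_span ⟨e', y, ?_, rfl⟩
      have := hO x y p hp
      unfold maslov at hd ⊢
      linarith
    exact this hz
  · intro d z hz
    have : G.filtration d ≤ (G'.filtration (d + t)).comap (f.restrictScalars (ZMod 2)) := by
      refine Submodule.span_le.2 ?_
      rintro _ ⟨e, x, hd, rfl⟩
      refine image x e (G'.filtration (d + t)) fun y p hp e' he' => Submodule.subset_span ⟨e', y, ?_, rfl⟩
      have h₁ : (maslovOf G'.O y : ℚ) = maslovOf G.O x + m + 2 * (e'.degree - e.degree) := by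
        have := hO x y p hp
        have h : maslovOf G'.O y = maslovOf G.O x + m + 2 * (e'.degree - e.degree) := by linarith
        exact_mod_cast h
      -- The variables do not record the `X`s, so passing over `X`s can only lower the Alexander
      -- level; this is why the map is filtered and not graded.
      have h₂ : (maslovOf G.X x : ℚ) + k ≤ maslovOf G'.X y := by
        have := hX x y p hp
        have := sideCount_nonneg (fun ρ => (side x p ρ).X) x p.1 p.2
        have h : maslovOf G.X x + k ≤ maslovOf G'.X y := by linarith
        exact_mod_cast h
      have h₃ : (m : ℚ) - k ≤ 2 * t := by exact_mod_cast hm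
      unfold alexander at hd ⊢
      push_cast
      linarith
    exact this hz

end Homogeneity

namespace CrossingChange

variable {n : ℕ} (D : CrossingChange n)

theorem left_ne_right : D.left ≠ D.right := ne_of_val (by have := D.cross.1; omega)

theorem two_le (D : CrossingChange n) : 2 ≤ n := by have := D.cross.1; omega

theorem minus_left : D.minus.O D.left = D.plus.O D.right ∧ D.minus.X D.left = D.plus.X D.right := by
  rw [D.cross.2.1, D.cross.2.2.1]
  simp

theorem minus_right : D.minus.O D.right = D.plus.O D.left ∧ D.minus.X D.right = D.plus.X D.left := by
  rw [D.cross.2.1, D.cross.2.2.1]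
  simp

theorem plus_O : D.plus.O = D.minus.O * Equiv.swap D.left D.right := by
  rw [D.cross.2.1, mul_assoc, Equiv.swap_mul_self, mul_one]

theorem plus_X : D.plus.X = D.minus.X * Equiv.swap D.left D.right := by
  rw [D.cross.2.2.1, mul_assoc, Equiv.swap_mul_self, mul_one]

/-- Going up from the left `O` one meets the right `X`, the left `X` and the right `O`; by the
choice of `s`, it comes before the right `X` or after the left `X`, for either naming of the `O`s.
-/
theorem s_mem_O : CycLT (4 * D.plus.O D.left + 2) D.s (4 * D.plus.O D.right + 2) := by
  have h₁ := D.positive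
  have h₂ := D.s_between
  unfold PositiveAt CycLT at h₁
  unfold CycLT at *
  omega

theorem s_mem_X : CycLT (4 * D.plus.X D.left + 2) D.s (4 * D.plus.X D.right + 2) := by
  have h₁ := D.positive
  have h₂ := D.s_between
  unfold PositiveAt CycLT at h₁
  unfold CycLT at *
  omega

theorem t_not_mem_O : ¬ CycLT (4 * D.plus.O D.right + 2) D.t (4 * D.plus.O D.left + 2) := by
  have h₁ := D.positive
  have h₂ := D.t_between
  unfold PositiveAt CycLT at h₁
  unfold CycLT at *
  omega

theorem s_ne_t : D.s ≠ D.t := by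
  have h₁ := D.s_mem_X
  have h₂ := D.t_between
  unfold CycLT at *
  omega

theorem X_right_mem : CycLT D.s (4 * D.plus.X D.right + 2) D.t := by
  have h₁ := D.s_mem_X
  have h₂ := D.t_between
  unfold CycLT at *
  omega

theorem X_left_mem : CycLT D.t (4 * D.plus.X D.left + 2) D.s := by
  have h₁ := D.s_mem_X
  have h₂ := D.t_between
  unfold CycLT at *
  omega

/-- The arc from `s` to `t` contains both or none of the `O`s of the two columns. -/
theorem O_arc :
    (D.o₁ = D.plus.O D.left ∧ CycLT D.s (4 * D.plus.O D.right + 2) D.t ∧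
      CycLT D.s (4 * D.plus.O D.left + 2) D.t) ∨
    (D.o₁ = D.plus.O D.right ∧ CycLT D.t (4 * D.plus.O D.right + 2) D.s ∧
      CycLT D.t (4 * D.plus.O D.left + 2) D.s) := by
  have h₁ := D.positive
  have h₂ := D.t_between
  have h₃ := D.s_between
  have h₄ := val_apply_ne D.plus.O D.left_ne_right
  unfold PositiveAt CycLT at h₁
  rcases D.o_mem with ⟨h₅, h₆⟩ | ⟨h₅, h₆⟩
  · left
    refine ⟨h₅, ?_⟩
    rcases h₃ with ⟨-, h₃⟩ | ⟨h₃, -⟩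
    · unfold CycLT at *
      omega
    · rw [h₃] at h₆
      exact absurd (congrArg Fin.val h₆) h₄
  · right
    refine ⟨h₅, ?_⟩
    rcases h₃ with ⟨h₃, -⟩ | ⟨-, h₃⟩
    · rw [h₃] at h₆
      exact absurd (congrArg Fin.val h₆).symm h₄
    · unfold CycLT at *
      omega

end CrossingChange
end GridHomology
end

/-! ### Matrix entries as operators -/

noncomputable section
namespace GridHomology
open GridDiagram

section Counting

variable {n : ℕ}

/-- A box determines its terminal state, so the sum over the states collapses. -/
theorem sum_sum_filter_boxes (x : GridState n) (Q : Fin n × Fin n → Prop) [DecidablePred Q]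
    (w : Fin n × Fin n → BaseRing n) :
    ∑ y, ∑ p ∈ (boxes x y).filter Q, Finsupp.single y (w p) =
      ∑ a, ∑ b, Finsupp.single (x * Equiv.swap a b) (if a ≠ b ∧ Q (a, b) then w (a, b) else 0) := by
  rw [← Fintype.sum_prod_type' (f := fun a b =>
    Finsupp.single (x * Equiv.swap a b) (if a ≠ b ∧ Q (a, b) then w (a, b) else 0))]
  simp only [boxes, Finset.filter_filter, Finset.sum_filter]
  rw [Finset.sum_comm]
  refine Finset.sum_congr rfl fun p _ => ?_
  by_cases h : p.1 ≠ p.2 ∧ Q p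
  · rw [if_pos h, Finset.sum_eq_single (x * Equiv.swap p.1 p.2)]
    · rw [if_pos ⟨⟨h.1, rfl⟩, h.2⟩]
    · exact fun y _ hy => if_neg fun h' => hy h'.1.2
    · simp
  · rw [if_neg h, Finsupp.single_zero]
    exact Finset.sum_eq_zero fun y _ => if_neg fun h' => h ⟨h'.1.1, h'.2⟩

theorem linearMap_ext_single {f g : (GridState n →₀ BaseRing n) →ₗ[BaseRing n] GridState n →₀ BaseRing n}
    (h : ∀ x, f (Finsupp.single x 1) = g (Finsupp.single x 1)) : f = g :=
  Finsupp.lhom_ext' fun x => LinearMap.ext_ring (h x)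

end Counting

section Paths

variable {R : Type*} [CommRing R]

/-- Only one summand is nonzero, depending on which of `s` and `t` is lower. In both cases the
second circle is used from `s` up to `t` in the cyclic sense and the first circle on the rest. -/
theorem pathMatrix_two_zero_add {s t u w N : ℕ} (p q : R) (hst : s ≠ t) (hs : s < N) (ht : t < N)
    (hu : u < N) (hw : w < N) (hus : u ≠ s) (hut : u ≠ t) (hws : w ≠ s) (hwt : w ≠ t) :
    pathMatrix (fun h => if h = u then p else 1) (fun h => if h = w then q else 1) s t 0 N 2 0 +
      pathMatrix (fun h => if h = w then q else 1) (fun h => if h = u then p else 1) t s 0 N 2 0 =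
    (if CycLT s u t then 1 else p) * (if CycLT s w t then q else 1) := by
  rw [pathMatrix_eq _ _ hst (if_neg hus.symm) (if_neg hws.symm) (if_neg hut.symm)
      (if_neg hwt.symm) (Nat.zero_le N),
    pathMatrix_eq _ _ hst.symm (if_neg hwt.symm) (if_neg hut.symm) (if_neg hws.symm)
      (if_neg hus.symm) (Nat.zero_le N)]
  simp only [Matrix.of_apply, Matrix.cons_val, Finset.prod_ite_eq', Finset.mem_Ico, Nat.zero_le,
    true_and, hs, ht, and_true]
  rcases lt_or_gt_of_ne hst with h | h
  · rw [if_pos h, if_neg h.not_gt, add_zero]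
    have e₁ : CycLT s u t ↔ s ≤ u ∧ u < t := by unfold CycLT; omega
    have e₂ : CycLT s w t ↔ s ≤ w ∧ w < t := by unfold CycLT; omega
    simp only [e₁, e₂]
    split_ifs <;> first | (exfalso; omega) | ring
  · rw [if_pos h, if_neg h.not_gt, zero_add]
    have e₁ : CycLT s u t ↔ ¬ (t ≤ u ∧ u < s) := by unfold CycLT; omega
    have e₂ : CycLT s w t ↔ ¬ (t ≤ w ∧ w < s) := by unfold CycLT; omega
    simp only [e₁, e₂]
    split_ifs <;> first | (exfalso; omega) | ring

end Paths

namespace BrokenCircle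

variable {n : ℕ} (F : BrokenCircle n)

/-- The operator which counts the empty boxes with an entry of their matrices of weights. -/
def count (i j : Fin 3) : (GridState n →₀ BaseRing n) →ₗ[BaseRing n] GridState n →₀ BaseRing n :=
  Finsupp.linearCombination (BaseRing n) fun x : GridState n =>
    ∑ a, ∑ b, Finsupp.single (x * Equiv.swap a b) (F.weight x a b i j)

theorem count_single (i j : Fin 3) (x : GridState n) : F.count i j (Finsupp.single x 1) =
    ∑ a, ∑ b, Finsupp.single (x * Equiv.swap a b) (F.weight x a b i j) := by
  rw [count, Finsupp.linearCombination_single, one_smul]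

theorem count_single' (i j : Fin 3) (x : GridState n) (z : BaseRing n) :
    F.count i j (Finsupp.single x z) =
    ∑ a, ∑ b, Finsupp.single (x * Equiv.swap a b) (F.weight x a b i j * z) := by
  rw [count, Finsupp.linearCombination_single, Finset.smul_sum]
  simp only [Finset.smul_sum, Finsupp.smul_single, smul_eq_mul, mul_comm]

theorem count_eq_zero {i j : Fin 3} (hij : i < j) : F.count i j = 0 :=
  linearMap_ext_single fun x => by
    simp only [count_single, F.weight_eq_zero hij, Finsupp.single_zero, Finset.sum_const_zero,
      LinearMap.zero_apply]

/-- This is the entry `(i, j)` of the matrix identity for the square of the box count; matrix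
multiplication becomes composition because the later box multiplies on the left. -/
theorem sum_count_comp_count {z : BaseRing n}
    (hz : pathMatrix F.leftWeight F.rightWeight F.s F.t 0 (4 * n) 2 0 +
      pathMatrix F.rightWeight F.leftWeight F.t F.s 0 (4 * n) 2 0 = z) (hn : 2 ≤ n) (i j : Fin 3) :
    ∑ k, F.count i k ∘ₗ F.count k j =
      (!![0, 0, 0; 0, 0, 0; z, 0, 0] : Matrix (Fin 3) (Fin 3) (BaseRing n)) i j • LinearMap.id := by
  refine linearMap_ext_single fun x => ?_
  have h := congrArg (Finsupp.mapRange.addMonoidHom (Matrix.entryAddMonoidHom (BaseRing n) i j))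
    (F.sum_single_weight_mul_weight hn hz x)
  simp only [map_sum, Finsupp.mapRange.addMonoidHom_apply, Finsupp.mapRange_single,
    Matrix.entryAddMonoidHom_apply] at h
  rw [LinearMap.smul_apply, LinearMap.id_apply, Finsupp.smul_single, smul_eq_mul, mul_one, ← h]
  simp only [LinearMap.sum_apply, LinearMap.comp_apply, map_sum, count_single',
    Matrix.mul_apply]
  rw [Finset.sum_comm]
  refine Finset.sum_congr rfl fun a _ => ?_
  rw [Finset.sum_comm]
  refine Finset.sum_congr rfl fun b _ => ?_
  rw [Finset.sum_comm]
  refine Finset.sum_congr rfl fun c _ => ?_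
  rw [Finset.sum_comm]
  refine Finset.sum_congr rfl fun d _ => ?_
  simp only [mul_one]
  exact (map_sum (Finsupp.singleAddHom _) _ _).symm

theorem count_diag {side : GridDiagram n} {i : Fin 3}
    (hi : (i = 1 ∧ side = F.G') ∨ (i ≠ 1 ∧ side = F.G)) : F.count i i = side.differential := by
  refine linearMap_ext_single fun x => ?_
  rw [count_single, differential, Finsupp.linearCombination_single, one_smul]
  simp only [F.weight_diag side i hi]
  exact (sum_sum_filter_boxes x _ _).symm

theorem linearMap_add_self
    (f : (GridState n →₀ BaseRing n) →ₗ[BaseRing n] GridState n →₀ BaseRing n) : f + f = 0 := by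
  ext
  simp [baseRing_add_self]

theorem count_one_zero_comm {z : BaseRing n}
    (hz : pathMatrix F.leftWeight F.rightWeight F.s F.t 0 (4 * n) 2 0 +
      pathMatrix F.rightWeight F.leftWeight F.t F.s 0 (4 * n) 2 0 = z) (hn : 2 ≤ n) :
    F.count 1 0 ∘ₗ F.G.differential = F.G'.differential ∘ₗ F.count 1 0 := by
  have h := F.sum_count_comp_count hz hn 1 0
  rw [Fin.sum_univ_three, F.count_eq_zero (show (1 : Fin 3) < 2 by decide),
    F.count_diag (Or.inr ⟨zero_ne_one, rfl⟩), F.count_diag (Or.inl ⟨rfl, rfl⟩)] at h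
  simp only [Matrix.of_apply, Matrix.cons_val, LinearMap.zero_comp, add_zero, zero_smul] at h
  exact (eq_neg_of_add_eq_zero_left h).trans (neg_eq_of_add_eq_zero_left (linearMap_add_self _))

theorem count_two_one_comm {z : BaseRing n}
    (hz : pathMatrix F.leftWeight F.rightWeight F.s F.t 0 (4 * n) 2 0 +
      pathMatrix F.rightWeight F.leftWeight F.t F.s 0 (4 * n) 2 0 = z) (hn : 2 ≤ n) :
    F.count 2 1 ∘ₗ F.G'.differential = F.G.differential ∘ₗ F.count 2 1 := by
  have h := F.sum_count_comp_count hz hn 2 1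
  rw [Fin.sum_univ_three, F.count_eq_zero (show (0 : Fin 3) < 1 by decide),
    F.count_diag (i := 2) (Or.inr ⟨by decide, rfl⟩), F.count_diag (Or.inl ⟨rfl, rfl⟩)] at h
  simp only [Matrix.of_apply, Matrix.cons_val, LinearMap.comp_zero, zero_add, zero_smul] at h
  exact (eq_neg_of_add_eq_zero_left h).trans (neg_eq_of_add_eq_zero_left (linearMap_add_self _))

/-- In entry (2,0) the intermediate state is 0, 1 or 2: differential before the hexagons, two
pentagons, or differential after the hexagons. Signs do not matter in characteristic 2. -/
theorem count_two_zero_homotopy {z : BaseRing n}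
    (hz : pathMatrix F.leftWeight F.rightWeight F.s F.t 0 (4 * n) 2 0 +
      pathMatrix F.rightWeight F.leftWeight F.t F.s 0 (4 * n) 2 0 = z) (hn : 2 ≤ n) :
    F.G.differential ∘ₗ F.count 2 0 + F.count 2 0 ∘ₗ F.G.differential =
      F.count 2 1 ∘ₗ F.count 1 0 - z • LinearMap.id := by
  have h := F.sum_count_comp_count hz hn 2 0
  rw [Fin.sum_univ_three, F.count_diag (i := 2) (Or.inr ⟨by decide, rfl⟩),
    F.count_diag (i := 0) (Or.inr ⟨by decide, rfl⟩)] at h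
  simp only [Matrix.of_apply, Matrix.cons_val] at h
  have e := linearMap_add_self
    (F.G.differential ∘ₗ F.count 2 0 + F.count 2 0 ∘ₗ F.G.differential)
  refine (neg_eq_of_add_eq_zero_left e).symm.trans ?_
  rw [← h]
  abel

end BrokenCircle
end GridHomology
end

/-! ### Application to the crossing change -/

noncomputable section
namespace GridHomology
open GridDiagram

namespace CrossingChange

variable {n : ℕ} (D : CrossingChange n)

/-- The special circle of `plus`, broken at `s` and `t`. -/
def plusCircle : BrokenCircle n where
  G := D.plus
  G' := D.minus
  l := D.left
  r := D.right
  succ := D.cross.1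
  swap_O := D.cross.2.1
  s := D.s
  t := D.t
  s_odd := D.s_odd
  t_odd := D.t_odd
  s_lt := D.s_lt
  t_lt := D.t_lt
  ne := D.s_ne_t

/-- The special circle of `minus`, broken at `t` and `s`. -/
def minusCircle : BrokenCircle n where
  G := D.minus
  G' := D.plus
  l := D.left
  r := D.right
  succ := D.cross.1
  swap_O := D.plus_O
  s := D.t
  t := D.s
  s_odd := D.t_odd
  t_odd := D.s_odd
  s_lt := D.t_lt
  t_lt := D.s_lt
  ne := D.s_ne_t.symm

/-- The right `O` counts outside the arc from `s` to `t` and the left one inside it. By `O_arc`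
exactly one of them counts, and it is `O_1`. -/
theorem pathMatrix_plusCircle :
    pathMatrix D.plusCircle.leftWeight D.plusCircle.rightWeight D.s D.t 0 (4 * n) 2 0 +
      pathMatrix D.plusCircle.rightWeight D.plusCircle.leftWeight D.t D.s 0 (4 * n) 2 0 =
    MvPolynomial.X D.o₁ := by
  have hs := D.s_odd
  have ht := D.t_odd
  refine Eq.trans (pathMatrix_two_zero_add (u := 4 * D.plus.O D.right + 2)
    (w := 4 * D.plus.O D.left + 2) (MvPolynomial.X (D.plus.O D.right) : BaseRing n)
    (MvPolynomial.X (D.plus.O D.left)) D.s_ne_t D.s_lt D.t_lt (by omega) (by omega) (by omega)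
    (by omega) (by omega) (by omega)) ?_
  rcases D.O_arc with ⟨h, h₁, h₂⟩ | ⟨h, h₁, h₂⟩
  · rw [h, if_pos h₁, if_pos h₂, one_mul]
  · rw [h, if_neg h₁.rotate.rotate.not_swap, if_neg h₂.rotate.rotate.not_swap, mul_one]

theorem pathMatrix_minusCircle :
    pathMatrix D.minusCircle.leftWeight D.minusCircle.rightWeight D.t D.s 0 (4 * n) 2 0 +
      pathMatrix D.minusCircle.rightWeight D.minusCircle.leftWeight D.s D.t 0 (4 * n) 2 0 =
    MvPolynomial.X D.o₁ := by
  have h₁ : D.minusCircle.leftWeight = D.plusCircle.rightWeight := by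
    funext h
    change (if h = 4 * (D.minus.O D.right : ℕ) + 2 then MvPolynomial.X (D.minus.O D.right) else 1) =
      if h = 4 * (D.plus.O D.left : ℕ) + 2 then MvPolynomial.X (D.plus.O D.left) else (1 : BaseRing n)
    rw [D.minus_right.1]
  have h₂ : D.minusCircle.rightWeight = D.plusCircle.leftWeight := by
    funext h
    change (if h = 4 * (D.minus.O D.left : ℕ) + 2 then MvPolynomial.X (D.minus.O D.left) else 1) =
      if h = 4 * (D.plus.O D.right : ℕ) + 2 then MvPolynomial.X (D.plus.O D.right) else (1 : BaseRing n)
    rw [D.minus_left.1]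
  rw [h₁, h₂, add_comm, pathMatrix_plusCircle]

theorem plusCircle_count_one_zero (x : GridState n) :
    D.plusCircle.count 1 0 (Finsupp.single x 1) =
      ∑ y, ∑ p ∈ D.pentS x y, Finsupp.single y (D.pentSMonomial x p) := by
  rw [BrokenCircle.count_single]
  simp only [D.plusCircle.weight_one_zero D rfl, pentS, emptyPentagons,
    sum_sum_filter_boxes]
  rfl

theorem plusCircle_count_two_one (x : GridState n) :
    D.plusCircle.count 2 1 (Finsupp.single x 1) =
      ∑ y, ∑ p ∈ D.pentT x y, Finsupp.single y (D.pentTMonomial x p) := by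
  rw [BrokenCircle.count_single]
  simp only [D.plusCircle.weight_two_one D rfl, pentT, emptyPentagons,
    sum_sum_filter_boxes]
  rfl

theorem plusCircle_count_two_zero (x : GridState n) :
    D.plusCircle.count 2 0 (Finsupp.single x 1) =
      ∑ y, ∑ p ∈ D.hexTS x y, Finsupp.single y (D.hexTSMonomial x p) := by
  rw [BrokenCircle.count_single]
  simp only [D.plusCircle.weight_two_zero D rfl, hexTS, emptyHexagons,
    sum_sum_filter_boxes]
  rfl

/-- Seen from `minus`, the first change takes place at `t` and leads to `plus`, which is the second
change seen from `plus`. So the same pentagons are counted. -/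
theorem minusCircle_count_one_zero : D.minusCircle.count 1 0 = D.plusCircle.count 2 1 := by
  refine linearMap_ext_single fun x => ?_
  rw [plusCircle_count_two_one, BrokenCircle.count_single]
  simp only [D.minusCircle.weight_one_zero D rfl, pentT, emptyPentagons,
    sum_sum_filter_boxes]
  rfl

theorem minusCircle_count_two_one : D.minusCircle.count 2 1 = D.plusCircle.count 1 0 := by
  refine linearMap_ext_single fun x => ?_
  rw [plusCircle_count_one_zero, BrokenCircle.count_single]
  simp only [D.minusCircle.weight_two_one D rfl, pentS, emptyPentagons,
    sum_sum_filter_boxes]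
  rfl

theorem minusCircle_count_two_zero (x : GridState n) :
    D.minusCircle.count 2 0 (Finsupp.single x 1) =
      ∑ y, ∑ p ∈ D.hexST x y, Finsupp.single y (D.hexSTMonomial x p) := by
  rw [BrokenCircle.count_single]
  simp only [D.minusCircle.weight_two_zero D rfl, hexST, emptyHexagons,
    sum_sum_filter_boxes]
  rfl

theorem maslovOf_emptyPentagons (π : GridDiagram n → Equiv.Perm (Fin n)) {G G' : GridDiagram n}
    (hπ : π G' = π G * Equiv.swap D.left D.right) {h : ℕ} (hh : h % 2 = 1) {x y : GridState n}
    {p : Fin n × Fin n} (hp : p ∈ D.emptyPentagons h x y) :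
    maslovOf (π G') y - 2 * sideCount (fun ρ => π (D.pentagonSide G G' h x p ρ)) x p.1 p.2 =
      maslovOf (π G) x + (arcSign (4 * π G D.left + 2) h (4 * π G D.right + 2) - 1) := by
  obtain ⟨a, b⟩ := p
  simp only [emptyPentagons, boxes, Finset.mem_filter, Finset.mem_univ, true_and] at hp
  obtain ⟨⟨hab, rfl⟩, hr, harc, he⟩ := hp
  have := maslovOf_pentagon x D π hπ h hh hab hr harc he
  linarith

theorem maslovOf_emptyHexagons (π : GridDiagram n → Equiv.Perm (Fin n)) {G G' : GridDiagram n}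
    (hπ : π G' = π G * Equiv.swap D.left D.right) {h₁ h₂ : ℕ} (hh₁ : h₁ % 2 = 1)
    (hh₂ : h₂ % 2 = 1) (hne : h₁ ≠ h₂) {x y : GridState n} {p : Fin n × Fin n}
    (hp : p ∈ D.emptyHexagons h₁ h₂ x y) :
    maslovOf (π G) y - 2 * sideCount (fun ρ => π (D.hexagonSide G G' h₁ h₂ p ρ)) x p.1 p.2 =
      maslovOf (π G) x + (2 * (arcInd h₂ (4 * π G D.right + 2) h₁ -
        arcInd h₂ (4 * π G D.left + 2) h₁) - 1) := by
  obtain ⟨a, b⟩ := p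
  simp only [emptyHexagons, boxes, Finset.mem_filter, Finset.mem_univ, true_and] at hp
  obtain ⟨⟨hab, rfl⟩, hr, harc₁, harc₂, harc₃, he⟩ := hp
  have := maslovOf_hexagon x D π hπ h₁ h₂ hh₁ hh₂ hne hab hr harc₁ harc₂ harc₃ he
  linarith

theorem homogeneousOfDegree_pentagons {G G' : GridDiagram n}
    (hO : G'.O = G.O * Equiv.swap D.left D.right) (hX : G'.X = G.X * Equiv.swap D.left D.right)
    {h : ℕ} (hh : h % 2 = 1) (f : G.Complex →ₗ[BaseRing n] G'.Complex)
    (hf : ∀ x, f (Finsupp.single x 1) = ∑ y, ∑ p ∈ D.emptyPentagons h x y,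
      Finsupp.single y (monomialOf (D.pentagonSide G G' h x p) x p)) {m t : ℤ}
    (hm : arcSign (4 * G.O D.left + 2) h (4 * G.O D.right + 2) - 1 = m)
    (ht : m - (arcSign (4 * G.X D.left + 2) h (4 * G.X D.right + 2) - 1) ≤ 2 * t) :
    HomogeneousOfDegree G G' f m t :=
  homogeneousOfDegree_of_maslovOf f _ _ hf
    (fun _ _ _ hp => hm ▸ D.maslovOf_emptyPentagons GridDiagram.O hO hh hp)
    (fun _ _ _ hp => D.maslovOf_emptyPentagons GridDiagram.X hX hh hp) ht

theorem homogeneousOfDegree_hexagons {G G' : GridDiagram n}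
    (hO : G'.O = G.O * Equiv.swap D.left D.right) (hX : G'.X = G.X * Equiv.swap D.left D.right)
    {h₁ h₂ : ℕ} (hh₁ : h₁ % 2 = 1) (hh₂ : h₂ % 2 = 1) (hne : h₁ ≠ h₂)
    (f : G.Complex →ₗ[BaseRing n] G.Complex)
    (hf : ∀ x, f (Finsupp.single x 1) = ∑ y, ∑ p ∈ D.emptyHexagons h₁ h₂ x y,
      Finsupp.single y (monomialOf (D.hexagonSide G G' h₁ h₂ p) x p)) {m t : ℤ}
    (hm : 2 * ((arcInd h₂ (4 * G.O D.right + 2) h₁ : ℤ) - arcInd h₂ (4 * G.O D.left + 2) h₁) - 1 = m)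
    (ht : m - (2 * ((arcInd h₂ (4 * G.X D.right + 2) h₁ : ℤ) -
      arcInd h₂ (4 * G.X D.left + 2) h₁) - 1) ≤ 2 * t) :
    HomogeneousOfDegree G G f m t :=
  homogeneousOfDegree_of_maslovOf f _ (fun _ p => D.hexagonSide G G' h₁ h₂ p) hf
    (fun _ _ _ hp => hm ▸ D.maslovOf_emptyHexagons GridDiagram.O hO hh₁ hh₂ hne hp)
    (fun _ _ _ hp => D.maslovOf_emptyHexagons GridDiagram.X hX hh₁ hh₂ hne hp) ht

/-- The point `s` lies on the arc from the left to the right marking for the `O`s and for the `X`s,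
so neither Maslov function is shifted. -/
theorem homogeneousOfDegree_pentS :
    HomogeneousOfDegree D.plus D.minus (D.plusCircle.count 1 0) 0 0 := by
  refine D.homogeneousOfDegree_pentagons D.cross.2.1 D.cross.2.2.1 D.s_odd _
    D.plusCircle_count_one_zero ?_ ?_
  · rw [arcSign, if_pos D.s_mem_O, sub_self]
  · rw [arcSign, if_pos D.s_mem_X, sub_self, sub_self, mul_zero]

/-- In `minus` the columns are exchanged. The point `t` is off the relevant arc for the `O`s, giving
-2, but on it for the `X`s, giving 0; half the difference is the filtration degree. -/
theorem homogeneousOfDegree_pentT :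
    HomogeneousOfDegree D.minus D.plus (D.plusCircle.count 2 1) (-2) (-1) := by
  refine D.homogeneousOfDegree_pentagons D.plus_O D.plus_X D.t_odd _
    D.plusCircle_count_two_one ?_ ?_
  · rw [D.minus_left.1, D.minus_right.1, arcSign, if_neg D.t_not_mem_O]
    norm_num
  · rw [D.minus_left.2, D.minus_right.2, arcSign, if_pos D.t_between]
    norm_num

theorem arcInd_O : arcInd D.s (4 * D.plus.O D.right + 2) D.t =
      arcInd D.s (4 * D.plus.O D.left + 2) D.t ∧
    arcInd D.t (4 * D.plus.O D.right + 2) D.s = arcInd D.t (4 * D.plus.O D.left + 2) D.s := by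
  unfold arcInd
  rcases D.O_arc with ⟨-, h₁, h₂⟩ | ⟨-, h₁, h₂⟩ <;>
  simp only [h₁, h₂, h₁.rotate.rotate.not_swap, h₂.rotate.rotate.not_swap, and_self]

/-- The arc from `s` to `t` treats both `O`s alike, which leaves the shift -1. It contains the right
`X` but not the left one, so the shift for the `X`s is 1. -/
theorem homogeneousOfDegree_hexTS :
    HomogeneousOfDegree D.plus D.plus (D.plusCircle.count 2 0) (-1) (-1) := by
  refine D.homogeneousOfDegree_hexagons D.cross.2.1 D.cross.2.2.1 D.t_odd D.s_odd D.s_ne_t.symm _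
    D.plusCircle_count_two_zero ?_ ?_
  · rw [D.arcInd_O.1]
    norm_num
  · rw [arcInd, arcInd, if_pos D.X_right_mem, if_neg D.X_left_mem.rotate.rotate.not_swap]
    norm_num

theorem homogeneousOfDegree_hexST :
    HomogeneousOfDegree D.minus D.minus (D.minusCircle.count 2 0) (-1) (-1) := by
  refine D.homogeneousOfDegree_hexagons D.plus_O D.plus_X D.s_odd D.t_odd D.s_ne_t _
    D.minusCircle_count_two_zero ?_ ?_
  · rw [D.minus_left.1, D.minus_right.1, D.arcInd_O.2]
    norm_num
  · rw [D.minus_left.2, D.minus_right.2, arcInd, arcInd, if_pos D.X_left_mem,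
      if_neg D.X_right_mem.rotate.rotate.not_swap]
    norm_num

end CrossingChange
end GridHomology
end

theorem theorem1p2 {n : ℕ} (D : GridHomology.CrossingChange n) (hK : D.plus.IsKnot) :
    ∃ (Cminus : D.plus.Complex →ₗ[GridHomology.BaseRing n] D.minus.Complex)
      (Cplus : D.minus.Complex →ₗ[GridHomology.BaseRing n] D.plus.Complex)
      (Hplus : D.plus.Complex →ₗ[GridHomology.BaseRing n] D.plus.Complex)
      (Hminus : D.minus.Complex →ₗ[GridHomology.BaseRing n] D.minus.Complex),
      (∀ x : GridHomology.GridState n, Cminus (Finsupp.single x 1) =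
        ∑ y : GridHomology.GridState n, ∑ p ∈ D.pentS x y,
          Finsupp.single y (D.pentSMonomial x p)) ∧
      (∀ x : GridHomology.GridState n, Cplus (Finsupp.single x 1) =
        ∑ y : GridHomology.GridState n, ∑ p ∈ D.pentT x y,
          Finsupp.single y (D.pentTMonomial x p)) ∧
      (∀ x : GridHomology.GridState n, Hplus (Finsupp.single x 1) =
        ∑ y : GridHomology.GridState n, ∑ p ∈ D.hexTS x y,
          Finsupp.single y (D.hexTSMonomial x p)) ∧
      (∀ x : GridHomology.GridState n, Hminus (Finsupp.single x 1) =
        ∑ y : GridHomology.GridState n, ∑ p ∈ D.hexST x y,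
          Finsupp.single y (D.hexSTMonomial x p)) ∧
      GridHomology.GridDiagram.IsChainMap D.plus D.minus Cminus ∧
      GridHomology.GridDiagram.HomogeneousOfDegree D.plus D.minus Cminus 0 0 ∧
      GridHomology.GridDiagram.IsChainMap D.minus D.plus Cplus ∧
      GridHomology.GridDiagram.HomogeneousOfDegree D.minus D.plus Cplus (-2) (-1) ∧
      GridHomology.GridDiagram.IsFilteredHomotopy D.plus D.plus Hplus (Cplus ∘ₗ Cminus)
        ((MvPolynomial.X D.o₁ : GridHomology.BaseRing n) • LinearMap.id) (-2) (-1) ∧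
      GridHomology.GridDiagram.IsFilteredHomotopy D.minus D.minus Hminus (Cminus ∘ₗ Cplus)
        ((MvPolynomial.X D.o₁ : GridHomology.BaseRing n) • LinearMap.id) (-2) (-1) := by
  refine ⟨D.plusCircle.count 1 0, D.plusCircle.count 2 1, D.plusCircle.count 2 0,
    D.minusCircle.count 2 0, D.plusCircle_count_one_zero, D.plusCircle_count_two_one,
    D.plusCircle_count_two_zero, D.minusCircle_count_two_zero,
    D.plusCircle.count_one_zero_comm D.pathMatrix_plusCircle D.two_le,
    D.homogeneousOfDegree_pentS,
    D.plusCircle.count_two_one_comm D.pathMatrix_plusCircle D.two_le,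
    D.homogeneousOfDegree_pentT,
    ⟨D.plusCircle.count_two_zero_homotopy D.pathMatrix_plusCircle D.two_le,
      D.homogeneousOfDegree_hexTS⟩, ?_, D.homogeneousOfDegree_hexST⟩
  -- The homotopy equation of the circle of `minus`, with its pentagon operators identified with
  -- those of `plus` in exchanged roles.
  have h := D.minusCircle.count_two_zero_homotopy D.pathMatrix_minusCircle D.two_le
  rw [D.minusCircle_count_one_zero, D.minusCircle_count_two_one] at h
  exact h
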